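/- Notation. For $r\ge 0$, elements of $\mathbb C(z)^r$ are row vectors. A subspace $W\subseteq\mathbb C(z)^r$ is fat if $p\,\mathbb C[z]^r\subseteq W\subseteq q^{-1}\mathbb C[z]^r$ for some nonzero polynomials $p,q$; it is primary decomposable if, for some nonzero polynomial $q$, $qW$ is an intersection (inside $\mathbb C[z]^r$) of finitely many subspaces each of which contains $(z-c)^k\mathbb C[z]^r$ for some $c\in\mathbb C$, $k\ge 0$. Let $M_W$ be the set of row vectors $(D_1,\dots,D_r)$ with entries in $\mathbb C(z)[\partial_z]$ such that $(D_1.p,\dots,D_r.p)\in W$ for all $p\in\mathbb C[z]$, and let $L_W\subseteq\mathbb C(z)^r$ be the set of leading coefficients of elements of $M_W$, together with $0$. The adelic Grassmannian $\mathrm{Gr}^{ad}(r)$ is the set of fat primary decomposable $W\subseteq\mathbb C(z)^r$ with $L_W=\mathbb C[z]^r$. For fat $W$ let $\overline W=W+p\,\mathcal O(\mathbb C)^r$, where $p\neq0$ is any polynomial with $p\,\mathbb C[z]^r\subseteq W$ and $\mathcal O(\mathbb C)$ is the ring of entire functions of $z$. A stationary Baker function of $W$ is an $r\times r$ matrix $\psi_W(x,z)=\bigl(I+\sum_{n\ge1}a_n(x)z^{-n}\bigr)e^{xz}$,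 where the $a_n$ have entries in $\mathbb C(x)$, such that for all but finitely many $x\in\mathbb C$ all $a_n$ are regular at $x$, the series in brackets is the expansion at $z=\infty$ of a matrix of rational functions of $z$, and each row of $\psi_W(x,\cdot)$ belongs to $\overline W$. Put $K_W=I+\sum_{n\ge1}a_n(x)\partial_x^{-n}$, a matrix over the ring $\mathbb C(x)((\partial_x^{-1}))$ of formal pseudodifferential operators, so that $\psi_W=K_W.e^{xz}$. For matrices $\varphi$ of functions and $D$ of differential operators put $(\varphi\star D)_{ij}=\sum_k D_{kj}.\varphi_{ik}$, that is, $\varphi\star D=(D^t.\varphi^t)^t$. For $D=\sum_k f_k(z)\partial_z^k\in\mathbb C(z)[\partial_z]$ put $b(D)=\sum_k x^k f_k(\partial_x)\in\mathbb C(x)((\partial_x^{-1}))$, the $f_k(\partial_x)$ being expanded in powers of $\partial_x^{-1}$; for matrices $b$ is applied entrywise. Statement. Let $U\in\mathrm{Gr}^{ad}(r)$ and $V\in\mathrm{Gr}^{ad}(s)$. Then $U$ and $V$ have unique stationary Baker functions $\psi_U$, $\psi_V$, and $K_V$ is invertible. Let $D$ be an $r\times s$ matrix with entries in $\mathbb C(z)[\partial_z]$.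 The following are equivalent: (i) $U\star D\subseteq V$; (ii) there is an $r\times s$ matrix $\Theta(x)$ with entries in $\mathbb C(x)[\partial_x]$ such that $\psi_U(x,z)\star D(z)=\Theta(x).\psi_V(x,z)$; (iii) the $r\times s$ matrix operator $K_U\,b(D)(x)\,K_V^{-1}$ is differential, that is, its entries belong to $\mathbb C(x)[\partial_x]$. Furthermore, the matrix $\Theta$ is uniquely determined by the formula in (ii), and coincides with the operator $K_U\,b(D)(x)\,K_V^{-1}$ in (iii). -/

import Mathlib

open Polynomial
open scoped LaurentSeries

noncomputable section

set_option linter.unusedSectionVars false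

namespace VecGr

/-! ### Formal Laurent series in `ξ⁻¹` over a differential ring

An element `A` of `R⸨X⸩` is read as `∑ₙ A.coeff n * ξ ^ (-n)`. -/

section Symbols

variable {R : Type*} [CommRing R]

/-- The operator `∂/∂ξ` on `R⸨X⸩`, where `ξ = X⁻¹`. It maps `a ξ ^ (-n)` to `-n a ξ ^ (-n-1)`. -/
def dXi : R⸨X⸩ →+ R⸨X⸩ :=
  AddMonoidHom.mk' (fun A : R⸨X⸩ =>
      (HahnSeries.ofSuppBddBelow (fun n : ℤ => -(((n - 1 : ℤ) : R) * A.coeff (n - 1)))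
        ⟨A.order + 1, fun n h => by
          by_contra hn
          exact h (by simp [HahnSeries.coeff_eq_zero_of_lt_order
            (show n - 1 < A.order by lia)])⟩ : R⸨X⸩))
      (fun A B => by
        ext n
        change -(((n - 1 : ℤ) : R) * (A.coeff (n - 1) + B.coeff (n - 1))) =
          -(((n - 1 : ℤ) : R) * A.coeff (n - 1)) + -(((n - 1 : ℤ) : R) * B.coeff (n - 1))
        ring)

theorem dXi_coeff (A : R⸨X⸩) (n : ℤ) :
    (dXi A).coeff n = -(((n - 1 : ℤ) : R) * A.coeff (n - 1)) := rfl

theorem dXi_mul (A B : R⸨X⸩) : dXi (A * B) = dXi A * B + A * dXi B := by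
  have key : ∀ A : R⸨X⸩, ∃ E : R⸨X⸩, (∀ n, E.coeff n = (n : R) * A.coeff n) ∧
      dXi A = -(HahnSeries.single 1 1 : R⸨X⸩) * E := by
    intro A
    refine ⟨HahnSeries.ofSuppBddBelow (fun n : ℤ => (n : R) * A.coeff n) ⟨A.order, fun n h => by
          by_contra hn
          exact h (by simp [HahnSeries.coeff_eq_zero_of_lt_order (not_le.mp hn)])⟩,
          fun n => rfl, ?_⟩
    ext n
    rw [dXi_coeff, neg_mul, HahnSeries.coeff_neg, HahnSeries.coeff_single_mul, one_mul]
    rfl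
  obtain ⟨E, hE, h1⟩ := key A
  obtain ⟨F, hF, h2⟩ := key B
  obtain ⟨G, hG, h3⟩ := key (A * B)
  have hs : ∀ A E : R⸨X⸩, (∀ n, E.coeff n = (n : R) * A.coeff n) → E.support ⊆ A.support :=
    fun A E h n hn h0 => hn (by simp [h, h0])
  have : G = E * B + A * F := by
    ext n
    rw [hG, HahnSeries.coeff_add, HahnSeries.coeff_mul_right' B.isPWO_support (hs B F hF),
        HahnSeries.coeff_mul_left' A.isPWO_support (hs A E hE), HahnSeries.coeff_mul,
        Finset.mul_sum, ← Finset.sum_add_distrib]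
    refine Finset.sum_congr rfl fun ij hij => ?_
    rw [Finset.mem_antidiagonal] at hij
    rw [hE, hF, ← hij.2.2]
    push_cast
    ring
  rw [h1, h2, h3, this]
  ring

/-- The operator on `R⸨X⸩` that differentiates the coefficients. -/
def dCoef [Differential R] : R⸨X⸩ →+ R⸨X⸩ :=
  AddMonoidHom.mk' (fun A : R⸨X⸩ => A.map (Differential.deriv : Derivation ℤ R R))
      (fun A B => by ext n; simp)

theorem dCoef_coeff [Differential R] (A : R⸨X⸩) (n : ℤ) :
    (dCoef A).coeff n = Differential.deriv (A.coeff n) := rfl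

theorem dCoef_mul [Differential R] (A B : R⸨X⸩) :
    dCoef (A * B) = dCoef A * B + A * dCoef B := by
  ext n
  have hA : ∀ A : R⸨X⸩, (dCoef A).support ⊆ A.support :=
    fun A n h h0 => h (by simp [dCoef_coeff, h0])
  rw [HahnSeries.coeff_add, HahnSeries.coeff_mul_right' B.isPWO_support (hA B),
    HahnSeries.coeff_mul_left' A.isPWO_support (hA A), dCoef_coeff,
    HahnSeries.coeff_mul, map_sum, ← Finset.sum_add_distrib]
  refine Finset.sum_congr rfl fun ij hij => ?_
  simp [dCoef_coeff, mul_comm]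
  ring

theorem dXi_dCoef [Differential R] (A : R⸨X⸩) : dXi (dCoef A) = dCoef (dXi A) := by
  ext n
  simp [dXi_coeff, dCoef_coeff]

/-- Iterated Leibniz rule. -/
theorem iterate_leibniz {S : Type*} [CommRing S] [Module ℚ S] [IsScalarTower ℚ S S]
    [SMulCommClass ℚ S S] (d : S →+ S)
    (hd : ∀ a b, d (a * b) = d a * b + a * d b) (n : ℕ) (a b : S) :
    (n.factorial : ℚ)⁻¹ • d^[n] (a * b) = ∑ ij ∈ Finset.HasAntidiagonal.antidiagonal n,
      ((ij.1.factorial : ℚ)⁻¹ • d^[ij.1] a) * ((ij.2.factorial : ℚ)⁻¹ • d^[ij.2] b) := by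
  have main : d^[n] (a * b) = ∑ ij ∈ Finset.HasAntidiagonal.antidiagonal n,
      n.choose ij.1 • (d^[ij.1] a * d^[ij.2] b) := by
    induction n with
    | zero => simp
    | succ n ih =>
      rw [Function.iterate_succ_apply', ih, map_sum,
        Finset.sum_antidiagonal_choose_succ_nsmul (M := S)
          (fun i j => d^[i] a * d^[j] b) n, ← Finset.sum_add_distrib]
      refine Finset.sum_congr rfl fun ij hij => ?_
      have : n.choose ij.2 = n.choose ij.1 := by
        rw [← Finset.HasAntidiagonal.mem_antidiagonal.mp hij, Nat.choose_symm_add]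
      rw [map_nsmul, hd, Function.iterate_succ_apply', Function.iterate_succ_apply', this, smul_add,
        add_comm]
  rw [main, Finset.smul_sum]
  refine Finset.sum_congr rfl fun ij hij => ?_
  rw [← Finset.HasAntidiagonal.mem_antidiagonal.mp hij, smul_mul_smul_comm,
    ← Nat.cast_smul_eq_nsmul ℚ, smul_smul]
  congr 1
  have h := Nat.add_choose_mul_factorial_mul_factorial ij.1 ij.2
  rw [← Nat.choose_symm_add] at h
  have h1 : ((ij.1 + ij.2).factorial : ℚ) ≠ 0 := by exact_mod_cast Nat.factorial_ne_zero _
  have h2 : (ij.1.factorial : ℚ) ≠ 0 := by exact_mod_cast Nat.factorial_ne_zero _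
  have h3 : (ij.2.factorial : ℚ) ≠ 0 := by exact_mod_cast Nat.factorial_ne_zero _
  have h' : (((ij.1 + ij.2).choose ij.1 : ℕ) : ℚ) * ij.1.factorial * ij.2.factorial =
    (ij.1 + ij.2).factorial := by exact_mod_cast h
  field_simp
  linarith

/-- All terms of `A` have order at most `-m` in `ξ`. -/
def Low (m : ℤ) (A : R⸨X⸩) : Prop := ∀ n < m, A.coeff n = 0

theorem low_order (A : R⸨X⸩) : Low A.order A := fun _ h => HahnSeries.coeff_eq_zero_of_lt_order h

theorem Low.mono {m m' : ℤ} {A : R⸨X⸩} (h : Low m A) (hm : m' ≤ m) : Low m' A :=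
  fun n hn => h n (lt_of_lt_of_le hn hm)

theorem Low.mul {m m' : ℤ} {A B : R⸨X⸩} (h : Low m A) (h' : Low m' B) : Low (m + m') (A * B) := by
  intro n hn
  rw [HahnSeries.coeff_mul]
  refine Finset.sum_eq_zero fun ij hij => ?_
  rw [Finset.mem_antidiagonal] at hij
  rcases lt_or_ge ij.1 m with h1 | h1
  · rw [h _ h1, zero_mul]
  · rw [h' _ (by lia), mul_zero]

theorem Low.dXi {m : ℤ} {A : R⸨X⸩} (h : Low m A) : Low (m + 1) (dXi A) := by
  intro n hn
  rw [dXi_coeff, h _ (by lia), mul_zero, neg_zero]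

theorem Low.dXi_iterate {m : ℤ} {A : R⸨X⸩} (h : Low m A) (k : ℕ) :
    Low (m + k) (VecGr.dXi^[k] A) := by
  induction k with
  | zero => simpa using h
  | succ k ih =>
    rw [Function.iterate_succ_apply']
    exact ih.dXi.mono (by push_cast; lia)

theorem Low.dCoef_iterate [Differential R] {m : ℤ} {A : R⸨X⸩} (h : Low m A) (k : ℕ) :
    Low m (dCoef^[k] A) := by
  induction k with
  | zero => simpa using h
  | succ k ih =>
    rw [Function.iterate_succ_apply']
    intro n hn
    rw [dCoef_coeff, ih n hn, map_zero]

theorem Low.add {m : ℤ} {A B : R⸨X⸩} (h : Low m A) (h' : Low m B) : Low m (A + B) :=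
  fun n hn => by rw [HahnSeries.coeff_add, h n hn, h' n hn, add_zero]

variable [Algebra ℚ R]

theorem Low.smul {m : ℤ} {A : R⸨X⸩} (h : Low m A) (q : ℚ) : Low m (q • A) :=
  fun n hn => by rw [HahnSeries.coeff_smul, h n hn, smul_zero]

variable [Differential R]

/-- The `k`-th term `(1 / k!) (∂^k A / ∂ξ^k) (∂^k B / ∂x^k)` of the composition of symbols. -/
def symTerm (A B : R⸨X⸩) (k : ℕ) : R⸨X⸩ :=
  ((k.factorial : ℚ)⁻¹ • dXi^[k] A) * dCoef^[k] B

theorem symTerm_low {a b : ℤ} {A B : R⸨X⸩} (hA : Low a A) (hB : Low b B) (k : ℕ) :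
    Low (a + b + k) (symTerm A B k) :=
  (((hA.dXi_iterate k).smul _).mul (hB.dCoef_iterate k)).mono (by lia)

theorem finsum_symTerm {a b : ℤ} {A B : R⸨X⸩} (hA : Low a A) (hB : Low b B) {n : ℤ} {N : ℕ}
    (hN : n < a + b + N) :
    ∑ᶠ k : ℕ, (symTerm A B k).coeff n = ∑ k ∈ Finset.range N, (symTerm A B k).coeff n := by
  refine finsum_eq_finsetSum_of_support_subset _ fun k hk => ?_
  by_contra h
  simp only [Finset.coe_range, Set.mem_Iio, not_lt] at h
  exact hk (symTerm_low hA hB k n (by lia))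

/-- Composition of symbols:
`A ∘ B = ∑ₖ (1 / k!) (∂^k A / ∂ξ^k) (∂^k B / ∂x^k)`. In each degree only finitely many `k`
contribute. -/
def symMul (A B : R⸨X⸩) : R⸨X⸩ :=
  HahnSeries.ofSuppBddBelow (fun n : ℤ => ∑ᶠ k : ℕ, (symTerm A B k).coeff n)
    ⟨A.order + B.order, fun n h => by
      by_contra hn
      refine h ?_
      · change ∑ᶠ k : ℕ, (symTerm A B k).coeff n = 0
        rw [finsum_symTerm (low_order A) (low_order B) (N := 0) (by push_cast; lia)]
        simp⟩

theorem symMul_coeff {a b : ℤ} {A B : R⸨X⸩} (hA : Low a A) (hB : Low b B) {n : ℤ} {N : ℕ}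
    (hN : n < a + b + N) :
    (symMul A B).coeff n = ∑ k ∈ Finset.range N, (symTerm A B k).coeff n :=
  finsum_symTerm hA hB hN

theorem symMul_approx {a b : ℤ} {A B : R⸨X⸩} (hA : Low a A) (hB : Low b B) (N : ℕ) :
    ∃ E : R⸨X⸩, Low (a + b + N) E ∧
      symMul A B = ∑ k ∈ Finset.range N, symTerm A B k + E := by
  refine ⟨symMul A B - ∑ k ∈ Finset.range N, symTerm A B k, fun n hn => ?_, by abel⟩
  rw [HahnSeries.coeff_sub, symMul_coeff hA hB hn, HahnSeries.coeff_sum, sub_self]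

theorem symMul_low {a b : ℤ} {A B : R⸨X⸩} (hA : Low a A) (hB : Low b B) :
    Low (a + b) (symMul A B) := by
  intro n hn
  rw [symMul_coeff hA hB (N := 0) (by simpa using hn)]
  simp

theorem symTerm_add_left (A A' B : R⸨X⸩) (k : ℕ) :
    symTerm (A + A') B k = symTerm A B k + symTerm A' B k := by
  simp [symTerm, iterate_map_add, add_mul]

theorem symTerm_add_right (A B B' : R⸨X⸩) (k : ℕ) :
    symTerm A (B + B') k = symTerm A B k + symTerm A B' k := by
  simp [symTerm, iterate_map_add, mul_add]

theorem symTerm_sum_left {ι : Type*} (s : Finset ι) (A : ι → R⸨X⸩) (B : R⸨X⸩) (k : ℕ) :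
    symTerm (∑ i ∈ s, A i) B k = ∑ i ∈ s, symTerm (A i) B k :=
  map_sum (AddMonoidHom.mk' (fun A => symTerm A B k) fun _ _ => symTerm_add_left _ _ _ _) _ _

theorem symTerm_sum_right {ι : Type*} (s : Finset ι) (A : R⸨X⸩) (B : ι → R⸨X⸩) (k : ℕ) :
    symTerm A (∑ i ∈ s, B i) k = ∑ i ∈ s, symTerm A (B i) k :=
  map_sum (AddMonoidHom.mk' (fun B => symTerm A B k) fun _ _ => symTerm_add_right _ _ _ _) _ _

theorem exists_low (A B C : R⸨X⸩) (n : ℤ) : ∃ (a : ℤ) (N : ℕ), Low a A ∧ Low a B ∧ Low a C ∧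
    n < a + a + N ∧ n < a + a + a + N := by
  set a := min (min A.order B.order) C.order with ha
  refine ⟨a, (n - (a + a)).toNat + (n - (a + a + a)).toNat + 1,
    (low_order A).mono (by lia), (low_order B).mono (by lia), (low_order C).mono (by lia), ?_, ?_⟩
    <;> lia

theorem symMul_add_left (A A' B : R⸨X⸩) : symMul (A + A') B = symMul A B + symMul A' B := by
  ext n
  obtain ⟨a, N, h1, h2, h3, hN, -⟩ := exists_low A A' B n
  rw [HahnSeries.coeff_add, symMul_coeff (h1.add h2) h3 hN, symMul_coeff h1 h3 hN,
    symMul_coeff h2 h3 hN, ← Finset.sum_add_distrib]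
  simp [symTerm_add_left]

theorem symMul_add_right (A B B' : R⸨X⸩) : symMul A (B + B') = symMul A B + symMul A B' := by
  ext n
  obtain ⟨a, N, h1, h2, h3, hN, -⟩ := exists_low A B B' n
  rw [HahnSeries.coeff_add, symMul_coeff h1 (h2.add h3) hN, symMul_coeff h1 h2 hN,
    symMul_coeff h1 h3 hN, ← Finset.sum_add_distrib]
  simp [symTerm_add_right]

theorem dXi_one : dXi (1 : R⸨X⸩) = 0 := by
  have := dXi_mul (1 : R⸨X⸩) 1
  simpa using this

theorem dCoef_one : dCoef (1 : R⸨X⸩) = 0 := by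
  have := dCoef_mul (1 : R⸨X⸩) 1
  simpa using this

theorem symMul_one_left (A : R⸨X⸩) : symMul 1 A = A := by
  ext n
  obtain ⟨a, N, h1, h2, -, hN, -⟩ := exists_low 1 A A n
  rw [symMul_coeff h1 h2 (N := N + 1) (by push_cast; lia), Finset.sum_range_succ',
    Finset.sum_eq_zero]
  · simp [symTerm]
  · intro k _
    simp [symTerm, dXi_one]

theorem symMul_one_right (A : R⸨X⸩) : symMul A 1 = A := by
  ext n
  obtain ⟨a, N, h1, h2, -, hN, -⟩ := exists_low A 1 A n
  rw [symMul_coeff h1 h2 (N := N + 1) (by push_cast; lia), Finset.sum_range_succ',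
    Finset.sum_eq_zero]
  · simp [symTerm]
  · intro k _
    simp [symTerm, dCoef_one]

theorem sum_range_antidiagonal {M : Type*} [AddCommMonoid M] (N : ℕ) (f : ℕ → ℕ → M)
    (hf : ∀ p q, N ≤ p + q → f p q = 0) :
    ∑ l ∈ Finset.range N, ∑ ij ∈ Finset.HasAntidiagonal.antidiagonal l, f ij.1 ij.2 =
      ∑ p ∈ Finset.range N, ∑ q ∈ Finset.range N, f p q := by
  rw [Finset.sum_sigma', ← Finset.sum_product']
  refine Finset.sum_bij_ne_zero (fun x _ _ => x.2) ?_ ?_ ?_ ?_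
  · rintro ⟨l, p, q⟩ h _
    simp at h ⊢
    lia
  · rintro ⟨l, p, q⟩ h _ ⟨l', p', q'⟩ h' _ he
    simp at h h' he ⊢
    lia
  · rintro ⟨p, q⟩ h h0
    refine ⟨⟨p + q, p, q⟩, ?_, h0, rfl⟩
    have : ¬ N ≤ p + q := fun hh => h0 (hf p q hh)
    simpa using this
  · intros
    rfl

theorem dXi_iterate_dCoef (A : R⸨X⸩) (k l : ℕ) :
    dXi^[k] (dCoef^[l] A) = dCoef^[l] (dXi^[k] A) :=
  (Function.Commute.iterate_iterate (fun A => dXi_dCoef A : Function.Commute dXi dCoef) k l).eq A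

theorem map_ratSmul (f : R⸨X⸩ →+ R⸨X⸩) (q : ℚ) (A : R⸨X⸩) (k : ℕ) :
    f^[k] (q • A) = q • f^[k] A := by
  induction k with
  | zero => rfl
  | succ k ih => rw [Function.iterate_succ_apply', ih, map_rat_smul, Function.iterate_succ_apply']

/-- The common expansion of both ways of composing three symbols. -/
def symTriple (A B C : R⸨X⸩) (p q k : ℕ) : R⸨X⸩ :=
  ((p.factorial : ℚ)⁻¹ * (q.factorial : ℚ)⁻¹ * (k.factorial : ℚ)⁻¹) •
    (dXi^[p + k] A * dXi^[q] (dCoef^[k] B) * dCoef^[p + q] C)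

theorem symTriple_low {a : ℤ} {A B C : R⸨X⸩} (hA : Low a A) (hB : Low a B) (hC : Low a C)
    (p q k : ℕ) : Low (a + a + a + (p + q + k : ℕ)) (symTriple A B C p q k) :=
  ((((hA.dXi_iterate _).mul ((hB.dCoef_iterate k).dXi_iterate q)).mul
    (hC.dCoef_iterate _)).smul _).mono (by push_cast; lia)

theorem symMul_assoc (A B C : R⸨X⸩) : symMul (symMul A B) C = symMul A (symMul B C) := by
  ext n
  obtain ⟨a, N, hA, hB, hC, -, hN⟩ := exists_low A B C n
  have hz : ∀ p q k : ℕ, N ≤ p + q + k → (symTriple A B C p q k).coeff n = 0 := fun p q k h =>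
    symTriple_low hA hB hC p q k n (by lia)
  trans ∑ p ∈ Finset.range N, ∑ q ∈ Finset.range N, ∑ k ∈ Finset.range N,
      (symTriple A B C p q k).coeff n
  · rw [symMul_coeff (symMul_low hA hB) hC hN]
    obtain ⟨E, hE, h⟩ := symMul_approx hA hB N
    rw [h]
    have : ∀ l, (symTerm (∑ k ∈ Finset.range N, symTerm A B k + E) C l).coeff n =
        ∑ pq ∈ Finset.HasAntidiagonal.antidiagonal l, ∑ k ∈ Finset.range N,
          (symTriple A B C pq.1 pq.2 k).coeff n := by
      intro l
      rw [symTerm_add_left, HahnSeries.coeff_add, symTerm_low hE hC l n (by lia), add_zero,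
        symTerm_sum_left, HahnSeries.coeff_sum, Finset.sum_comm]
      refine Finset.sum_congr rfl fun k _ => ?_
      rw [← HahnSeries.coeff_sum]
      congr 1
      rw [symTerm, symTerm, iterate_leibniz dXi dXi_mul, Finset.sum_mul]
      refine Finset.sum_congr rfl fun pq hpq => ?_
      rw [← Finset.HasAntidiagonal.mem_antidiagonal.mp hpq, map_ratSmul, symTriple,
        ← Function.iterate_add_apply]
      simp only [smul_mul_assoc, mul_smul_comm, smul_smul]
      congr 1
      ring
    simp only [this]
    exact sum_range_antidiagonal N
      (fun p q => ∑ k ∈ Finset.range N, (symTriple A B C p q k).coeff n)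
      (fun p q h => Finset.sum_eq_zero fun k _ => hz p q k (by lia))
  · rw [symMul_coeff hA (symMul_low hB hC) (N := N) (by lia)]
    obtain ⟨E, hE, h⟩ := symMul_approx hB hC N
    rw [h]
    have : ∀ m, (symTerm A (∑ q ∈ Finset.range N, symTerm B C q + E) m).coeff n =
        ∑ pk ∈ Finset.HasAntidiagonal.antidiagonal m, ∑ q ∈ Finset.range N,
          (symTriple A B C pk.1 q pk.2).coeff n := by
      intro m
      rw [symTerm_add_right, HahnSeries.coeff_add, symTerm_low hA hE m n (by lia), add_zero,
        symTerm_sum_right, HahnSeries.coeff_sum, Finset.sum_comm]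
      refine Finset.sum_congr rfl fun q _ => ?_
      rw [← HahnSeries.coeff_sum]
      congr 1
      rw [symTerm, symTerm, smul_mul_assoc, ← mul_smul_comm,
        mul_comm (_ • _ : R⸨X⸩) (dCoef^[q] C), iterate_leibniz dCoef dCoef_mul, Finset.mul_sum]
      refine Finset.sum_congr rfl fun pk hpk => ?_
      rw [← Finset.HasAntidiagonal.mem_antidiagonal.mp hpk, map_ratSmul, symTriple,
        ← Function.iterate_add_apply, dXi_iterate_dCoef]
      simp only [smul_mul_assoc, mul_smul_comm, smul_smul]
      congr 1
      · ring
      · ring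
    simp only [this]
    rw [sum_range_antidiagonal N
      (fun p k => ∑ q ∈ Finset.range N, (symTriple A B C p q k).coeff n)
      (fun p k h => Finset.sum_eq_zero fun q _ => hz p q k (by lia))]
    exact Finset.sum_congr rfl fun p _ => Finset.sum_comm

end Symbols

/-- The ring of formal pseudodifferential operators `∑ₙ aₙ ∂^(-n)` (`n` bounded below) with
coefficients in the differential ring `R`; such an operator is given by its symbol, the
Laurent series in `∂⁻¹` with coefficients `aₙ`. -/
def PsiDO (R : Type*) [CommRing R] : Type _ := R⸨X⸩

namespace PsiDO

variable {R : Type*} [CommRing R]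

instance : AddCommGroup (PsiDO R) := inferInstanceAs (AddCommGroup R⸨X⸩)

/-- The operator `∑ₙ aₙ ∂^(-n)` with symbol `∑ₙ aₙ X^n`. -/
def ofSymbol : R⸨X⸩ ≃+ PsiDO R := AddEquiv.refl _

variable [Algebra ℚ R] [Differential R]

/-- Multiplication is composition: `∂ a = a ∂ + a'`, and more generally
`∂^m a = ∑ₖ (m choose k) a^(k) ∂^(m-k)` for every integer `m`. -/
instance : Ring (PsiDO R) where
  __ := (inferInstance : AddCommGroup (PsiDO R))
  one := ofSymbol 1
  mul P Q := ofSymbol (symMul (ofSymbol.symm P) (ofSymbol.symm Q))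
  mul_assoc := symMul_assoc
  one_mul := symMul_one_left
  mul_one := symMul_one_right
  left_distrib := symMul_add_right
  right_distrib := symMul_add_left
  zero_mul A := by
    have := symMul_add_left (0 : R⸨X⸩) 0 A
    rw [add_zero] at this
    exact left_eq_add.mp this
  mul_zero A := by
    have := symMul_add_right A (0 : R⸨X⸩) 0
    rw [add_zero] at this
    exact left_eq_add.mp this

end PsiDO

/-! ### Differentiation of rational functions -/

/-- The derivative of a rational function, `(p / q)' = (p' q - p q') / q²`. -/
def ratDeriv (f : RatFunc ℂ) : RatFunc ℂ :=
  algebraMap ℂ[X] (RatFunc ℂ) (derivative f.num * f.denom - f.num * derivative f.denom) /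
    algebraMap ℂ[X] (RatFunc ℂ) (f.denom ^ 2)

theorem ratDeriv_aux {S : Type*} [CommRing S] {n d p q n' d' p' q' : S} (h : n * q = p * d)
    (h' : n' * q + n * q' = p' * d + p * d') :
    (n' * d - n * d') * q ^ 2 = (p' * q - p * q') * d ^ 2 := by
  linear_combination (d * q) * h' - (d * q' + d' * q) * h

theorem ratDeriv_div (p q : ℂ[X]) (hq : q ≠ 0) :
    ratDeriv (algebraMap ℂ[X] (RatFunc ℂ) p / algebraMap ℂ[X] (RatFunc ℂ) q) =
      algebraMap ℂ[X] (RatFunc ℂ) (derivative p * q - p * derivative q) /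
        algebraMap ℂ[X] (RatFunc ℂ) (q ^ 2) := by
  generalize hf : algebraMap ℂ[X] (RatFunc ℂ) p / algebraMap ℂ[X] (RatFunc ℂ) q = f
  have h : f.num * q = p * f.denom := (RatFunc.num_mul_eq_mul_denom_iff hq).mpr hf.symm
  have h' := congrArg derivative h
  rw [derivative_mul, derivative_mul] at h'
  rw [ratDeriv, div_eq_div_iff (RatFunc.algebraMap_ne_zero (pow_ne_zero 2 f.denom_ne_zero))
    (RatFunc.algebraMap_ne_zero (pow_ne_zero 2 hq)),
    ← map_mul (algebraMap ℂ[X] (RatFunc ℂ)), ← map_mul (algebraMap ℂ[X] (RatFunc ℂ)),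
    ratDeriv_aux h h']

/-- `ratDeriv` as a derivation over `ℂ`. -/
def ratDer : Derivation ℂ (RatFunc ℂ) (RatFunc ℂ) :=
  Derivation.mk'
    { toFun := ratDeriv
      map_add' := fun f g => by
        have hf := RatFunc.algebraMap_ne_zero f.denom_ne_zero
        have hg := RatFunc.algebraMap_ne_zero g.denom_ne_zero
        conv_lhs => rw [← f.num_div_denom, ← g.num_div_denom, div_add_div _ _ hf hg, ← map_mul,
          ← map_mul, ← map_mul, ← map_add,
          ratDeriv_div _ _ (mul_ne_zero f.denom_ne_zero g.denom_ne_zero)]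
        simp only [ratDeriv, derivative_mul, map_add, map_mul, map_sub, map_pow]
        field_simp
        ring
      map_smul' := fun c f => by
        conv_lhs => rw [← f.num_div_denom, ← smul_div_assoc, Algebra.smul_def,
          IsScalarTower.algebraMap_apply ℂ ℂ[X] (RatFunc ℂ), ← map_mul,
          ratDeriv_div _ _ f.denom_ne_zero]
        rw [RingHom.id_apply, ratDeriv, ← smul_div_assoc, Algebra.smul_def,
          IsScalarTower.algebraMap_apply ℂ ℂ[X] (RatFunc ℂ), ← map_mul]
        simp only [Polynomial.algebraMap_apply, Algebra.algebraMap_self, RingHom.id_apply,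
          derivative_C_mul]
        congr 2
        ring }
    fun f g => by
      have hf := RatFunc.algebraMap_ne_zero f.denom_ne_zero
      have hg := RatFunc.algebraMap_ne_zero g.denom_ne_zero
      change ratDeriv (f * g) = f • ratDeriv g + g • ratDeriv f
      conv_lhs => rw [← f.num_div_denom, ← g.num_div_denom, div_mul_div_comm, ← map_mul,
          ← map_mul, ratDeriv_div _ _ (mul_ne_zero f.denom_ne_zero g.denom_ne_zero)]
      have e : ∀ a b F G : RatFunc ℂ, F = a → G = b → F • ratDeriv g + G • ratDeriv f =
          a * ratDeriv g + b * ratDeriv f := by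
        rintro a b _ _ rfl rfl
        rfl
      rw [e _ _ f g f.num_div_denom.symm g.num_div_denom.symm]
      simp only [ratDeriv, derivative_mul, map_add, map_mul, map_sub, map_pow]
      field_simp
      ring

/-- A differential ring from an additive map that satisfies the Leibniz rule. -/
abbrev differentialOfLeibniz {R : Type*} [CommRing R] (d : R →+ R)
    (h : ∀ a b, d (a * b) = a * d b + b * d a) : Differential R :=
  ⟨Derivation.mk' d.toIntLinearMap h⟩

instance : Differential (RatFunc ℂ) :=
  differentialOfLeibniz (AddMonoidHom.mk' ratDeriv (map_add ratDer)) ratDer.leibniz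

theorem deriv_ratFunc (f : RatFunc ℂ) : Differential.deriv f = ratDeriv f := rfl

/-! ### Differential operators with rational coefficients -/

/-- The space `ℂ(z)[∂_z]` of differential operators in one variable with rational coefficients:
the finitely supported sequence `D` stands for `∑ₖ D k * ∂^k`, coefficients to the left. -/
abbrev DiffOp : Type := ℕ →₀ RatFunc ℂ

/-- The action `D.f` of a differential operator on a rational function. -/
def DiffOp.act (D : DiffOp) (f : RatFunc ℂ) : RatFunc ℂ :=
  D.sum fun k a => a * ratDeriv^[k] f

/-- The action `u ⋆ D` of a matrix of differential operators on a row vector of rational functions,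
`(u ⋆ D)ⱼ = ∑ₖ Dₖⱼ.uₖ`. -/
def rowStar {r s : ℕ} (u : Fin r → RatFunc ℂ) (D : Matrix (Fin r) (Fin s) DiffOp) :
    Fin s → RatFunc ℂ :=
  fun j => ∑ k, (D k j).act (u k)

/-- A differential operator as a pseudodifferential operator. -/
def DiffOp.toPsiDO (D : DiffOp) : PsiDO (RatFunc ℂ) :=
  D.sum fun k a => PsiDO.ofSymbol (HahnSeries.single (-(k : ℤ)) a)

/-- A matrix of pseudodifferential operators is differential if its entries belong to
`ℂ(x)[∂_x]`. -/
def IsDifferential {r s : ℕ} (P : Matrix (Fin r) (Fin s) (PsiDO (RatFunc ℂ))) : Prop :=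
  ∃ Θ : Matrix (Fin r) (Fin s) DiffOp, P = Θ.map DiffOp.toPsiDO

/-! ### Fat and primary decomposable subspaces, the adelic Grassmannian -/

/-- The row vector of rational functions given by a row vector of polynomials. -/
def polyRow {r : ℕ} (u : Fin r → ℂ[X]) : Fin r → RatFunc ℂ :=
  fun i => algebraMap ℂ[X] (RatFunc ℂ) (u i)

/-- `p ℂ[z]^r ⊆ W`. -/
def ContainsMultiples {r : ℕ} (W : Submodule ℂ (Fin r → RatFunc ℂ)) (p : ℂ[X]) : Prop :=
  ∀ u : Fin r → ℂ[X], polyRow (p • u) ∈ W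

/-- `W` is fat: `p ℂ[z]^r ⊆ W ⊆ q⁻¹ ℂ[z]^r` for some nonzero polynomials `p`, `q`. -/
def IsFat {r : ℕ} (W : Submodule ℂ (Fin r → RatFunc ℂ)) : Prop :=
  ∃ p q : ℂ[X], p ≠ 0 ∧ q ≠ 0 ∧ ContainsMultiples W p ∧
    ∀ f ∈ W, ∃ u : Fin r → ℂ[X], algebraMap ℂ[X] (RatFunc ℂ) q • f = polyRow u

/-- A subspace of `ℂ[z]^r` is `c`-primary if it contains `(z - c)^k ℂ[z]^r` for some `k`. -/
def IsPrimaryAt {r : ℕ} (c : ℂ) (V : Submodule ℂ (Fin r → ℂ[X])) : Prop :=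
  ∃ k : ℕ, ∀ u : Fin r → ℂ[X], (X - C c) ^ k • u ∈ V

/-- `W` is primary decomposable: after multiplication by a suitable nonzero polynomial it becomes
a finite intersection of primary subspaces of `ℂ[z]^r`. -/
def IsPrimaryDecomposable {r : ℕ} (W : Submodule ℂ (Fin r → RatFunc ℂ)) : Prop :=
  ∃ q : ℂ[X], q ≠ 0 ∧ ∃ (S : Finset ℂ) (V : ℂ → Submodule ℂ (Fin r → ℂ[X])),
    (∀ c ∈ S, IsPrimaryAt c (V c)) ∧
    ∀ f : Fin r → RatFunc ℂ, f ∈ W ↔ ∃ u : Fin r → ℂ[X],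
      algebraMap ℂ[X] (RatFunc ℂ) q • f = polyRow u ∧ ∀ c ∈ S, u ∈ V c

/-- `M_W`: the row vectors `(D₁, …, D_r)` of operators with `(D₁.p, …, D_r.p) ∈ W` for every
polynomial `p`. -/
def opsInto {r : ℕ} (W : Submodule ℂ (Fin r → RatFunc ℂ)) : Set (Fin r → DiffOp) :=
  {D | ∀ p : ℂ[X], (fun i => (D i).act (algebraMap ℂ[X] (RatFunc ℂ) p)) ∈ W}

/-- `L_W`: the set of leading coefficients of the elements of `M_W` (together with `0`); here the
leading coefficient of a row vector of operators of order `n` is the row vector of the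
coefficients of `∂^n`. -/
def leadingCoeffs {r : ℕ} (W : Submodule ℂ (Fin r → RatFunc ℂ)) : Set (Fin r → RatFunc ℂ) :=
  {c | ∃ D ∈ opsInto W, ∃ n : ℕ, (∀ i, ∀ m > n, D i m = 0) ∧ c = fun i => D i n}

/-- The adelic Grassmannian `Gr^ad(r)`: the primary decomposable fat subspaces `W` of `ℂ(z)^r` with
`L_W = ℂ[z]^r`. -/
def AdelicGrassmannian (r : ℕ) : Set (Submodule ℂ (Fin r → RatFunc ℂ)) :=
  {W | IsFat W ∧ IsPrimaryDecomposable W ∧ leadingCoeffs W = Set.range polyRow}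

/-- The space `𝓓(U, V)` of `r × s` matrices `D` over `ℂ(z)[∂_z]` with `U ⋆ D ⊆ V`. -/
def opSpace {r s : ℕ} (U : Submodule ℂ (Fin r → RatFunc ℂ))
    (V : Submodule ℂ (Fin s → RatFunc ℂ)) : Set (Matrix (Fin r) (Fin s) DiffOp) :=
  {D | ∀ u ∈ U, rowStar u D ∈ V}

/-! ### Functions of the form `φ(x, z) e^{xz}`

Such a function, with `φ = ∑ₙ φₙ(x) z^(-n)`, is given by the Laurent series
`φ ∈ ℂ(x)((z⁻¹))`. -/

/-- The expansion at `∞` of a rational function of `z`, as a Laurent series in `z⁻¹`. -/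
def expandAtInfty (K : Type) [Field K] [Algebra ℂ K] (f : RatFunc ℂ) : K⸨X⸩ :=
  f.eval ((HahnSeries.C : K →+* K⸨X⸩).comp (algebraMap ℂ K)) (HahnSeries.single (-1) 1)

/-- `∂_x (φ e^{xz}) = (∂φ/∂x + z φ) e^{xz}`. -/
def expDx (φ : (RatFunc ℂ)⸨X⸩) : (RatFunc ℂ)⸨X⸩ :=
  dCoef φ + HahnSeries.single (-1) 1 * φ

/-- `∂_z (φ e^{xz}) = (∂φ/∂z + x φ) e^{xz}`. -/
def expDz (φ : (RatFunc ℂ)⸨X⸩) : (RatFunc ℂ)⸨X⸩ :=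
  dXi φ + HahnSeries.C RatFunc.X * φ

/-- The action of an operator `Θ(x)` in `ℂ(x)[∂_x]` on `φ e^{xz}`. -/
def DiffOp.actX (Θ : DiffOp) (φ : (RatFunc ℂ)⸨X⸩) : (RatFunc ℂ)⸨X⸩ :=
  Θ.sum fun k a => HahnSeries.C a * expDx^[k] φ

/-- The action of an operator `D(z)` in `ℂ(z)[∂_z]` on `φ e^{xz}`. -/
def DiffOp.actZ (D : DiffOp) (φ : (RatFunc ℂ)⸨X⸩) : (RatFunc ℂ)⸨X⸩ :=
  D.sum fun k a => expandAtInfty (RatFunc ℂ) a * expDz^[k] φ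

/-- `ψ(x,z) ⋆ D(z) = (D(z)ᵗ.ψ(x,z)ᵗ)ᵗ`. -/
def bakerStar {m r s : ℕ} (ψ : Matrix (Fin m) (Fin r) (RatFunc ℂ)⸨X⸩)
    (D : Matrix (Fin r) (Fin s) DiffOp) : Matrix (Fin m) (Fin s) (RatFunc ℂ)⸨X⸩ :=
  fun i j => ∑ k, (D k j).actZ (ψ i k)

/-- `Θ(x).ψ(x,z)`. -/
def bakerAct {m r s : ℕ} (Θ : Matrix (Fin m) (Fin r) DiffOp)
    (ψ : Matrix (Fin r) (Fin s) (RatFunc ℂ)⸨X⸩) : Matrix (Fin m) (Fin s) (RatFunc ℂ)⸨X⸩ :=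
  fun i j => ∑ k, (Θ i k).actX (ψ k j)

/-! ### The stationary Baker function -/

/-- The completion `W + p 𝒪(ℂ)^r` of a fat subspace `W`, where `p ≠ 0` is any polynomial with
`p ℂ[z]^r ⊆ W` and `𝒪(ℂ)` is the ring of entire functions. Its elements are meromorphic functions,
and two of them are not distinguished if they agree off a finite set. -/
def completion {r : ℕ} (W : Submodule ℂ (Fin r → RatFunc ℂ)) : Set (ℂ → Fin r → ℂ) :=
  {g | ∃ w ∈ W, ∃ p : ℂ[X], p ≠ 0 ∧ ContainsMultiples W p ∧
    ∃ h : ℂ → Fin r → ℂ, Differentiable ℂ h ∧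
      ∀ᶠ z in Filter.cofinite, ∀ i,
        g z i = (w i).eval (RingHom.id ℂ) z + p.eval z * h z i}

/-- `ψ(x,z) e^{xz}` is the stationary Baker function of `W`: the `r × r` matrix `ψ` has the form
`1 + ∑_{n ≥ 1} aₙ(x) z^(-n)`, and, for all but finitely many `x ∈ ℂ`, the coefficients `aₙ` are
regular at `x`, the series is the expansion of a matrix `M` of rational functions of `z`, and every
row of `M(z) e^{xz}` belongs to the completion of `W`. -/
def IsStationaryBaker {r : ℕ} (W : Submodule ℂ (Fin r → RatFunc ℂ))
    (ψ : Matrix (Fin r) (Fin r) (RatFunc ℂ)⸨X⸩) : Prop :=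
  (∀ i j, ∀ n < 0, (ψ i j).coeff n = 0) ∧
  (∀ i j, (ψ i j).coeff 0 = (1 : Matrix (Fin r) (Fin r) (RatFunc ℂ)) i j) ∧
  ∀ᶠ x : ℂ in Filter.cofinite,
    (∀ i j n, ((ψ i j).coeff n).denom.eval x ≠ 0) ∧
    ∃ M : Matrix (Fin r) (Fin r) (RatFunc ℂ),
      (∀ i j n, (expandAtInfty ℂ (M i j)).coeff n =
        ((ψ i j).coeff n).eval (RingHom.id ℂ) x) ∧
      ∀ i, (fun z j => (M i j).eval (RingHom.id ℂ) z * Complex.exp (x * z)) ∈ completion W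

/-- The operator `K = ∑ₙ aₙ(x) ∂_x^(-n)` with `K.e^{xz} = ∑ₙ aₙ(x) z^(-n) e^{xz}`. -/
def waveOperator {r : ℕ} (ψ : Matrix (Fin r) (Fin r) (RatFunc ℂ)⸨X⸩) :
    Matrix (Fin r) (Fin r) (PsiDO (RatFunc ℂ)) :=
  ψ.map PsiDO.ofSymbol

/-- The operator `b(D)(x)`, where `b` is the anti-isomorphism with `b(z) = ∂_x` and `b(∂_z) = x`:
`b(∑ₖ fₖ(z) ∂_z^k) = ∑ₖ x^k fₖ(∂_x)`. -/
def DiffOp.bisp (D : DiffOp) : PsiDO (RatFunc ℂ) :=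
  D.sum fun k f => PsiDO.ofSymbol (HahnSeries.C RatFunc.X) ^ k *
    PsiDO.ofSymbol (expandAtInfty (RatFunc ℂ) f)

end VecGr

end

open VecGr

noncomputable section

namespace VecGr

/-! ### The action of pseudodifferential operators on `φ(x, z) e^{xz}` -/

section Symbols

variable {R : Type*} [CommRing R]

/-! Write a function `φ e^{xz}` as the pseudodifferential operator `K` with `K.e^{xz} = φ e^{xz}`.
An operator `Θ(x)` then acts as left multiplication by `Θ`, and `D(z)` acts as right multiplication
by `b(D)` (`ofSymbol_actX`, `ofSymbol_actZ`). Thus `ψ_U ⋆ D = Θ.ψ_V` says `K_U b(D) = Θ K_V`. Since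
`K_V = 1 + (terms of negative order)` is invertible by a geometric series, (ii) and (iii) are
equivalent and `Θ` is determined. This part does not involve `U` and `V`
(`bakerStar_eq_bakerAct_iff`).

For (i) ⇔ (ii), let `W` be cut out by a denominator `q` and finitely many functionals supported at
points. Its Baker module `B_W` consists of the rows `φ` over `ℂ(x)((z⁻¹))` for which `qφ` is
polynomial in `z` and `φ e^{xz}` satisfies the conditions. As `e^{xz}` is a generating function for
all polynomials in `z`, an operator row `D` lies in `M_W` exactly when `D.e^{xz}` lies in `B_W`
(`Cuts.symb_mem_iff`). Clearing denominators in `x`, every element of `B_W` is `h(x)⁻¹ D.e^{xz}`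
with `D ∈ M_W` (`Cuts.exists_symb_eq`).

The two halves of `L_W = ℂ[z]^r` play different roles. The inclusion `⊆` shows that an element of
`B_W` with only negative powers of `z` is zero (`Cuts.eq_zero_of_coeff`), which gives uniqueness of
the Baker function. The inclusion `⊇` shows that all values of the conditions are attained on rows
of degree below `deg q` (`Cuts.condAll_mem`), which gives existence (`Cuts.exists_isNormalized`).
Since `∂_x^d ψ_W` has leading term `z^d`, the rows of `ψ_W` generate `B_W` over `ℂ(x)[∂_x]`
(`Cuts.exists_actX`).

Given (i), a row of `ψ_U` is `h⁻¹ E.e^{xz}` with `E ∈ M_U`. Composing with `D` gives an element of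
`M_V`, so the rows of `ψ_U ⋆ D` lie in `B_V` and are combinations of those of `ψ_V`. Given (ii),
each `u ∈ U` is `E.1` for some `E ∈ M_U` (`Cuts.exists_opsInto_apply_zero`). Then `E.e^{xz} =
Θ'.ψ_U`, so `(E.e^{xz}) ⋆ D = Θ'Θ.ψ_V` lies in `B_V`; the composite of `E` and `D` is therefore in
`M_V`, and its value at `1` is `u ⋆ D ∈ V`.

The analytic definition of the Baker function is tied to `B_W` by `Cuts.mem_completion_iff`, which
turns membership in the completion at a fixed `x` into the point conditions. -/

theorem dXi_C (a : R) : dXi (HahnSeries.C a : R⸨X⸩) = 0 := by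
  ext n
  rw [dXi_coeff, HahnSeries.coeff_zero]
  by_cases h : n - 1 = 0
  · simp [h]
  · simp [HahnSeries.C_apply, HahnSeries.coeff_single_of_ne h]

theorem dXi_single_neg_one : dXi (HahnSeries.single (-1) 1 : R⸨X⸩) = 1 := by
  ext n
  rw [dXi_coeff]
  by_cases h : n = 0
  · simp [h]
  · rw [HahnSeries.coeff_single_of_ne (by lia), HahnSeries.coeff_one, if_neg h]
    simp

theorem dCoef_C [Differential R] (a : R) :
    dCoef (HahnSeries.C a : R⸨X⸩) = HahnSeries.C (Differential.deriv a) := by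
  ext n
  rw [dCoef_coeff, HahnSeries.C_apply, HahnSeries.C_apply]
  by_cases h : n = 0
  · simp [h]
  · simp [HahnSeries.coeff_single_of_ne h]

variable [Algebra ℚ R] [Differential R]

theorem symMul_eq_sum (A B : R⸨X⸩) (N : ℕ) (h : ∀ k, N ≤ k → symTerm A B k = 0) :
    symMul A B = ∑ k ∈ Finset.range N, symTerm A B k := by
  ext n
  obtain ⟨a, M, h1, h2, -, hM, -⟩ := exists_low A B B n
  rw [symMul_coeff h1 h2 (N := N + M) (by push_cast; lia), HahnSeries.coeff_sum]
  refine (Finset.sum_subset (by simp) fun k _ hk => ?_).symm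
  rw [h k (by simpa using hk), HahnSeries.coeff_zero]

theorem symTerm_zero_index (A B : R⸨X⸩) : symTerm A B 0 = A * B := by simp [symTerm]

theorem symTerm_one_index (A B : R⸨X⸩) : symTerm A B 1 = dXi A * dCoef B := by simp [symTerm]

theorem iterate_eq_zero {M : Type*} [AddMonoid M] (f : M →+ M) (A : M) {m k : ℕ}
    (h : f^[m] A = 0) (hk : m ≤ k) : f^[k] A = 0 := by
  obtain ⟨l, rfl⟩ := Nat.exists_eq_add_of_le' hk
  rw [Function.iterate_add_apply, h, iterate_map_zero]

theorem symMul_of_dXi_eq_zero {A : R⸨X⸩} (hA : dXi A = 0) (B : R⸨X⸩) : symMul A B = A * B := by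
  rw [symMul_eq_sum A B 1, Finset.sum_range_one, symTerm_zero_index]
  intro k hk
  rw [symTerm, iterate_eq_zero dXi A (m := 1) hA hk, smul_zero, zero_mul]

theorem symMul_of_dCoef_eq_zero (A : R⸨X⸩) {B : R⸨X⸩} (hB : dCoef B = 0) :
    symMul A B = A * B := by
  rw [symMul_eq_sum A B 1, Finset.sum_range_one, symTerm_zero_index]
  intro k hk
  rw [symTerm, iterate_eq_zero dCoef B (m := 1) hB hk, mul_zero]

theorem symMul_single_neg_one_left (B : R⸨X⸩) :
    symMul (HahnSeries.single (-1) 1) B = dCoef B + HahnSeries.single (-1) 1 * B := by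
  rw [symMul_eq_sum _ B 2, Finset.sum_range_succ, Finset.sum_range_one, symTerm_zero_index,
    symTerm_one_index, dXi_single_neg_one, one_mul, add_comm]
  intro k hk
  rw [symTerm, iterate_eq_zero dXi _ (m := 2) _ hk, smul_zero, zero_mul]
  simp [dXi_single_neg_one, dXi_one]

end Symbols

namespace PsiDO

variable {R : Type*} [CommRing R] [Algebra ℚ R] [Differential R]

theorem ofSymbol_mul (A B : R⸨X⸩) : ofSymbol A * ofSymbol B = ofSymbol (symMul A B) := rfl

theorem ofSymbol_sum {ι : Type*} (s : Finset ι) (A : ι → R⸨X⸩) :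
    ofSymbol (∑ i ∈ s, A i) = ∑ i ∈ s, ofSymbol (A i) := map_sum ofSymbol A s

theorem ofSymbol_C_mul (a : R) (A : R⸨X⸩) :
    ofSymbol (HahnSeries.C a * A) = ofSymbol (HahnSeries.C a) * ofSymbol A := by
  rw [ofSymbol_mul, symMul_of_dXi_eq_zero (dXi_C a)]

theorem ofSymbol_mul_of_dCoef_eq_zero (A : R⸨X⸩) {B : R⸨X⸩} (hB : dCoef B = 0) :
    ofSymbol (A * B) = ofSymbol A * ofSymbol B := by
  rw [ofSymbol_mul, symMul_of_dCoef_eq_zero A hB]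

theorem ofSymbol_single_neg (k : ℕ) (a : R) :
    ofSymbol (HahnSeries.single (-(k : ℤ)) a) =
      ofSymbol (HahnSeries.C a) * ofSymbol (HahnSeries.single (-1) 1) ^ k := by
  have : ∀ k : ℕ, ofSymbol (HahnSeries.single (-(k : ℤ)) (1 : R)) =
      ofSymbol (HahnSeries.single (-1) 1) ^ k := by
    intro k
    induction k with
    | zero =>
      simp only [Nat.cast_zero, neg_zero, pow_zero]
      rfl
    | succ k ih =>
      rw [pow_succ', ← ih, ofSymbol_mul, symMul_single_neg_one_left, HahnSeries.single_mul_single]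
      congr 1
      have h : dCoef (HahnSeries.single (-(k : ℤ)) (1 : R)) = 0 := by
        ext n
        rw [dCoef_coeff]
        by_cases h : n = -(k : ℤ)
        · simp [h]
        · simp [HahnSeries.coeff_single_of_ne h]
      rw [h, zero_add, one_mul]
      congr 1
      push_cast
      ring_nf
  rw [← this, ← ofSymbol_C_mul, HahnSeries.C_apply, HahnSeries.single_mul_single, zero_add, mul_one]

/-- The action of `∑ₖ aₖ ∂^k` on symbols. -/
theorem sum_ofSymbol_single_mul (s : Finset ℕ) (a : ℕ → R) (φ : R⸨X⸩) :
    (∑ k ∈ s, ofSymbol (HahnSeries.single (-(k : ℤ)) (a k))) * ofSymbol φ =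
      ofSymbol (∑ k ∈ s, HahnSeries.C (a k) *
        (fun B : R⸨X⸩ => dCoef B + HahnSeries.single (-1) 1 * B)^[k] φ) := by
  have : ∀ k : ℕ, ofSymbol ((fun B : R⸨X⸩ => dCoef B + HahnSeries.single (-1) 1 * B)^[k] φ) =
      ofSymbol (HahnSeries.single (-1) 1) ^ k * ofSymbol φ := by
    intro k
    induction k with
    | zero => simp
    | succ k ih =>
      rw [Function.iterate_succ_apply', ← symMul_single_neg_one_left, ← ofSymbol_mul, ih, pow_succ',
        mul_assoc]
  rw [ofSymbol_sum, Finset.sum_mul]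
  refine Finset.sum_congr rfl fun k _ => ?_
  rw [ofSymbol_C_mul, this, ofSymbol_single_neg, mul_assoc]

/-- The composition series stops after the first `ξ`-derivative because `x'' = 0`. What remains is
`e^{-xz} ∂_z e^{xz}` acting on symbols, which explains `b(∂_z) = x`. -/
theorem ofSymbol_mul_C {x : R} (hx : Differential.deriv x = 1) (φ : R⸨X⸩) :
    ofSymbol φ * ofSymbol (HahnSeries.C x) = ofSymbol (dXi φ + HahnSeries.C x * φ) := by
  rw [ofSymbol_mul, symMul_eq_sum _ _ 2, Finset.sum_range_succ, Finset.sum_range_one,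
    symTerm_zero_index, symTerm_one_index, dCoef_C, hx, map_one, mul_one, add_comm, mul_comm]
  intro k hk
  rw [symTerm, iterate_eq_zero dCoef _ (m := 2) _ hk, mul_zero]
  rw [Function.iterate_succ_apply', Function.iterate_one, dCoef_C, hx, map_one, dCoef_one]

/-- Multiplication on the right by `∑ₖ x^k gₖ`, where the `gₖ` have constant coefficients. -/
theorem ofSymbol_mul_sum {x : R} (hx : Differential.deriv x = 1) (s : Finset ℕ) (g : ℕ → R⸨X⸩)
    (hg : ∀ k, dCoef (g k) = 0) (φ : R⸨X⸩) :
    ofSymbol φ * ∑ k ∈ s, ofSymbol (HahnSeries.C x) ^ k * ofSymbol (g k) =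
      ofSymbol (∑ k ∈ s, g k * (fun A : R⸨X⸩ => dXi A + HahnSeries.C x * A)^[k] φ) := by
  have : ∀ k : ℕ, ofSymbol ((fun A : R⸨X⸩ => dXi A + HahnSeries.C x * A)^[k] φ) =
      ofSymbol φ * ofSymbol (HahnSeries.C x) ^ k := by
    intro k
    induction k with
    | zero => simp
    | succ k ih =>
      rw [Function.iterate_succ_apply', ← ofSymbol_mul_C hx, ih, pow_succ, mul_assoc]
  rw [ofSymbol_sum, Finset.mul_sum]
  refine Finset.sum_congr rfl fun k _ => ?_
  rw [mul_comm (g k), ofSymbol_mul_of_dCoef_eq_zero _ (hg k), this, mul_assoc]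

end PsiDO

open PsiDO

theorem ratDeriv_X : ratDeriv RatFunc.X = 1 := by
  have := ratDeriv_div X 1 one_ne_zero
  simpa using this

theorem ratDeriv_zero : ratDeriv 0 = 0 := map_zero ratDer

theorem ratDeriv_add (f g : RatFunc ℂ) : ratDeriv (f + g) = ratDeriv f + ratDeriv g :=
  map_add ratDer f g

theorem ratDeriv_mul (f g : RatFunc ℂ) : ratDeriv (f * g) = ratDeriv f * g + f * ratDeriv g := by
  have := ratDer.leibniz f g
  rw [smul_eq_mul, smul_eq_mul] at this
  change ratDeriv (f * g) = f * ratDeriv g + g * ratDeriv f at this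
  rw [this]
  ring

theorem ratDeriv_algebraMap (p : ℂ[X]) :
    ratDeriv (algebraMap ℂ[X] (RatFunc ℂ) p) = algebraMap ℂ[X] (RatFunc ℂ) (derivative p) := by
  have := ratDeriv_div p 1 one_ne_zero
  simpa using this

theorem ratDeriv_iterate_algebraMap (p : ℂ[X]) (k : ℕ) :
    ratDeriv^[k] (algebraMap ℂ[X] (RatFunc ℂ) p) =
      algebraMap ℂ[X] (RatFunc ℂ) (derivative^[k] p) := by
  induction k with
  | zero => rfl
  | succ k ih => rw [Function.iterate_succ_apply', ih, ratDeriv_algebraMap,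
      Function.iterate_succ_apply']

/-- Action in `x` on `φ e^{xz}` is composition from the left. -/
theorem ofSymbol_actX (Θ : DiffOp) (φ : (RatFunc ℂ)⸨X⸩) :
    ofSymbol (Θ.actX φ) = Θ.toPsiDO * ofSymbol φ :=
  (sum_ofSymbol_single_mul Θ.support Θ φ).symm

/-! ### Expansions at infinity -/

section Expand

variable (K : Type) [Field K]

/-- A polynomial in `z` as a Laurent series in `z⁻¹`. -/
def polySeries : K[X] →+* K⸨X⸩ := eval₂RingHom HahnSeries.C (HahnSeries.single (-1) 1)

variable {K}

theorem polySeries_monomial (n : ℕ) (a : K) :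
    polySeries K (monomial n a) = HahnSeries.single (-(n : ℤ)) a := by
  simp [polySeries, HahnSeries.single_pow]

theorem polySeries_coeff (p : K[X]) (n : ℤ) :
    (polySeries K p).coeff n = if n ≤ 0 then p.coeff (-n).toNat else 0 := by
  induction p using Polynomial.induction_on' with
  | add p q hp hq =>
    rw [map_add, HahnSeries.coeff_add, hp, hq]
    split_ifs <;> simp
  | monomial k a =>
    rw [polySeries_monomial, HahnSeries.coeff_single, coeff_monomial]
    split_ifs <;> first | rfl | lia

theorem polySeries_coeff_neg (p : K[X]) (n : ℕ) :
    (polySeries K p).coeff (-(n : ℤ)) = p.coeff n := by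
  rw [polySeries_coeff, if_pos (by lia)]
  congr 1
  lia

theorem polySeries_coeff_pos (p : K[X]) {n : ℤ} (hn : 0 < n) : (polySeries K p).coeff n = 0 := by
  rw [polySeries_coeff, if_neg (by lia)]

theorem polySeries_injective : Function.Injective (polySeries K) := fun p q h => by
  ext n
  rw [← polySeries_coeff_neg, h, polySeries_coeff_neg]

variable [Algebra ℂ K]

theorem expand_eval₂ (p : ℂ[X]) :
    eval₂ ((HahnSeries.C : K →+* K⸨X⸩).comp (algebraMap ℂ K)) (HahnSeries.single (-1) 1) p =
      polySeries K (p.map (algebraMap ℂ K)) := by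
  rw [polySeries, coe_eval₂RingHom, eval₂_map]

theorem polySeries_map_ne_zero {p : ℂ[X]} (hp : p ≠ 0) :
    polySeries K (p.map (algebraMap ℂ K)) ≠ 0 := by
  rw [Ne, map_eq_zero_iff _ polySeries_injective]
  exact (Polynomial.map_ne_zero_iff (algebraMap ℂ K).injective).mpr hp

variable (K)

/-- The expansion at infinity as a ring homomorphism. -/
def expandHom : RatFunc ℂ →+* K⸨X⸩ where
  toFun := expandAtInfty K
  map_one' := by simp [expandAtInfty]
  map_zero' := by simp [expandAtInfty]
  map_add' f g := by
    refine RatFunc.eval_add _ _ ?_ ?_ <;> rw [expand_eval₂] <;>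
      exact polySeries_map_ne_zero (RatFunc.denom_ne_zero _)
  map_mul' f g := by
    refine RatFunc.eval_mul _ _ ?_ ?_ <;> rw [expand_eval₂] <;>
      exact polySeries_map_ne_zero (RatFunc.denom_ne_zero _)

variable {K}

theorem expandAtInfty_eq (f : RatFunc ℂ) : expandAtInfty K f = expandHom K f := rfl

theorem expandHom_algebraMap (p : ℂ[X]) :
    expandHom K (algebraMap ℂ[X] (RatFunc ℂ) p) = polySeries K (p.map (algebraMap ℂ K)) := by
  rw [← expandAtInfty_eq, expandAtInfty, RatFunc.eval_algebraMap, Algebra.algebraMap_self,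
    RingHom.id_apply, expand_eval₂]

theorem expandHom_injective : Function.Injective (expandHom K) := (expandHom K).injective

/-- Expansion at infinity commutes with extension of the field of constants. -/
theorem expandHom_coeff (f : RatFunc ℂ) (n : ℤ) :
    (expandHom K f).coeff n = algebraMap ℂ K ((expandHom ℂ f).coeff n) := by
  set m : ℂ⸨X⸩ →+* K⸨X⸩ :=
    { toFun := fun A => A.map (algebraMap ℂ K)
      map_one' := by
        ext n
        simp only [HahnSeries.map_coeff, HahnSeries.coeff_one]
        split_ifs <;> simp
      map_zero' := by ext n; simp
      map_add' := fun A B => by ext n; simp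
      map_mul' := fun A B => by
        ext n
        have hs : ∀ A : ℂ⸨X⸩, (A.map (algebraMap ℂ K)).support = A.support := fun A => by
          ext n; simp
        simp only [HahnSeries.map_coeff, HahnSeries.coeff_mul, map_sum, map_mul]
        refine Finset.sum_congr ?_ fun _ _ => rfl
        ext ij
        simp [Finset.mem_antidiagonal] } with hm
  have : (m.comp (expandHom ℂ)) = expandHom K := by
    refine IsLocalization.ringHom_ext (nonZeroDivisors ℂ[X]) (RingHom.ext fun p => ?_)
    simp only [RingHom.comp_apply, expandHom_algebraMap]
    ext n
    change algebraMap ℂ K _ = _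
    simp only [polySeries_coeff]
    split_ifs <;> simp
  rw [← this]
  rfl

/-- The expansion coefficients are complex numbers, hence constants for `∂_x`. Right composition
with `f(∂_x)` is therefore plain multiplication of symbols. -/
theorem dCoef_expandHom (f : RatFunc ℂ) : dCoef (expandHom (RatFunc ℂ) f) = 0 := by
  ext n
  rw [dCoef_coeff, expandHom_coeff]
  exact ratDer.map_algebraMap _

end Expand

/-- Action in `z` on `φ e^{xz}` is composition from the right, so it reverses products and commutes
with every action in `x`. -/
theorem ofSymbol_actZ (D : DiffOp) (φ : (RatFunc ℂ)⸨X⸩) :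
    ofSymbol (D.actZ φ) = ofSymbol φ * D.bisp :=
  (ofSymbol_mul_sum ratDeriv_X D.support (fun k => expandHom _ (D k))
    (fun _ => dCoef_expandHom _) φ).symm

open PsiDO

/-! ### Invertibility of `1 + (terms of negative order)` -/

section Units

variable {R : Type*} [CommRing R] {r : ℕ}

/-- All entries have order at most `-m`. -/
def LowMat (m : ℤ) (P : Matrix (Fin r) (Fin r) (PsiDO R)) : Prop :=
  ∀ i j, Low m (ofSymbol.symm (P i j))

theorem low_sum {ι : Type*} {m : ℤ} (s : Finset ι) (A : ι → R⸨X⸩) (h : ∀ i ∈ s, Low m (A i)) :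
    Low m (∑ i ∈ s, A i) := fun n hn => by
  rw [HahnSeries.coeff_sum]
  exact Finset.sum_eq_zero fun i hi => h i hi n hn

theorem LowMat.mono {m m' : ℤ} {P : Matrix (Fin r) (Fin r) (PsiDO R)} (hP : LowMat m P)
    (h : m' ≤ m) : LowMat m' P := fun i j => (hP i j).mono h

variable [Algebra ℚ R] [Differential R]

theorem LowMat.mul {m m' : ℤ} {P Q : Matrix (Fin r) (Fin r) (PsiDO R)} (hP : LowMat m P)
    (hQ : LowMat m' Q) : LowMat (m + m') (P * Q) := fun i j => by
  rw [Matrix.mul_apply, map_sum]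
  exact low_sum _ _ fun k _ => symMul_low (hP i k) (hQ k j)

theorem LowMat.one : LowMat 0 (1 : Matrix (Fin r) (Fin r) (PsiDO R)) := fun i j n hn => by
  rw [Matrix.one_apply]
  split_ifs
  · change (1 : R⸨X⸩).coeff n = 0
    rw [HahnSeries.coeff_one, if_neg hn.ne]
  · rfl

theorem LowMat.pow {P : Matrix (Fin r) (Fin r) (PsiDO R)} (hP : LowMat 1 P) (k : ℕ) :
    LowMat k (P ^ k) := by
  induction k with
  | zero => simpa using LowMat.one
  | succ k ih => rw [pow_succ]; exact_mod_cast ih.mul hP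

theorem LowMat.sub {m : ℤ} {P Q : Matrix (Fin r) (Fin r) (PsiDO R)} (hP : LowMat m P)
    (hQ : LowMat m Q) : LowMat m (P - Q) := fun i j n hn => by
  change (ofSymbol.symm (P i j)).coeff n - (ofSymbol.symm (Q i j)).coeff n = 0
  rw [hP i j n hn, hQ i j n hn, sub_zero]

theorem eq_of_forall_lowMat_sub {P Q : Matrix (Fin r) (Fin r) (PsiDO R)}
    (h : ∀ m : ℕ, LowMat m (P - Q)) : P = Q := by
  refine Matrix.ext fun i j => ofSymbol.symm.injective (HahnSeries.ext (funext fun n => ?_))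
  have := h (n.toNat + 1) i j n (by push_cast; lia)
  exact sub_eq_zero.mp this

/-- `P ^ k` has order at most `-k`, so each coefficient of the geometric series is a finite sum. -/
theorem exists_geometric_sum {P : Matrix (Fin r) (Fin r) (PsiDO R)} (hP : LowMat 1 P) :
    ∃ S, ∀ m : ℕ, LowMat m (S - ∑ k ∈ Finset.range m, P ^ k) := by
  have coeff_sum : ∀ (m : ℕ) i j n,
      (ofSymbol.symm ((∑ k ∈ Finset.range m, P ^ k : Matrix (Fin r) (Fin r) (PsiDO R)) i j)).coeff n
        = ∑ k ∈ Finset.range m, (ofSymbol.symm ((P ^ k) i j)).coeff n := by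
    intro m i j n
    rw [Matrix.sum_apply, map_sum, HahnSeries.coeff_sum]
  -- In degree `n` only the powers with `k ≤ n` contribute, which makes `n.toNat + 1` terms enough.
  refine ⟨fun i j => ofSymbol (HahnSeries.ofSuppBddBelow
    (fun n : ℤ => ∑ k ∈ Finset.range (n.toNat + 1), (ofSymbol.symm ((P ^ k) i j)).coeff n)
    ⟨0, fun n h => by
      by_contra hn
      exact h (Finset.sum_eq_zero fun k _ => hP.pow k i j n (by lia))⟩), fun m i j n hn => ?_⟩
  change (∑ k ∈ Finset.range (n.toNat + 1), (ofSymbol.symm ((P ^ k) i j)).coeff n) -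
    (ofSymbol.symm ((∑ k ∈ Finset.range m, P ^ k : Matrix _ _ (PsiDO R)) i j)).coeff n = 0
  rw [coeff_sum, sub_eq_zero]
  rcases Nat.eq_zero_or_pos m with rfl | hm
  · exact Finset.sum_eq_zero fun k _ => hP.pow k i j n (by push_cast at hn; lia)
  · refine Finset.sum_subset (Finset.range_mono (by lia)) fun k _ hk => ?_
    exact hP.pow k i j n (by simp at hk; lia)

theorem isUnit_one_sub {P : Matrix (Fin r) (Fin r) (PsiDO R)} (hP : LowMat 1 P) :
    IsUnit (1 - P) := by
  obtain ⟨S, hS⟩ := exists_geometric_sum hP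
  have h1 : LowMat 0 (1 - P) := LowMat.one.sub (hP.mono (by lia))
  have key : ∀ m : ℕ, LowMat m ((1 - P) * S - 1) ∧ LowMat m (S * (1 - P) - 1) := by
    intro m
    have e1 : (1 - P) * S - 1 = (1 - P) * (S - ∑ k ∈ Finset.range m, P ^ k) - P ^ m := by
      rw [mul_sub, mul_neg_geom_sum]
      abel
    have e2 : S * (1 - P) - 1 = (S - ∑ k ∈ Finset.range m, P ^ k) * (1 - P) - P ^ m := by
      rw [sub_mul, geom_sum_mul_neg]
      abel
    rw [e1, e2]
    exact ⟨((h1.mul (hS m)).mono (by lia)).sub (hP.pow m),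
      (((hS m).mul h1).mono (by lia)).sub (hP.pow m)⟩
  exact ⟨⟨1 - P, S, eq_of_forall_lowMat_sub fun m => (key m).1,
    eq_of_forall_lowMat_sub fun m => (key m).2⟩, rfl⟩

theorem isUnit_of_lowMat_one_sub {P : Matrix (Fin r) (Fin r) (PsiDO R)} (hP : LowMat 1 (1 - P)) :
    IsUnit P := by
  simpa using isUnit_one_sub hP

theorem PsiDO.matrix_mul_assoc {k l m n : ℕ} (A : Matrix (Fin k) (Fin l) (PsiDO R))
    (B : Matrix (Fin l) (Fin m) (PsiDO R)) (C : Matrix (Fin m) (Fin n) (PsiDO R)) :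
    A * B * C = A * (B * C) :=
  Matrix.mul_assoc A B C

end Units

/-! ### Normalized matrices -/

/-- `ψ = 1 + ∑_{n ≥ 1} aₙ(x) z^(-n)`. -/
def IsNormalized {r : ℕ} (ψ : Matrix (Fin r) (Fin r) (RatFunc ℂ)⸨X⸩) : Prop :=
  (∀ i j, ∀ n < 0, (ψ i j).coeff n = 0) ∧
    ∀ i j, (ψ i j).coeff 0 = (1 : Matrix (Fin r) (Fin r) (RatFunc ℂ)) i j

theorem IsNormalized.isUnit_waveOperator {r : ℕ} {ψ : Matrix (Fin r) (Fin r) (RatFunc ℂ)⸨X⸩}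
    (h : IsNormalized ψ) : IsUnit (waveOperator ψ) := by
  refine isUnit_of_lowMat_one_sub fun i j n hn => ?_
  have h1 : (ofSymbol.symm ((1 : Matrix (Fin r) (Fin r) (PsiDO (RatFunc ℂ))) i j)).coeff n =
      if n = 0 then (1 : Matrix (Fin r) (Fin r) (RatFunc ℂ)) i j else 0 := by
    rw [Matrix.one_apply, Matrix.one_apply]
    split_ifs with h1 h2 h2
    · subst h2; exact HahnSeries.coeff_one.trans (if_pos rfl)
    · exact HahnSeries.coeff_one.trans (if_neg h2)
    · rfl
    · rfl
  change (ofSymbol.symm ((1 : Matrix (Fin r) (Fin r) (PsiDO (RatFunc ℂ))) i j)).coeff n -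
    (ψ i j).coeff n = 0
  rw [h1]
  split_ifs with h0
  · rw [h0, h.2, sub_self]
  · rw [h.1 i j n (by lia), sub_zero]

/-! ### Matrices of operators -/

theorem toPsiDO_injective : Function.Injective DiffOp.toPsiDO := by
  have : ∀ (Θ : DiffOp) (k : ℕ), (ofSymbol.symm Θ.toPsiDO).coeff (-(k : ℤ)) = Θ k := by
    intro Θ k
    rw [DiffOp.toPsiDO, Finsupp.sum, map_sum, HahnSeries.coeff_sum]
    change ∑ x ∈ Θ.support, (HahnSeries.single (-(x : ℤ)) (Θ x)).coeff (-(k : ℤ)) = _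
    rw [Finset.sum_eq_single k]
    · simp
    · intro b _ hb
      exact HahnSeries.coeff_single_of_ne (by lia)
    · intro hk
      simpa using hk
  intro Θ Θ' h
  ext k
  rw [← this, h, this]

theorem map_ofSymbol_bakerAct {m r s : ℕ} (Θ : Matrix (Fin m) (Fin r) DiffOp)
    (ψ : Matrix (Fin r) (Fin s) (RatFunc ℂ)⸨X⸩) :
    (bakerAct Θ ψ).map ofSymbol = Θ.map DiffOp.toPsiDO * ψ.map ofSymbol := by
  refine Matrix.ext fun i j => ?_
  refine Eq.trans ?_ (Matrix.mul_apply (M := Θ.map DiffOp.toPsiDO) (N := ψ.map ofSymbol)).symm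
  exact (ofSymbol_sum Finset.univ fun k => (Θ i k).actX (ψ k j)).trans
    (Finset.sum_congr rfl fun k _ => ofSymbol_actX (Θ i k) (ψ k j))

theorem map_ofSymbol_bakerStar {m r s : ℕ} (ψ : Matrix (Fin m) (Fin r) (RatFunc ℂ)⸨X⸩)
    (D : Matrix (Fin r) (Fin s) DiffOp) :
    (bakerStar ψ D).map ofSymbol = ψ.map ofSymbol * D.map DiffOp.bisp := by
  refine Matrix.ext fun i j => ?_
  refine Eq.trans ?_ (Matrix.mul_apply (M := ψ.map ofSymbol) (N := D.map DiffOp.bisp)).symm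
  exact (ofSymbol_sum Finset.univ fun k => (D k j).actZ (ψ i k)).trans
    (Finset.sum_congr rfl fun k _ => ofSymbol_actZ (D k j) (ψ i k))

theorem map_ofSymbol_injective {m r : ℕ} : Function.Injective
    (fun ψ : Matrix (Fin m) (Fin r) (RatFunc ℂ)⸨X⸩ => ψ.map ofSymbol) := fun ψ ψ' h => by
  ext1 i j
  exact ofSymbol.injective (congrFun (congrFun h i) j)

theorem mul_inverse_eq_iff {T : Type*} [Ring T] {m r : ℕ} (A : Matrix (Fin m) (Fin r) T)
    (B : Matrix (Fin m) (Fin r) T) {K : Matrix (Fin r) (Fin r) T} (hK : IsUnit K) :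
    A * Ring.inverse K = B ↔ A = B * K := by
  constructor
  · rintro rfl
    rw [Matrix.mul_assoc, Ring.inverse_mul_cancel _ hK, Matrix.mul_one]
  · rintro rfl
    rw [Matrix.mul_assoc, Ring.mul_inverse_cancel _ hK, Matrix.mul_one]

/-- On symbols the left side reads `K_U b(D) = Θ K_V`, and the unit `K_V` can be moved across. -/
theorem bakerStar_eq_bakerAct_iff {r s : ℕ} (ψU : Matrix (Fin r) (Fin r) (RatFunc ℂ)⸨X⸩)
    {ψV : Matrix (Fin s) (Fin s) (RatFunc ℂ)⸨X⸩} (hV : IsUnit (waveOperator ψV))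
    (D Θ : Matrix (Fin r) (Fin s) DiffOp) :
    bakerStar ψU D = bakerAct Θ ψV ↔ Θ.map DiffOp.toPsiDO =
      waveOperator ψU * D.map DiffOp.bisp * Ring.inverse (waveOperator ψV) := by
  have e1 := map_ofSymbol_bakerStar ψU D
  have e2 := map_ofSymbol_bakerAct Θ ψV
  have key := mul_inverse_eq_iff (waveOperator ψU * D.map DiffOp.bisp) (Θ.map DiffOp.toPsiDO) hV
  constructor
  · intro h
    exact (key.mpr (e1.symm.trans ((congrArg (fun φ => φ.map ofSymbol) h).trans e2))).symm
  · intro h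
    exact map_ofSymbol_injective (e1.trans ((key.mp h.symm).trans e2.symm))

/-- Left and right multiplication commute: this is associativity of operator composition. -/
theorem bakerAct_bakerStar {k m r s : ℕ} (Θ : Matrix (Fin k) (Fin m) DiffOp)
    (ψ : Matrix (Fin m) (Fin r) (RatFunc ℂ)⸨X⸩) (D : Matrix (Fin r) (Fin s) DiffOp) :
    bakerStar (bakerAct Θ ψ) D = bakerAct Θ (bakerStar ψ D) := by
  have e1 := map_ofSymbol_bakerStar (bakerAct Θ ψ) D
  have e2 := map_ofSymbol_bakerAct Θ ψ
  have e3 := map_ofSymbol_bakerStar ψ D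
  have e4 := map_ofSymbol_bakerAct Θ (bakerStar ψ D)
  rw [e2] at e1
  rw [e3] at e4
  have e5 := PsiDO.matrix_mul_assoc (Θ.map DiffOp.toPsiDO) (ψ.map ofSymbol) (D.map DiffOp.bisp)
  exact map_ofSymbol_injective (e1.trans (e5.trans e4.symm))

/-! ### Symbols and composition of differential operators in `z` -/

/-- The function `D.e^{xz} = ∑ₖ fₖ(z) x^k e^{xz}` of an operator `D = ∑ₖ fₖ(z) ∂_z^k`. -/
def DiffOp.symb (D : DiffOp) : (RatFunc ℂ)⸨X⸩ :=
  D.sum fun k a => expandHom (RatFunc ℂ) a * HahnSeries.C (RatFunc.X ^ k)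

namespace DiffOp

theorem symb_add (D E : DiffOp) : symb (D + E) = symb D + symb E :=
  Finsupp.sum_add_index' (fun k => by simp) fun k a b => by rw [map_add, add_mul]

theorem symb_single (k : ℕ) (a : RatFunc ℂ) :
    symb (Finsupp.single k a) = expandHom (RatFunc ℂ) a * HahnSeries.C (RatFunc.X ^ k) :=
  Finsupp.sum_single_index (by simp)

theorem symb_zero : symb 0 = 0 := Finsupp.sum_zero_index

theorem act_add (D E : DiffOp) (f : RatFunc ℂ) : act (D + E) f = act D f + act E f :=
  Finsupp.sum_add_index' (fun k => by simp) fun k a b => by rw [add_mul]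

theorem act_single (k : ℕ) (a f : RatFunc ℂ) :
    act (Finsupp.single k a) f = a * ratDeriv^[k] f :=
  Finsupp.sum_single_index (by simp)

theorem act_zero (f : RatFunc ℂ) : act 0 f = 0 := Finsupp.sum_zero_index

theorem actZ_add (D E : DiffOp) (φ : (RatFunc ℂ)⸨X⸩) : actZ (D + E) φ = actZ D φ + actZ E φ :=
  Finsupp.sum_add_index' (fun k => by simp [expandAtInfty_eq]) fun k a b => by
    simp only [expandAtInfty_eq, map_add, add_mul]

theorem actZ_single (k : ℕ) (a : RatFunc ℂ) (φ : (RatFunc ℂ)⸨X⸩) :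
    actZ (Finsupp.single k a) φ = expandHom (RatFunc ℂ) a * expDz^[k] φ :=
  Finsupp.sum_single_index (by simp [expandAtInfty_eq])

theorem actZ_zero (φ : (RatFunc ℂ)⸨X⸩) : actZ 0 φ = 0 := Finsupp.sum_zero_index

theorem actX_add (D E : DiffOp) (φ : (RatFunc ℂ)⸨X⸩) : actX (D + E) φ = actX D φ + actX E φ :=
  Finsupp.sum_add_index' (fun k => by simp) fun k a b => by rw [map_add, add_mul]

theorem actX_single (k : ℕ) (a : RatFunc ℂ) (φ : (RatFunc ℂ)⸨X⸩) :
    actX (Finsupp.single k a) φ = HahnSeries.C a * expDx^[k] φ :=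
  Finsupp.sum_single_index (by simp)

theorem actX_zero (φ : (RatFunc ℂ)⸨X⸩) : actX 0 φ = 0 := Finsupp.sum_zero_index

theorem symb_sum {ι : Type*} (s : Finset ι) (D : ι → DiffOp) :
    symb (∑ i ∈ s, D i) = ∑ i ∈ s, symb (D i) :=
  map_sum (AddMonoidHom.mk' symb symb_add) _ _

theorem act_sum {ι : Type*} (s : Finset ι) (D : ι → DiffOp) (f : RatFunc ℂ) :
    act (∑ i ∈ s, D i) f = ∑ i ∈ s, act (D i) f :=
  map_sum (AddMonoidHom.mk' (fun D => act D f) fun _ _ => act_add _ _ _) _ _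

end DiffOp

theorem dXi_polySeries {K : Type} [Field K] (p : K[X]) :
    dXi (polySeries K p) = polySeries K (derivative p) := by
  ext n
  rw [dXi_coeff]
  rcases lt_or_ge 0 n with h | h
  · rw [polySeries_coeff_pos _ h]
    rcases eq_or_ne n 1 with rfl | h1
    · simp
    · rw [polySeries_coeff_pos _ (by lia)]
      simp
  · obtain ⟨k, rfl⟩ : ∃ k : ℕ, n = -(k : ℤ) := ⟨(-n).toNat, by lia⟩
    rw [polySeries_coeff_neg, show -(k : ℤ) - 1 = -((k + 1 : ℕ) : ℤ) by push_cast; ring,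
      polySeries_coeff_neg, coeff_derivative]
    push_cast
    ring

/-- Both derivations agree on polynomials, and the Leibniz rule for `f * denom = num` determines the
derivative of a quotient. -/
theorem dXi_expandHom (K : Type) [Field K] [Algebra ℂ K] (f : RatFunc ℂ) :
    dXi (expandHom K f) = expandHom K (ratDeriv f) := by
  have hpoly : ∀ p : ℂ[X], dXi (expandHom K (algebraMap ℂ[X] (RatFunc ℂ) p)) =
      expandHom K (ratDeriv (algebraMap ℂ[X] (RatFunc ℂ) p)) := by
    intro p
    rw [ratDeriv_algebraMap, expandHom_algebraMap, expandHom_algebraMap, dXi_polySeries,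
      derivative_map]
  set q := algebraMap ℂ[X] (RatFunc ℂ) f.denom
  have hq : expandHom K q ≠ 0 := by
    rw [Ne, map_eq_zero_iff _ expandHom_injective]
    exact RatFunc.algebraMap_ne_zero f.denom_ne_zero
  have hf : f * q = algebraMap ℂ[X] (RatFunc ℂ) f.num := by
    conv_lhs => rw [← f.num_div_denom]
    exact div_mul_cancel₀ _ (RatFunc.algebraMap_ne_zero f.denom_ne_zero)
  have h1 := hpoly f.num
  rw [← hf, map_mul, dXi_mul, ratDeriv_mul, map_add, map_mul, map_mul, hpoly f.denom] at h1
  exact mul_right_cancel₀ hq (add_right_cancel h1)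

theorem expDz_add (φ χ : (RatFunc ℂ)⸨X⸩) : expDz (φ + χ) = expDz φ + expDz χ := by
  rw [expDz, expDz, expDz, map_add]
  ring

theorem expDz_C_mul (a : RatFunc ℂ) (φ : (RatFunc ℂ)⸨X⸩) :
    expDz (HahnSeries.C a * φ) = HahnSeries.C a * expDz φ := by
  rw [expDz, expDz, dXi_mul, dXi_C]
  ring

theorem expDz_iterate_C_mul (a : RatFunc ℂ) (φ : (RatFunc ℂ)⸨X⸩) (k : ℕ) :
    expDz^[k] (HahnSeries.C a * φ) = HahnSeries.C a * expDz^[k] φ := by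
  induction k with
  | zero => rfl
  | succ k ih => rw [Function.iterate_succ_apply', ih, expDz_C_mul, Function.iterate_succ_apply']

theorem DiffOp.actZ_C_mul (D : DiffOp) (a : RatFunc ℂ) (φ : (RatFunc ℂ)⸨X⸩) :
    D.actZ (HahnSeries.C a * φ) = HahnSeries.C a * D.actZ φ := by
  rw [actZ, actZ, Finsupp.sum, Finsupp.sum, Finset.mul_sum]
  refine Finset.sum_congr rfl fun k _ => ?_
  rw [expDz_iterate_C_mul]
  ring

/-- The composite `∂_z D`, recorded through its value on `e^{xz}` and its action on `ℂ(z)`; these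
two data replace a ring structure on `DiffOp`. -/
theorem DiffOp.exists_deriv_comp (D : DiffOp) :
    ∃ E : DiffOp, E.symb = expDz D.symb ∧ ∀ f, E.act f = ratDeriv (D.act f) := by
  induction D using Finsupp.induction_linear with
  | zero => exact ⟨0, by simp [symb_zero, expDz], fun f => by simp [act_zero, ratDeriv_zero]⟩
  | add D D' h h' =>
    obtain ⟨E, h1, h2⟩ := h
    obtain ⟨E', h1', h2'⟩ := h'
    exact ⟨E + E', by rw [symb_add, symb_add, expDz_add, h1, h1'],
      fun f => by rw [act_add, act_add, ratDeriv_add, h2, h2']⟩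
  | single k a =>
    refine ⟨Finsupp.single k (ratDeriv a) + Finsupp.single (k + 1) a, ?_, fun f => ?_⟩
    · rw [symb_add, symb_single, symb_single, symb_single,
        mul_comm _ (HahnSeries.C (RatFunc.X ^ k)),
        mul_comm _ (HahnSeries.C (RatFunc.X ^ k)), expDz_C_mul, expDz, dXi_expandHom, pow_succ,
        map_mul]
      ring
    · rw [act_add, act_single, act_single, act_single, ratDeriv_mul, Function.iterate_succ_apply']

/-- Composition of differential operators, on symbols. -/
theorem DiffOp.exists_comp (D E : DiffOp) :
    ∃ F : DiffOp, F.symb = D.actZ E.symb ∧ ∀ f, F.act f = D.act (E.act f) := by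
  induction D using Finsupp.induction_linear with
  | zero => exact ⟨0, by rw [symb_zero, actZ_zero], fun f => by rw [act_zero, act_zero]⟩
  | add D D' h h' =>
    obtain ⟨E, h1, h2⟩ := h
    obtain ⟨E', h1', h2'⟩ := h'
    exact ⟨E + E', by rw [symb_add, actZ_add, h1, h1'],
      fun f => by rw [act_add, act_add, h2, h2']⟩
  | single k a =>
    have : ∃ G : DiffOp, G.symb = expDz^[k] E.symb ∧ ∀ f, G.act f = ratDeriv^[k] (E.act f) := by
      induction k with
      | zero => exact ⟨E, rfl, fun _ => rfl⟩
      | succ k ih =>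
        obtain ⟨G, h1, h2⟩ := ih
        obtain ⟨H, h3, h4⟩ := G.exists_deriv_comp
        exact ⟨H, by rw [h3, h1, Function.iterate_succ_apply'],
          fun f => by rw [h4, h2, Function.iterate_succ_apply']⟩
    obtain ⟨G, h1, h2⟩ := this
    refine ⟨G.mapRange (a * ·) (mul_zero a), ?_, fun f => ?_⟩
    · rw [actZ_single, ← h1, symb, Finsupp.sum_mapRange_index (by simp), symb, Finsupp.sum,
        Finsupp.sum, Finset.mul_sum]
      exact Finset.sum_congr rfl fun _ _ => by rw [map_mul, mul_assoc]
    · rw [act_single, ← h2, act, Finsupp.sum_mapRange_index (by simp), act, Finsupp.sum,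
        Finsupp.sum, Finset.mul_sum]
      exact Finset.sum_congr rfl fun _ _ => by rw [mul_assoc]

/-- The composite `F` of `E` and `D` links the two sides of the theorem: its action is that of `E`
followed by `⋆ D`, and its value on `e^{xz}` is `(E.e^{xz}) ⋆ D`. -/
theorem exists_row_comp {r s : ℕ} (E : Fin r → DiffOp) (D : Matrix (Fin r) (Fin s) DiffOp) :
    ∃ F : Fin s → DiffOp, (∀ j, (F j).symb = ∑ k, (D k j).actZ (E k).symb) ∧
      ∀ f, (fun j => (F j).act f) = rowStar (fun k => (E k).act f) D := by
  choose F h1 h2 using fun k j => (D k j).exists_comp (E k)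
  refine ⟨fun j => ∑ k, F k j, fun j => ?_, fun f => funext fun j => ?_⟩
  · rw [DiffOp.symb_sum]
    exact Finset.sum_congr rfl fun k _ => h1 k j
  · rw [DiffOp.act_sum, rowStar]
    exact Finset.sum_congr rfl fun k _ => h2 k j f

/-! ### Subspaces cut out by finitely many point conditions -/

/-- A nonzero polynomial `q` and finitely many linear functionals on `ℂ[z]^r`, each of them
supported at a point `c j`. -/
structure PointConditions (r : ℕ) where
  /-- The denominator. -/
  q : ℂ[X]
  q_ne_zero : q ≠ 0
  /-- The index set of the functionals. -/
  J : Type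
  fintype : Fintype J
  /-- The support of the functionals. -/
  c : J → ℂ
  /-- The order of the functionals. -/
  κ : ℕ
  /-- The functionals. -/
  lam : J → (Fin r → ℂ[X]) →ₗ[ℂ] ℂ
  lam_pow_smul : ∀ j u, lam j ((X - C (c j)) ^ κ • u) = 0

namespace PointConditions

variable {r : ℕ} (S : PointConditions r)

instance : Fintype S.J := S.fintype

/-- `W` consists of the `f` such that `q f` is polynomial and satisfies the conditions. -/
def Cuts (W : Submodule ℂ (Fin r → RatFunc ℂ)) : Prop :=
  ∀ f : Fin r → RatFunc ℂ, f ∈ W ↔ ∃ u : Fin r → ℂ[X],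
    algebraMap ℂ[X] (RatFunc ℂ) S.q • f = polyRow u ∧ ∀ j, S.lam j u = 0

end PointConditions

/-- Division with remainder by `(z - c)^k`: rows of degree below `k` represent every class of the
quotient. -/
theorem IsPrimaryAt.finite {r : ℕ} {c : ℂ} {V : Submodule ℂ (Fin r → ℂ[X])} (h : IsPrimaryAt c V) :
    Module.Finite ℂ ((Fin r → ℂ[X]) ⧸ V) := by
  obtain ⟨k, hk⟩ := h
  have hm : ((X - C c) ^ k : ℂ[X]).Monic := (monic_X_sub_C c).pow k
  let f : (Fin r → degreeLT ℂ k) →ₗ[ℂ] (Fin r → ℂ[X]) :=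
    LinearMap.pi fun i => (degreeLT ℂ k).subtype ∘ₗ LinearMap.proj i
  have : Module.Finite ℂ (degreeLT ℂ k) := Module.Finite.equiv (degreeLTEquiv ℂ k).symm
  refine Module.Finite.of_surjective (V.mkQ ∘ₗ f) fun y => ?_
  obtain ⟨u, rfl⟩ := V.mkQ_surjective y
  refine ⟨fun i => ⟨u i %ₘ (X - C c) ^ k, ?_⟩, ?_⟩
  · rw [mem_degreeLT]
    refine (degree_modByMonic_lt _ hm).trans_le ?_
    rw [degree_pow, degree_X_sub_C, nsmul_one]
  · rw [LinearMap.comp_apply, ← sub_eq_zero, ← map_sub, Submodule.mkQ_apply,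
      Submodule.Quotient.mk_eq_zero]
    convert V.neg_mem (hk fun i => u i /ₘ (X - C c) ^ k) using 1
    ext1 i
    have := modByMonic_add_div (u i) ((X - C c) ^ k)
    simp only [Pi.sub_apply, Pi.neg_apply, Pi.smul_apply, smul_eq_mul]
    change u i %ₘ (X - C c) ^ k - u i = _
    linear_combination this

/-- Coordinates on the finite-dimensional quotients by the primary subspaces serve as functionals,
and the largest exponent serves as the common order `κ`. -/
theorem IsPrimaryDecomposable.exists_pointConditions {r : ℕ}
    {W : Submodule ℂ (Fin r → RatFunc ℂ)} (h : IsPrimaryDecomposable W) :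
    ∃ S : PointConditions r, S.Cuts W := by
  obtain ⟨q, hq, S, V, hV, hW⟩ := h
  choose! k hk using hV
  have hfin : ∀ c : S, Module.Finite ℂ ((Fin r → ℂ[X]) ⧸ V c) := fun c =>
    IsPrimaryAt.finite ⟨k c, hk c c.2⟩
  refine ⟨{
    q := q
    q_ne_zero := hq
    J := Σ c : S, Fin (Module.finrank ℂ ((Fin r → ℂ[X]) ⧸ V c))
    fintype := inferInstance
    c := fun j => j.1
    κ := S.sup k
    lam := fun j => (Module.finBasis ℂ ((Fin r → ℂ[X]) ⧸ V j.1)).coord j.2 ∘ₗ (V j.1).mkQ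
    lam_pow_smul := fun j u => ?_ }, fun f => ?_⟩
  · obtain ⟨d, hd⟩ := Nat.exists_eq_add_of_le (Finset.le_sup (f := k) j.1.2)
    rw [hd, pow_add, mul_smul, LinearMap.comp_apply, Submodule.mkQ_apply,
      (Submodule.Quotient.mk_eq_zero _).mpr (hk _ j.1.2 _), map_zero]
  · rw [hW]
    refine exists_congr fun u => and_congr_right fun _ => ⟨fun h j => ?_, fun h c hc => ?_⟩
    · change (Module.finBasis ℂ _).coord j.2 (Submodule.Quotient.mk u) = 0
      rw [(Submodule.Quotient.mk_eq_zero _).mpr (h _ j.1.2), map_zero]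
    · rw [← Submodule.Quotient.mk_eq_zero]
      have := hfin ⟨c, hc⟩
      exact (Module.finBasis ℂ ((Fin r → ℂ[X]) ⧸ V c)).ext_elem fun i => by
        simpa using h ⟨⟨c, hc⟩, i⟩

namespace PointConditions

variable {r : ℕ} (S : PointConditions r)

theorem lam_pow_smul_of_le (j : S.J) {t : ℕ} (ht : S.κ ≤ t) (u : Fin r → ℂ[X]) :
    S.lam j ((X - C (S.c j)) ^ t • u) = 0 := by
  obtain ⟨d, rfl⟩ := Nat.exists_eq_add_of_le ht
  rw [pow_add, mul_smul, S.lam_pow_smul]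

theorem lam_smul_of_dvd (j : S.J) {g : ℂ[X]} (hg : (X - C (S.c j)) ^ S.κ ∣ g) (u : Fin r → ℂ[X]) :
    S.lam j (g • u) = 0 := by
  obtain ⟨d, rfl⟩ := hg
  rw [mul_smul, S.lam_pow_smul]

/-- The condition that `v e^{xz}` satisfies the condition `lam j`, as a polynomial in `x`: it is
`e^(-c j x)` times the value of `lam j` on the expansion of `v e^{xz}` at `c j`. -/
def cond (j : S.J) : (Fin r → ℂ[X]) →ₗ[ℂ] ℂ[X] :=
  ∑ t ∈ Finset.range S.κ, monomial t ∘ₗ ((t.factorial : ℂ)⁻¹ • S.lam j ∘ₗ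
    (LinearMap.lsmul ℂ[X] (Fin r → ℂ[X]) ((X - C (S.c j)) ^ t)).restrictScalars ℂ)

theorem cond_apply (j : S.J) (v : Fin r → ℂ[X]) : S.cond j v = ∑ t ∈ Finset.range S.κ,
    monomial t ((t.factorial : ℂ)⁻¹ * S.lam j ((X - C (S.c j)) ^ t • v)) := by
  simp [cond]

theorem coeff_cond (j : S.J) (v : Fin r → ℂ[X]) (t : ℕ) :
    (S.cond j v).coeff t = (t.factorial : ℂ)⁻¹ * S.lam j ((X - C (S.c j)) ^ t • v) := by
  rw [cond_apply, finsetSum_coeff]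
  simp only [coeff_monomial]
  rw [Finset.sum_ite_eq']
  split_ifs with h
  · rfl
  · rw [S.lam_pow_smul_of_le j (by simpa using h), mul_zero]

theorem coeff_cond_of_le (j : S.J) (v : Fin r → ℂ[X]) {t : ℕ} (ht : S.κ ≤ t) :
    (S.cond j v).coeff t = 0 := by
  rw [coeff_cond, S.lam_pow_smul_of_le j ht, mul_zero]

/-- Differentiating `e^{x(z-c)} v` in `x` multiplies it by `z - c`. -/
theorem derivative_cond (j : S.J) (v : Fin r → ℂ[X]) :
    derivative (S.cond j v) = S.cond j ((X - C (S.c j)) • v) := by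
  ext t
  rw [coeff_derivative, coeff_cond, coeff_cond, smul_smul, ← pow_succ, Nat.factorial_succ]
  push_cast
  field_simp

/-- Since `x^k e^{x(z-c)} = ∂_z^k e^{x(z-c)}`, the sum is the functional applied to `∑ N_k ∂_z^k`
acting on `e^{x(z-c)}`, and the coefficient of `x^t` picks out `(z-c)^t / t!`. -/
theorem coeff_sum_X_pow_mul_cond (j : S.J) (N : ℕ → Fin r → ℂ[X]) (n t : ℕ) :
    (∑ k ∈ Finset.range n, X ^ k * S.cond j (N k)).coeff t = (t.factorial : ℂ)⁻¹ *
      S.lam j (∑ k ∈ Finset.range n, (derivative^[k] ((X - C (S.c j)) ^ t)) • N k) := by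
  rw [finsetSum_coeff, map_sum, Finset.mul_sum]
  refine Finset.sum_congr rfl fun k _ => ?_
  rw [coeff_X_pow_mul', iterate_derivative_X_sub_pow]
  split_ifs with h
  · rw [coeff_cond, smul_assoc, map_nsmul, nsmul_eq_mul, ← mul_assoc]
    congr 1
    have := Nat.factorial_mul_descFactorial h
    have h1 : ((t.factorial : ℕ) : ℂ) ≠ 0 := by exact_mod_cast Nat.factorial_ne_zero _
    have h2 : (((t - k).factorial : ℕ) : ℂ) ≠ 0 := by exact_mod_cast Nat.factorial_ne_zero _
    field_simp
    exact_mod_cast this.symm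
  · rw [Nat.descFactorial_of_lt (not_le.mp h), zero_smul, zero_smul, map_zero, mul_zero]

/-- The powers of `z - c` generated by `e^{x(z-c)}` span all polynomials, so one identity in `x`
tests every `p`. -/
theorem sum_X_pow_mul_cond_eq_zero_iff (j : S.J) (N : ℕ → Fin r → ℂ[X]) (n : ℕ) :
    ∑ k ∈ Finset.range n, X ^ k * S.cond j (N k) = 0 ↔
      ∀ p : ℂ[X], S.lam j (∑ k ∈ Finset.range n, (derivative^[k] p) • N k) = 0 := by
  constructor
  · intro h p
    have key : ∀ t, S.lam j (∑ k ∈ Finset.range n,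
        (derivative^[k] ((X - C (S.c j)) ^ t)) • N k) = 0 := fun t => by
      have := S.coeff_sum_X_pow_mul_cond j N n t
      rw [h, coeff_zero, eq_comm, mul_eq_zero] at this
      exact this.resolve_left (inv_ne_zero (by exact_mod_cast Nat.factorial_ne_zero _))
    have hp : p = ∑ t ∈ (taylor (S.c j) p).support,
        (taylor (S.c j) p).coeff t • (X - C (S.c j)) ^ t := by
      conv_lhs => rw [← sum_taylor_eq p (S.c j), Polynomial.sum]
      exact Finset.sum_congr rfl fun t _ => (smul_eq_C_mul _).symm
    rw [hp]
    have : ∀ k, derivative^[k] (∑ t ∈ (taylor (S.c j) p).support,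
        (taylor (S.c j) p).coeff t • (X - C (S.c j)) ^ t) = ∑ t ∈ (taylor (S.c j) p).support,
        (taylor (S.c j) p).coeff t • derivative^[k] ((X - C (S.c j)) ^ t) := fun k => by
      rw [iterate_derivative_sum]
      exact Finset.sum_congr rfl fun t _ => iterate_derivative_smul _ _ _
    simp only [this, Finset.sum_smul]
    rw [Finset.sum_comm, map_sum]
    refine Finset.sum_eq_zero fun t _ => ?_
    simp only [smul_assoc]
    rw [← Finset.smul_sum, map_smul, key, smul_zero]
  · intro h
    ext t
    rw [S.coeff_sum_X_pow_mul_cond, h, mul_zero, coeff_zero]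

end PointConditions

/-! ### Operators into `W` -/

theorem DiffOp.act_eq_sum {D : DiffOp} {n : ℕ} (h : ∀ k, n ≤ k → D k = 0) (f : RatFunc ℂ) :
    D.act f = ∑ k ∈ Finset.range n, D k * ratDeriv^[k] f :=
  Finsupp.sum_of_support_subset _ (fun k hk => by
    by_contra hn
    exact (Finsupp.mem_support_iff.mp hk) (h k (by simpa using hn))) _ fun _ _ => zero_mul _

theorem DiffOp.symb_eq_sum {D : DiffOp} {n : ℕ} (h : ∀ k, n ≤ k → D k = 0) :
    D.symb = ∑ k ∈ Finset.range n,
      expandHom (RatFunc ℂ) (D k) * HahnSeries.C (RatFunc.X ^ k) :=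
  Finsupp.sum_of_support_subset _ (fun k hk => by
    by_contra hn
    exact (Finsupp.mem_support_iff.mp hk) (h k (by simpa using hn))) _ fun _ _ => by simp

theorem exists_order_bound {r : ℕ} (D : Fin r → DiffOp) :
    ∃ n : ℕ, ∀ i k, n ≤ k → D i k = 0 := by
  refine ⟨Finset.univ.sup (fun i => (D i).support.sup id) + 1, fun i k hk => ?_⟩
  by_contra h
  have h1 : k ≤ (D i).support.sup id := Finset.le_sup (f := id) (Finsupp.mem_support_iff.mpr h)
  have h2 : (D i).support.sup id ≤ _ :=
    Finset.le_sup (f := fun i => (D i).support.sup id) (Finset.mem_univ i)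
  lia

namespace PointConditions

variable {r : ℕ} {S : PointConditions r} {W : Submodule ℂ (Fin r → RatFunc ℂ)}

/-- The coefficients of an operator into `W` have denominator `q`. -/
theorem Cuts.exists_coeff (hW : S.Cuts W) {D : Fin r → DiffOp} (hD : D ∈ opsInto W) :
    ∃ N : ℕ → Fin r → ℂ[X],
      ∀ k i, algebraMap ℂ[X] (RatFunc ℂ) S.q * D i k = algebraMap ℂ[X] (RatFunc ℂ) (N k i) := by
  have key : ∀ i k, algebraMap ℂ[X] (RatFunc ℂ) S.q * D i k ∈
      (algebraMap ℂ[X] (RatFunc ℂ)).range := by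
    intro i k
    induction k using Nat.strong_induction_on with
    | _ k ih =>
      -- Test on `z^k`: terms of order above `k` vanish, order `k` contributes `k! D_k`, and the
      -- lower ones become polynomial after multiplication by `q`, by induction.
      obtain ⟨u, hu, -⟩ := (hW _).mp (hD (X ^ k))
      have h1 := congrFun hu i
      obtain ⟨n, hn⟩ := exists_order_bound D
      change algebraMap ℂ[X] (RatFunc ℂ) S.q *
        (D i).act (algebraMap ℂ[X] (RatFunc ℂ) (X ^ k)) = algebraMap ℂ[X] (RatFunc ℂ) (u i) at h1
      rw [DiffOp.act_eq_sum (n := k + 1 + n) (fun l hl => hn i l (by lia)), Finset.mul_sum,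
        Finset.sum_range_add, Finset.sum_range_succ] at h1
      have h2 : ∀ l, algebraMap ℂ[X] (RatFunc ℂ) S.q * (D i (k + 1 + l) *
          ratDeriv^[k + 1 + l] (algebraMap ℂ[X] (RatFunc ℂ) (X ^ k))) = 0 := fun l => by
        rw [ratDeriv_iterate_algebraMap, iterate_derivative_eq_zero (by
          rw [natDegree_X_pow]; lia), map_zero, mul_zero, mul_zero]
      simp only [h2, Finset.sum_const_zero, add_zero] at h1
      rw [ratDeriv_iterate_algebraMap, iterate_derivative_X_pow_eq_C_mul, Nat.sub_self, pow_zero,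
        mul_one, Nat.descFactorial_self] at h1
      have h3 : (C ((k.factorial : ℂ)) : ℂ[X]) * C ((k.factorial : ℂ)⁻¹) = 1 := by
        rw [← C_mul, mul_inv_cancel₀ (by exact_mod_cast Nat.factorial_ne_zero _), C_1]
      have h4 : algebraMap ℂ[X] (RatFunc ℂ) S.q * D i k = (algebraMap ℂ[X] (RatFunc ℂ) (u i) -
          ∑ l ∈ Finset.range k, algebraMap ℂ[X] (RatFunc ℂ) S.q * (D i l *
            ratDeriv^[l] (algebraMap ℂ[X] (RatFunc ℂ) (X ^ k)))) *
          algebraMap ℂ[X] (RatFunc ℂ) (C ((k.factorial : ℂ)⁻¹)) := by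
        rw [← h1, add_sub_cancel_left, mul_assoc, mul_assoc, ← map_mul, h3, map_one, mul_one]
      rw [h4]
      refine Subring.mul_mem _ (Subring.sub_mem _ ⟨_, rfl⟩ (Subring.sum_mem _ fun l hl => ?_))
        ⟨_, rfl⟩
      rw [← mul_assoc, ratDeriv_iterate_algebraMap]
      exact Subring.mul_mem _ (ih l (Finset.mem_range.mp hl)) ⟨_, rfl⟩
  choose N hN using key
  exact ⟨fun k i => N i k, fun k i => (hN i k).symm⟩

theorem mem_opsInto_aux {D : Fin r → DiffOp} {N : ℕ → Fin r → ℂ[X]} {n : ℕ}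
    (hN : ∀ k i, algebraMap ℂ[X] (RatFunc ℂ) S.q * D i k = algebraMap ℂ[X] (RatFunc ℂ) (N k i))
    (hn : ∀ i k, n ≤ k → D i k = 0) (p : ℂ[X]) :
    (algebraMap ℂ[X] (RatFunc ℂ) S.q • fun i => (D i).act (algebraMap ℂ[X] (RatFunc ℂ) p)) =
      polyRow (∑ k ∈ Finset.range n, (derivative^[k] p) • N k) := by
  ext1 i
  change algebraMap ℂ[X] (RatFunc ℂ) S.q * (D i).act _ = _
  rw [DiffOp.act_eq_sum (hn i), Finset.mul_sum, polyRow, Finset.sum_apply, map_sum]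
  refine Finset.sum_congr rfl fun k _ => ?_
  rw [← mul_assoc, hN, ratDeriv_iterate_algebraMap, Pi.smul_apply, smul_eq_mul, map_mul, mul_comm]

theorem polyRow_injective : Function.Injective (polyRow (r := r)) := fun _ _ h =>
  funext fun i => RatFunc.algebraMap_injective ℂ (congrFun h i)

/-- Multiplying `D.p` by `q` gives `∑ p^{(k)} N_k`, so the conditions for all `p` together form one
polynomial identity in `x` for each functional. -/
theorem Cuts.mem_opsInto_iff (hW : S.Cuts W) {D : Fin r → DiffOp} {N : ℕ → Fin r → ℂ[X]} {n : ℕ}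
    (hN : ∀ k i, algebraMap ℂ[X] (RatFunc ℂ) S.q * D i k = algebraMap ℂ[X] (RatFunc ℂ) (N k i))
    (hn : ∀ i k, n ≤ k → D i k = 0) :
    D ∈ opsInto W ↔ ∀ j, ∑ k ∈ Finset.range n, X ^ k * S.cond j (N k) = 0 := by
  simp only [S.sum_X_pow_mul_cond_eq_zero_iff]
  rw [forall_comm]
  refine forall_congr' fun p => ?_
  rw [hW, mem_opsInto_aux hN hn p]
  constructor
  · rintro ⟨u, h1, h2⟩
    rw [polyRow_injective h1]
    exact h2
  · exact fun h => ⟨_, rfl, h⟩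

/-- The Taylor expansion at `z`, truncated and evaluated at `b`. -/
theorem dvd_taylor_sub (b : ℂ) (κ : ℕ) (p : ℂ[X]) :
    (X - C b) ^ κ ∣ ∑ l ∈ Finset.range (κ + 1),
      ((l.factorial : ℂ)⁻¹ • (C b - X) ^ l) * derivative^[l] p - C (p.eval b) := by
  have h1 : ∀ l, ((l.factorial : ℂ)⁻¹ • (C b - X) ^ l) * derivative^[l] p =
      hasseDeriv l p * (C b - X) ^ l := fun l => by
    have := congrFun (factorial_smul_hasseDeriv (R := ℂ) l) p
    change (l.factorial : ℕ) • hasseDeriv l p = _ at this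
    rw [← this, smul_mul_assoc, mul_smul_comm, ← Nat.cast_smul_eq_nsmul ℂ, smul_smul,
      inv_mul_cancel₀ (by exact_mod_cast Nat.factorial_ne_zero _), one_smul, mul_comm]
  -- The exact Taylor formula for `p` at the variable point `z`, evaluated at `b`. The range is long
  -- enough to contain every nonzero term, and the terms beyond the truncation are divisible by `(z
  -- - b)^κ`.
  have h2 : C (p.eval b) = ∑ l ∈ Finset.range (κ + 1 + (p.natDegree + 1)),
      hasseDeriv l p * (C b - X) ^ l := by
    have := taylor_eval (X : ℂ[X]) (p.map C) (C b - X)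
    rw [sub_add_cancel, eval_map, eval₂_at_apply] at this
    rw [← this, eval_eq_sum_range' (n := κ + 1 + (p.natDegree + 1))]
    · refine Finset.sum_congr rfl fun l _ => ?_
      have : hasseDeriv l (p.map C) = (hasseDeriv l p).map C := by
        ext n
        simp [hasseDeriv_coeff]
      rw [taylor_coeff, this, eval_map, eval₂_C_X]
    · rw [natDegree_taylor]
      exact natDegree_map_le.trans_lt (by lia)
  rw [h2, Finset.sum_range_add _ (κ + 1)]
  simp only [h1]
  rw [sub_add_cancel_left, dvd_neg]
  refine Finset.dvd_sum fun l _ => Dvd.dvd.mul_left ?_ _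
  rw [← neg_sub X (C b), neg_pow]
  exact Dvd.dvd.mul_left (pow_dvd_pow _ (by lia)) _

/-- Every element of `W` is the value at `1` of an operator into `W`. -/
theorem Cuts.exists_opsInto_apply_zero (hW : S.Cuts W) {f : Fin r → RatFunc ℂ} (hf : f ∈ W) :
    ∃ D ∈ opsInto W, ∀ i, (D i).act 1 = f i := by
  classical
  obtain ⟨v, hv, hlam⟩ := (hW f).mp hf
  -- Chinese remainder theorem: `e a` is `1` modulo `(z - a)^κ` and `0` modulo `(z - b)^κ` at the
  -- other points `b` of `T`.
  set T : Finset ℂ := Finset.univ.image S.c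
  have hcop : ∀ a b : ℂ, a ≠ b → IsCoprime ((X - C a : ℂ[X]) ^ S.κ) ((X - C b) ^ S.κ) :=
    fun a b h => (isCoprime_X_sub_C_of_isUnit_sub (sub_ne_zero.mpr h).isUnit).pow
  have hcop' : ∀ a, IsCoprime ((X - C a : ℂ[X]) ^ S.κ) (∏ b ∈ T.erase a, (X - C b) ^ S.κ) :=
    fun a => IsCoprime.prod_right fun b hb => hcop a b (Finset.ne_of_mem_erase hb).symm
  choose α β hαβ using hcop'
  set e : ℂ → ℂ[X] := fun a => β a * ∏ b ∈ T.erase a, (X - C b) ^ S.κ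
  have he : ∀ a, (X - C a) ^ S.κ ∣ 1 - e a := fun a => ⟨α a, by
    linear_combination -(hαβ a)⟩
  have he' : ∀ a b, b ∈ T → a ≠ b → (X - C b) ^ S.κ ∣ e a := fun a b hb hab =>
    Dvd.dvd.mul_left (Finset.dvd_prod_of_mem _ (Finset.mem_erase.mpr ⟨hab.symm, hb⟩)) _
  -- The scalar operator `G = ∑ g_l ∂^l` glues the truncated Taylor operators at the points of `T`.
  -- It satisfies `G.p ≡ p(a)` modulo `(z - a)^κ` at each `a ∈ T`; the summand `1 - ∑ e_a` secures
  -- `G.1 = 1`. Then `D.p = (G.p) f` meets the conditions because `f` does.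
  set g : ℕ → ℂ[X] := fun l => (if l = 0 then 1 - ∑ a ∈ T, e a else 0) +
    ∑ a ∈ T, e a * ((l.factorial : ℂ)⁻¹ • (C a - X) ^ l) with hg
  set D : Fin r → DiffOp := fun i => ∑ l ∈ Finset.range (S.κ + 1),
    Finsupp.single l (algebraMap ℂ[X] (RatFunc ℂ) (g l) * f i) with hD
  have hact : ∀ (p : ℂ[X]) i, (D i).act (algebraMap ℂ[X] (RatFunc ℂ) p) =
      algebraMap ℂ[X] (RatFunc ℂ) (∑ l ∈ Finset.range (S.κ + 1), g l * derivative^[l] p) * f i := by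
    intro p i
    rw [hD, DiffOp.act_sum, map_sum, Finset.sum_mul]
    refine Finset.sum_congr rfl fun l _ => ?_
    rw [DiffOp.act_single, ratDeriv_iterate_algebraMap, map_mul]
    ring
  have hG : ∀ p : ℂ[X], ∑ l ∈ Finset.range (S.κ + 1), g l * derivative^[l] p =
      (1 - ∑ a ∈ T, e a) * p + ∑ a ∈ T, e a * ∑ l ∈ Finset.range (S.κ + 1),
        ((l.factorial : ℂ)⁻¹ • (C a - X) ^ l) * derivative^[l] p := by
    intro p
    simp only [hg, add_mul, Finset.sum_add_distrib]
    congr 1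
    · rw [Finset.sum_eq_single 0]
      · simp
      · intro l _ hl
        rw [if_neg hl, zero_mul]
      · simp
    · simp only [Finset.sum_mul, Finset.mul_sum]
      rw [Finset.sum_comm]
      simp only [mul_assoc]
  refine ⟨D, fun p => (hW _).mpr ⟨(∑ l ∈ Finset.range (S.κ + 1), g l * derivative^[l] p) • v,
    ?_, fun j => ?_⟩, fun i => ?_⟩
  · ext1 i
    have := congrFun hv i
    change algebraMap ℂ[X] (RatFunc ℂ) S.q * f i = algebraMap ℂ[X] (RatFunc ℂ) (v i) at this
    change algebraMap ℂ[X] (RatFunc ℂ) S.q * (D i).act _ =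
      algebraMap ℂ[X] (RatFunc ℂ) (_ * v i)
    rw [hact, map_mul, ← this]
    ring
  · have hj : S.c j ∈ T := Finset.mem_image_of_mem _ (Finset.mem_univ j)
    have hdvd : (X - C (S.c j)) ^ S.κ ∣
        ∑ l ∈ Finset.range (S.κ + 1), g l * derivative^[l] p - C (p.eval (S.c j)) := by
      have ht := dvd_taylor_sub (S.c j) S.κ p
      rw [hG, ← Finset.add_sum_erase T e hj, ← Finset.add_sum_erase T _ hj]
      set t : ℂ → ℂ[X] := fun a => ∑ l ∈ Finset.range (S.κ + 1),
        ((l.factorial : ℂ)⁻¹ • (C a - X) ^ l) * derivative^[l] p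
      -- Each of the three summands on the right is divisible by `(z - c_j)^κ`: by the first
      -- congruence for `e`, by Taylor's formula, and by the vanishing of the other `e a` at `c_j`.
      have e1 : (1 - (e (S.c j) + ∑ a ∈ T.erase (S.c j), e a)) * p +
          (e (S.c j) * t (S.c j) + ∑ a ∈ T.erase (S.c j), e a * t a) - C (p.eval (S.c j)) =
          (1 - e (S.c j)) * (p - t (S.c j)) + (t (S.c j) - C (p.eval (S.c j))) +
            ∑ a ∈ T.erase (S.c j), e a * (t a - p) := by
        simp only [mul_sub, Finset.sum_sub_distrib, ← Finset.sum_mul]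
        ring
      rw [e1]
      exact ((Dvd.dvd.mul_right (he _) _).add ht).add (Finset.dvd_sum fun a ha =>
        Dvd.dvd.mul_right (he' a _ hj (Finset.ne_of_mem_erase ha)) _)
    have h1 := S.lam_smul_of_dvd j hdvd v
    rw [sub_smul, map_sub, sub_eq_zero] at h1
    rw [h1, ← mul_one (C _), ← smul_eq_C_mul, smul_assoc, one_smul, map_smul, hlam, smul_zero]
  · have := hact 1 i
    rw [map_one, hG, mul_one] at this
    rw [this]
    have h2 : ∀ a, ∑ l ∈ Finset.range (S.κ + 1),
        ((l.factorial : ℂ)⁻¹ • (C a - X) ^ l) * derivative^[l] (1 : ℂ[X]) = 1 := fun a => by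
      rw [Finset.sum_eq_single 0]
      · simp
      · intro l _ hl
        rw [iterate_derivative_eq_zero (by rw [natDegree_one]; lia), mul_zero]
      · simp
    simp only [h2, mul_one]
    rw [sub_add_cancel, map_one, one_mul]

end PointConditions

/-! ### Reading off coefficients in `x` and `z` from expansions. -/

theorem row_addHom_ext {r : ℕ} {P M : Type*} [Semiring P] [AddCommMonoid M]
    {f g : (Fin r → P[X]) →+ M}
    (h : ∀ i n a, f (Pi.single i (monomial n a)) = g (Pi.single i (monomial n a))) : f = g := by
  refine AddMonoidHom.functions_ext' _ _ _ fun i => Polynomial.addHom_ext fun n a => ?_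
  exact h i n a

/-- A Laurent series in `z⁻¹` has finitely many nonnegative powers of `z`; they form a polynomial
with the same expansion. -/
theorem expandHom_isPoly {f : RatFunc ℂ} (h : ∀ n : ℤ, 0 < n → (expandHom ℂ f).coeff n = 0) :
    ∃ p : ℂ[X], f = algebraMap ℂ[X] (RatFunc ℂ) p := by
  refine ⟨∑ n ∈ Finset.range ((-(expandHom ℂ f).order).toNat + 1),
    monomial n ((expandHom ℂ f).coeff (-(n : ℤ))), expandHom_injective (K := ℂ) ?_⟩
  rw [expandHom_algebraMap, Algebra.algebraMap_self, Polynomial.map_id]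
  ext n
  rcases lt_or_ge 0 n with hn | hn
  · rw [h n hn, polySeries_coeff_pos _ hn]
  · obtain ⟨k, rfl⟩ : ∃ k : ℕ, n = -(k : ℤ) := ⟨(-n).toNat, by lia⟩
    rw [polySeries_coeff_neg, finsetSum_coeff]
    simp only [coeff_monomial]
    rw [Finset.sum_ite_eq']
    split_ifs with hk
    · rfl
    · refine HahnSeries.coeff_eq_zero_of_lt_order ?_
      simp only [Finset.mem_range] at hk
      lia

theorem algebraMap_eq_C (a : ℂ) :
    algebraMap ℂ (RatFunc ℂ) a = algebraMap ℂ[X] (RatFunc ℂ) (C a) := by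
  rw [IsScalarTower.algebraMap_apply ℂ ℂ[X] (RatFunc ℂ), Polynomial.algebraMap_eq]

theorem sum_X_pow_mul_eq (n : ℕ) (a : ℕ → ℂ) :
    ∑ k ∈ Finset.range n, RatFunc.X ^ k * algebraMap ℂ (RatFunc ℂ) (a k) =
      algebraMap ℂ[X] (RatFunc ℂ) (∑ k ∈ Finset.range n, monomial k (a k)) := by
  rw [map_sum]
  refine Finset.sum_congr rfl fun k _ => ?_
  rw [algebraMap_eq_C, ← RatFunc.algebraMap_X, ← map_pow, ← map_mul, mul_comm,
    C_mul_X_pow_eq_monomial]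

/-- Linear independence of the powers of `x` over `ℂ`; it recovers the coefficients of `D` from
`D.e^{xz}`. -/
theorem eq_zero_of_sum_X_pow_mul_eq_zero {n : ℕ} {a : ℕ → ℂ}
    (h : ∑ k ∈ Finset.range n, RatFunc.X ^ k * algebraMap ℂ (RatFunc ℂ) (a k) = 0) {k : ℕ}
    (hk : k < n) : a k = 0 := by
  rw [sum_X_pow_mul_eq, map_eq_zero_iff _ (RatFunc.algebraMap_injective ℂ)] at h
  have := congrArg (fun p => coeff p k) h
  simpa [finsetSum_coeff, coeff_monomial, hk] using this

theorem DiffOp.coeff_symb {D : DiffOp} {n : ℕ} (h : ∀ k, n ≤ k → D k = 0) (l : ℤ) :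
    D.symb.coeff l = ∑ k ∈ Finset.range n,
      RatFunc.X ^ k * algebraMap ℂ (RatFunc ℂ) ((expandHom ℂ (D k)).coeff l) := by
  rw [symb_eq_sum h, HahnSeries.coeff_sum]
  refine Finset.sum_congr rfl fun k _ => ?_
  rw [mul_comm, HahnSeries.C_mul_eq_smul, HahnSeries.coeff_smul, smul_eq_mul, expandHom_coeff]

theorem polySeries_C {K : Type} [Field K] (a : K) : polySeries K (C a) = HahnSeries.C a := by
  rw [polySeries, coe_eval₂RingHom, eval₂_C]

/-! ### The Baker module over `ℂ(x)[∂_x]` and its relation to `M_W`. -/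

namespace PointConditions

variable {r : ℕ} (S : PointConditions r)

/-- The `ℂ(x)`-linear extension of `cond`. -/
def condK (j : S.J) : (Fin r → (RatFunc ℂ)[X]) →ₗ[RatFunc ℂ] RatFunc ℂ :=
  ∑ i, (basisMonomials (RatFunc ℂ)).constr (RatFunc ℂ)
    (fun n => algebraMap ℂ[X] (RatFunc ℂ) (S.cond j (Pi.single i (X ^ n)))) ∘ₗ LinearMap.proj i

theorem condK_single_monomial (j : S.J) (i : Fin r) (n : ℕ) (a : RatFunc ℂ) :
    S.condK j (Pi.single i (monomial n a)) =
      a * algebraMap ℂ[X] (RatFunc ℂ) (S.cond j (Pi.single i (X ^ n))) := by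
  have h : ∀ b : ℕ → RatFunc ℂ,
      (basisMonomials (RatFunc ℂ)).constr (RatFunc ℂ) b (monomial n a) = a * b n := fun b => by
    have h1 : monomial n a = a • basisMonomials (RatFunc ℂ) n := by
      rw [coe_basisMonomials, smul_monomial, smul_eq_mul, mul_one]
    rw [h1, map_smul, Module.Basis.constr_basis, smul_eq_mul]
  rw [condK, LinearMap.sum_apply, Finset.sum_eq_single i]
  · rw [LinearMap.comp_apply, LinearMap.proj_apply, Pi.single_eq_same, h]
  · intro i' _ hi'
    rw [LinearMap.comp_apply, LinearMap.proj_apply, Pi.single_eq_of_ne hi', map_zero]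
  · simp

theorem condK_map (j : S.J) (v : Fin r → ℂ[X]) :
    S.condK j (fun i => (v i).map (algebraMap ℂ (RatFunc ℂ))) =
      algebraMap ℂ[X] (RatFunc ℂ) (S.cond j v) := by
  let f : (Fin r → ℂ[X]) →+ RatFunc ℂ := (S.condK j).toAddMonoidHom.comp
    (AddMonoidHom.mk' (fun v i => (v i).map (algebraMap ℂ (RatFunc ℂ))) fun u v => by
      ext1 i; simp)
  let g : (Fin r → ℂ[X]) →+ RatFunc ℂ := (algebraMap ℂ[X] (RatFunc ℂ)).toAddMonoidHom.comp
    (S.cond j).toAddMonoidHom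
  suffices f = g from congrArg (fun F : (Fin r → ℂ[X]) →+ RatFunc ℂ => F v) this
  refine row_addHom_ext fun i n a => ?_
  change S.condK j (fun i' => Polynomial.map (algebraMap ℂ (RatFunc ℂ))
      ((Pi.single i (monomial n a) : Fin r → ℂ[X]) i')) =
    algebraMap ℂ[X] (RatFunc ℂ) (S.cond j (Pi.single i (monomial n a)))
  have h1 : (fun i' => Polynomial.map (algebraMap ℂ (RatFunc ℂ))
      ((Pi.single i (monomial n a) : Fin r → ℂ[X]) i')) =
      Pi.single i (monomial n (algebraMap ℂ (RatFunc ℂ) a)) := by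
    ext1 i'
    rw [← Polynomial.map_monomial]
    exact Pi.apply_single (fun _ (p : ℂ[X]) => p.map (algebraMap ℂ (RatFunc ℂ)))
      (fun _ => Polynomial.map_zero _) i (monomial n a) i'
  have h2 : (Pi.single i (monomial n a) : Fin r → ℂ[X]) = a • Pi.single i (X ^ n) := by
    rw [← Pi.single_smul, X_pow_eq_monomial, smul_monomial, smul_eq_mul, mul_one]
  rw [h1, condK_single_monomial, h2, map_smul, smul_eq_C_mul, map_mul, algebraMap_eq_C]

/-- The operator `e^(-xz) ∂_x e^{xz}` on polynomials in `z`. -/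
def nabla : (Fin r → (RatFunc ℂ)[X]) →+ (Fin r → (RatFunc ℂ)[X]) :=
  AddMonoidHom.mk' (fun N i => Differential.mapCoeffs (N i) + X * N i) fun N N' => by
    ext1 i
    simp only [Pi.add_apply, map_add]
    ring

theorem nabla_apply (N : Fin r → (RatFunc ℂ)[X]) (i : Fin r) :
    nabla N i = Differential.mapCoeffs (N i) + X * N i := rfl

/-- Up to the factor `e^{c_j x}`, `condK` is the functional on `N e^{xz}`, which commutes with
`∂_x`; differentiating that factor produces the term with `c_j`. Hence the Baker module is stable
under `∂_x`. -/
theorem condK_nabla (j : S.J) (N : Fin r → (RatFunc ℂ)[X]) :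
    S.condK j (nabla N) =
      ratDeriv (S.condK j N) + algebraMap ℂ (RatFunc ℂ) (S.c j) * S.condK j N := by
  let f : (Fin r → (RatFunc ℂ)[X]) →+ RatFunc ℂ := (S.condK j).toAddMonoidHom.comp nabla
  let g : (Fin r → (RatFunc ℂ)[X]) →+ RatFunc ℂ :=
    (AddMonoidHom.mk' (fun a => ratDeriv a + algebraMap ℂ (RatFunc ℂ) (S.c j) * a) fun a b => by
      rw [ratDeriv_add]; ring).comp (S.condK j).toAddMonoidHom
  suffices f = g from congrArg (fun F : (Fin r → (RatFunc ℂ)[X]) →+ RatFunc ℂ => F N) this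
  refine row_addHom_ext fun i n a => ?_
  change S.condK j (nabla (Pi.single i (monomial n a))) =
    ratDeriv (S.condK j (Pi.single i (monomial n a))) +
      algebraMap ℂ (RatFunc ℂ) (S.c j) * S.condK j (Pi.single i (monomial n a))
  have h1 : nabla (Pi.single i (monomial n a)) =
      Pi.single i (monomial n (ratDeriv a)) + Pi.single i (monomial (n + 1) a) := by
    ext1 i'
    rcases eq_or_ne i' i with rfl | h
    · rw [nabla_apply]
      simp only [Pi.single_eq_same, Pi.add_apply, X_mul_monomial]
      congr 1
      exact Differential.mapCoeffs_monomial n a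
    · rw [nabla_apply]
      simp [Pi.single_eq_of_ne h]
  have h2 : S.cond j ((X - C (S.c j)) • Pi.single i (X ^ n)) =
      S.cond j (Pi.single i (X ^ (n + 1))) - C (S.c j) * S.cond j (Pi.single i (X ^ n)) := by
    rw [sub_smul, map_sub, ← Pi.single_smul, smul_eq_mul, ← pow_succ', ← smul_eq_C_mul,
      ← map_smul]
    congr 2
    ext1 i'
    simp [smul_eq_C_mul]
  rw [h1, map_add, condK_single_monomial, condK_single_monomial, condK_single_monomial,
    ratDeriv_mul, ratDeriv_algebraMap, derivative_cond, h2, map_sub, map_mul, algebraMap_eq_C]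
  ring

/-- The rows `φ` with coefficients in `ℂ(x)` such that `φ e^{xz}` is in the completion of the
subspace cut out by the conditions, for generic `x`. -/
def bakerModule : Submodule (RatFunc ℂ) (Fin r → (RatFunc ℂ)⸨X⸩) where
  carrier := {φ | ∃ N : Fin r → (RatFunc ℂ)[X],
    (∀ i, φ i * expandHom (RatFunc ℂ) (algebraMap ℂ[X] (RatFunc ℂ) S.q) =
      polySeries (RatFunc ℂ) (N i)) ∧ ∀ j, S.condK j N = 0}
  add_mem' := by
    rintro φ φ' ⟨N, h1, h2⟩ ⟨N', h1', h2'⟩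
    refine ⟨N + N', fun i => ?_, fun j => by rw [map_add, h2, h2', add_zero]⟩
    rw [Pi.add_apply, Pi.add_apply, add_mul, h1, h1', map_add]
  zero_mem' := ⟨0, fun i => by simp, fun j => map_zero _⟩
  smul_mem' := by
    rintro a φ ⟨N, h1, h2⟩
    refine ⟨a • N, fun i => ?_, fun j => by rw [map_smul, h2, smul_zero]⟩
    rw [Pi.smul_apply, Pi.smul_apply, ← HahnSeries.C_mul_eq_smul, mul_assoc, h1, smul_eq_C_mul,
      map_mul, polySeries_C]

theorem dCoef_polySeries (p : (RatFunc ℂ)[X]) :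
    dCoef (polySeries (RatFunc ℂ) p) = polySeries (RatFunc ℂ) (Differential.mapCoeffs p) := by
  ext n
  rw [dCoef_coeff, polySeries_coeff, polySeries_coeff]
  split_ifs
  · rfl
  · exact ratDer.map_zero

variable {S}

theorem C_mul_mem_bakerModule {φ : Fin r → (RatFunc ℂ)⸨X⸩} (h : φ ∈ S.bakerModule)
    (a : RatFunc ℂ) : (fun i => HahnSeries.C a * φ i) ∈ S.bakerModule := by
  convert S.bakerModule.smul_mem a h using 1
  ext1 i
  rw [HahnSeries.C_mul_eq_smul, Pi.smul_apply]

theorem expDx_mem_bakerModule {φ : Fin r → (RatFunc ℂ)⸨X⸩} (h : φ ∈ S.bakerModule) :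
    (fun i => expDx (φ i)) ∈ S.bakerModule := by
  obtain ⟨N, h1, h2⟩ := h
  refine ⟨nabla N, fun i => ?_, fun j => by
    rw [condK_nabla, h2, ratDeriv_zero, mul_zero, add_zero]⟩
  have h3 : polySeries (RatFunc ℂ) X = HahnSeries.single (-1) 1 := by
    simp [polySeries]
  change _ = polySeries _ (Differential.mapCoeffs (N i) + X * N i)
  rw [map_add, map_mul, ← dCoef_polySeries, ← h1, dCoef_mul, dCoef_expandHom, h3]
  change (dCoef (φ i) + HahnSeries.single (-1) 1 * φ i) * _ = _
  ring

theorem expDx_iterate_mem_bakerModule {φ : Fin r → (RatFunc ℂ)⸨X⸩} (h : φ ∈ S.bakerModule)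
    (k : ℕ) : (fun i => expDx^[k] (φ i)) ∈ S.bakerModule := by
  induction k with
  | zero => exact h
  | succ k ih =>
    simp only [Function.iterate_succ_apply']
    exact expDx_mem_bakerModule ih

theorem sum_mem_bakerModule {ι : Type*} (s : Finset ι) {φ : ι → Fin r → (RatFunc ℂ)⸨X⸩}
    (h : ∀ k ∈ s, φ k ∈ S.bakerModule) : (fun i => ∑ k ∈ s, φ k i) ∈ S.bakerModule := by
  convert S.bakerModule.sum_mem h using 1
  ext1 i
  rw [Finset.sum_apply]

theorem actX_mem_bakerModule (Θ : DiffOp) {φ : Fin r → (RatFunc ℂ)⸨X⸩} (h : φ ∈ S.bakerModule) :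
    (fun i => Θ.actX (φ i)) ∈ S.bakerModule :=
  sum_mem_bakerModule _ fun k _ =>
    C_mul_mem_bakerModule (expDx_iterate_mem_bakerModule h k) (Θ k)

theorem bakerAct_mem_bakerModule {m k : ℕ} (Θ : Matrix (Fin m) (Fin k) DiffOp)
    {ψ : Matrix (Fin k) (Fin r) (RatFunc ℂ)⸨X⸩} (h : ∀ i, ψ i ∈ S.bakerModule) (i : Fin m) :
    bakerAct Θ ψ i ∈ S.bakerModule :=
  sum_mem_bakerModule _ fun k _ => actX_mem_bakerModule (Θ i k) (h k)

theorem expandHom_q_ne_zero (S : PointConditions r) :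
    expandHom (RatFunc ℂ) (algebraMap ℂ[X] (RatFunc ℂ) S.q) ≠ 0 := by
  rw [Ne, map_eq_zero_iff _ expandHom_injective]
  exact RatFunc.algebraMap_ne_zero S.q_ne_zero

theorem symb_mul_q {D : Fin r → DiffOp} {N : ℕ → Fin r → ℂ[X]} {n : ℕ}
    (hN : ∀ k i, algebraMap ℂ[X] (RatFunc ℂ) S.q * D i k = algebraMap ℂ[X] (RatFunc ℂ) (N k i))
    (hn : ∀ i k, n ≤ k → D i k = 0) (i : Fin r) :
    (D i).symb * expandHom (RatFunc ℂ) (algebraMap ℂ[X] (RatFunc ℂ) S.q) =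
      polySeries (RatFunc ℂ) ((∑ k ∈ Finset.range n, (RatFunc.X : RatFunc ℂ) ^ k •
        fun i => (N k i).map (algebraMap ℂ (RatFunc ℂ))) i) := by
  rw [DiffOp.symb_eq_sum (hn i), Finset.sum_mul, Finset.sum_apply, map_sum]
  refine Finset.sum_congr rfl fun k _ => ?_
  rw [mul_right_comm, ← map_mul, mul_comm (D i k), hN, expandHom_algebraMap, Pi.smul_apply,
    smul_eq_C_mul, map_mul, mul_comm,
    polySeries_C]

theorem condK_sum (j : S.J) (N : ℕ → Fin r → ℂ[X]) (n : ℕ) :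
    S.condK j (∑ k ∈ Finset.range n, (RatFunc.X : RatFunc ℂ) ^ k •
        fun i => (N k i).map (algebraMap ℂ (RatFunc ℂ))) =
      algebraMap ℂ[X] (RatFunc ℂ) (∑ k ∈ Finset.range n, X ^ k * S.cond j (N k)) := by
  rw [map_sum, map_sum]
  refine Finset.sum_congr rfl fun k _ => ?_
  rw [map_smul, condK_map, map_mul, map_pow, RatFunc.algebraMap_X, smul_eq_mul]

variable {W : Submodule ℂ (Fin r → RatFunc ℂ)}

/-- The defining conditions on `D.e^{xz}` are the identities of `mem_opsInto_iff`. To get there from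
the Baker module, `qD` must have polynomial coefficients, which follows by comparing powers of `x`.
-/
theorem Cuts.symb_mem_iff (hW : S.Cuts W) (D : Fin r → DiffOp) :
    (fun i => (D i).symb) ∈ S.bakerModule ↔ D ∈ opsInto W := by
  obtain ⟨n, hn⟩ := exists_order_bound D
  constructor
  · rintro ⟨P, h1, h2⟩
    have key : ∀ k i, ∃ p : ℂ[X],
        algebraMap ℂ[X] (RatFunc ℂ) S.q * D i k = algebraMap ℂ[X] (RatFunc ℂ) p := by
      intro k i
      refine expandHom_isPoly fun l hl => ?_
      rcases lt_or_ge k n with hk | hk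
      · set E : DiffOp := (D i).mapRange (algebraMap ℂ[X] (RatFunc ℂ) S.q * ·) (mul_zero _)
        have hE : ∀ k, n ≤ k → E k = 0 := fun k hk => by
          rw [Finsupp.mapRange_apply, hn i k hk, mul_zero]
        have h3 : E.symb = polySeries (RatFunc ℂ) (P i) := by
          rw [← h1]
          dsimp only
          rw [DiffOp.symb_eq_sum hE, DiffOp.symb_eq_sum (hn i), Finset.sum_mul]
          refine Finset.sum_congr rfl fun k _ => ?_
          rw [Finsupp.mapRange_apply, map_mul]
          ring
        have h4 := DiffOp.coeff_symb hE l
        rw [h3, polySeries_coeff_pos _ hl] at h4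
        exact eq_zero_of_sum_X_pow_mul_eq_zero h4.symm hk
      · rw [hn i k hk, mul_zero, map_zero, HahnSeries.coeff_zero]
    choose N hN using key
    rw [hW.mem_opsInto_iff hN hn]
    intro j
    have h3 : P = ∑ k ∈ Finset.range n, (RatFunc.X : RatFunc ℂ) ^ k •
        fun i => (N k i).map (algebraMap ℂ (RatFunc ℂ)) :=
      funext fun i => polySeries_injective ((h1 i).symm.trans (symb_mul_q hN hn i))
    have h4 := h2 j
    rwa [h3, condK_sum, map_eq_zero_iff _ (RatFunc.algebraMap_injective ℂ)] at h4
  · intro h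
    obtain ⟨N, hN⟩ := hW.exists_coeff h
    refine ⟨_, symb_mul_q hN hn, fun j => ?_⟩
    rw [condK_sum, (hW.mem_opsInto_iff hN hn).mp h j, map_zero]

/-- Clearing denominators. -/
theorem exists_common_denominator {ι : Type*} [Fintype ι] (N : ι → (RatFunc ℂ)[X]) :
    ∃ (h : ℂ[X]) (P : ι → ℂ[X][X]), h ≠ 0 ∧
      ∀ i, (P i).map (algebraMap ℂ[X] (RatFunc ℂ)) = algebraMap ℂ[X] (RatFunc ℂ) h • N i := by
  classical
  obtain ⟨b, hb⟩ := IsLocalization.exist_integer_multiples_of_finset (nonZeroDivisors ℂ[X])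
    (Finset.univ.biUnion fun i => (N i).support.image (N i).coeff)
  have key : ∀ i, ∃ P : ℂ[X][X],
      P.map (algebraMap ℂ[X] (RatFunc ℂ)) = algebraMap ℂ[X] (RatFunc ℂ) b • N i := by
    intro i
    rw [← Polynomial.mem_lifts, Polynomial.lifts_iff_coeff_lifts]
    intro n
    by_cases hn : (N i).coeff n = 0
    · exact ⟨0, by rw [map_zero, coeff_smul, hn, smul_zero]⟩
    · obtain ⟨p, hp⟩ := hb ((N i).coeff n) (Finset.mem_biUnion.mpr ⟨i, Finset.mem_univ i,
        Finset.mem_image_of_mem _ (mem_support_iff.mpr hn)⟩)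
      exact ⟨p, by rw [hp, coeff_smul, smul_eq_mul, Algebra.smul_def]⟩
  choose P hP using key
  exact ⟨b, P, nonZeroDivisors.ne_zero b.2, hP⟩

/-- After clearing denominators, `h q φ` is a polynomial in `x` and `z`. Read as a polynomial in `x`
over `ℂ[z]` and divided by `q`, its coefficients are those of `D`; `Bivariate.swap` exchanges the
variables. -/
theorem Cuts.exists_symb_eq (hW : S.Cuts W) {φ : Fin r → (RatFunc ℂ)⸨X⸩}
    (hφ : φ ∈ S.bakerModule) : ∃ h : ℂ[X], h ≠ 0 ∧ ∃ D ∈ opsInto W,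
      ∀ i, HahnSeries.C (algebraMap ℂ[X] (RatFunc ℂ) h) * φ i = (D i).symb := by
  obtain ⟨N, h1, -⟩ := id hφ
  obtain ⟨h, P, hh, hP⟩ := exists_common_denominator N
  set n := Finset.univ.sup (fun i => (Bivariate.swap (P i)).natDegree) + 1
  have hq := RatFunc.algebraMap_ne_zero S.q_ne_zero
  set D : Fin r → DiffOp := fun i => ∑ k ∈ Finset.range n, Finsupp.single k
    (algebraMap ℂ[X] (RatFunc ℂ) ((Bivariate.swap (P i)).coeff k) /
      algebraMap ℂ[X] (RatFunc ℂ) S.q)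
  have hD : ∀ i, HahnSeries.C (algebraMap ℂ[X] (RatFunc ℂ) h) * φ i = (D i).symb := by
    intro i
    refine mul_right_cancel₀ (expandHom_q_ne_zero S) ?_
    have hC : HahnSeries.C (algebraMap ℂ[X] (RatFunc ℂ) h) =
        polySeries (RatFunc ℂ) (C (algebraMap ℂ[X] (RatFunc ℂ) h)) := (polySeries_C _).symm
    rw [mul_assoc, h1, hC, ← map_mul, ← smul_eq_C_mul, ← hP, DiffOp.symb_sum, Finset.sum_mul]
    have e : ∀ k, DiffOp.symb (Finsupp.single k
        (algebraMap ℂ[X] (RatFunc ℂ) ((Bivariate.swap (P i)).coeff k) /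
          algebraMap ℂ[X] (RatFunc ℂ) S.q)) *
        expandHom (RatFunc ℂ) (algebraMap ℂ[X] (RatFunc ℂ) S.q) = polySeries (RatFunc ℂ)
          (((Bivariate.swap (P i)).coeff k).map (algebraMap ℂ (RatFunc ℂ)) *
            C (RatFunc.X ^ k)) := fun k => by
      rw [DiffOp.symb_single, mul_right_comm, ← map_mul, div_mul_cancel₀ _ hq,
        expandHom_algebraMap, map_mul, polySeries_C]
    rw [Finset.sum_congr rfl fun k _ => e k, ← map_sum]
    congr 1
    have h3 : ∀ Q : ℂ[X][X], ∀ m, Q.natDegree < m → ∑ k ∈ Finset.range m,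
        (Q.coeff k).map (algebraMap ℂ (RatFunc ℂ)) * C (RatFunc.X ^ k) =
        (Bivariate.swap Q).map (algebraMap ℂ[X] (RatFunc ℂ)) := by
      intro Q m hm
      have : Q = ∑ k ∈ Finset.range m, C (Q.coeff k) * X ^ k := by
        conv_lhs => rw [Q.as_sum_range' m hm]
        exact Finset.sum_congr rfl fun k _ => (C_mul_X_pow_eq_monomial).symm
      conv_rhs => rw [this, map_sum, Polynomial.map_sum]
      refine Finset.sum_congr rfl fun k _ => ?_
      rw [map_mul, map_pow Bivariate.swap, Bivariate.swap_Y, Bivariate.swap_C, Polynomial.map_mul,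
        Polynomial.map_map, Polynomial.map_pow, map_C, ← C_pow, RatFunc.algebraMap_X]
      rfl
    rw [h3 _ n (Nat.lt_succ_of_le (Finset.le_sup (f := fun i => (Bivariate.swap (P i)).natDegree)
      (Finset.mem_univ i))), Bivariate.swap_swap_apply]
  refine ⟨h, hh, D, (hW.symb_mem_iff D).mp ?_, hD⟩
  simp only [← hD]
  exact C_mul_mem_bakerModule hφ _

/-- An element of the Baker module without nonnegative powers of `z` vanishes. -/
theorem Cuts.eq_zero_of_coeff (hW : S.Cuts W) (hL : leadingCoeffs W ⊆ Set.range polyRow)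
    {φ : Fin r → (RatFunc ℂ)⸨X⸩} (hφ : φ ∈ S.bakerModule)
    (h0 : ∀ i, ∀ n ≤ 0, (φ i).coeff n = 0) : φ = 0 := by
  classical
  obtain ⟨h, hh, D, hD, hφD⟩ := hW.exists_symb_eq hφ
  have hex := exists_order_bound D
  -- The least bound is one more than the order of `D`, and it is `0` exactly when `D = 0`.
  have hn := Nat.find_spec hex
  rcases Nat.eq_zero_or_eq_succ_pred (Nat.find hex) with hz | hz
  · have hD0 : ∀ i, D i = 0 := fun i => Finsupp.ext fun k => hn i k (by rw [hz]; exact k.zero_le)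
    ext1 i
    have := hφD i
    rw [hD0, DiffOp.symb_zero, mul_eq_zero] at this
    refine this.resolve_left ?_
    rw [map_eq_zero_iff _ HahnSeries.C_injective]
    exact RatFunc.algebraMap_ne_zero hh
  · set m := (Nat.find hex).pred
    rw [hz] at hn
    -- The leading coefficient is a polynomial row, but its coefficients at `z^l`, `l ≥ 0`, vanish
    -- by hypothesis. It is thus zero, against minimality.
    obtain ⟨u, hu⟩ := hL ⟨D, hD, m, fun i k hk => hn i k hk, rfl⟩
    exfalso
    refine Nat.find_min hex (m := m) (by lia) fun i k hk => ?_
    rcases eq_or_lt_of_le hk with rfl | hk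
    · have h1 : D i m = algebraMap ℂ[X] (RatFunc ℂ) (u i) := (congrFun hu i).symm
      rw [h1]
      suffices u i = 0 by rw [this, map_zero]
      ext l
      have h2 := DiffOp.coeff_symb (hn i) (-(l : ℤ))
      rw [← hφD, HahnSeries.C_mul_eq_smul, HahnSeries.coeff_smul, h0 i _ (by lia), smul_zero] at h2
      have h3 := eq_zero_of_sum_X_pow_mul_eq_zero h2.symm (Nat.lt_succ_self m)
      rwa [h1, expandHom_algebraMap, polySeries_coeff_neg, Algebra.algebraMap_self,
        Polynomial.map_id] at h3
    · exact hn i k hk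

end PointConditions

/-! ### Existence of a normalized matrix with rows in the Baker module. -/

theorem order_polySeries {K : Type} [Field K] {p : K[X]} (hp : p ≠ 0) :
    (polySeries K p).order = -(p.natDegree : ℤ) := by
  have h0 : polySeries K p ≠ 0 := by rwa [Ne, map_eq_zero_iff _ polySeries_injective]
  refine le_antisymm (HahnSeries.order_le_of_coeff_ne_zero ?_) ?_
  · rw [polySeries_coeff_neg]
    exact leadingCoeff_ne_zero.mpr hp
  · by_contra h
    refine (HahnSeries.coeff_order_eq_zero.not.mpr h0) ?_
    rw [polySeries_coeff]
    split_ifs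
    · exact coeff_eq_zero_of_natDegree_lt (by lia)
    · rfl

/-- A proper fraction vanishes at infinity. -/
theorem coeff_eq_zero_of_mul_polySeries {K : Type} [Field K] {χ : K⸨X⸩} {p f : K[X]} (hp : p ≠ 0)
    (h : χ * polySeries K p = polySeries K f) (hf : f.degree < p.degree) {n : ℤ} (hn : n ≤ 0) :
    χ.coeff n = 0 := by
  rcases eq_or_ne χ 0 with rfl | hχ
  · rfl
  refine HahnSeries.coeff_eq_zero_of_lt_order (hn.trans_lt ?_)
  have h0 : polySeries K p ≠ 0 := by rwa [Ne, map_eq_zero_iff _ polySeries_injective]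
  have hf0 : f ≠ 0 := by
    rintro rfl
    rw [map_zero, mul_eq_zero] at h
    exact h.elim hχ h0
  have h1 := congrArg HahnSeries.order h
  rw [HahnSeries.order_mul hχ h0, order_polySeries hp, order_polySeries hf0] at h1
  have := natDegree_lt_natDegree hf0 hf
  lia

namespace PointConditions

variable {r : ℕ} {S : PointConditions r} {W : Submodule ℂ (Fin r → RatFunc ℂ)}

/-- A relation over `ℂ[x]` among the conditions that holds on rows of degree below `deg q` holds on
all rows. Division by `q` leaves the values `H(q u)`. Here `u` is the leading coefficient of an
operator of order `n` in `M_W`, whence `x^n H(q u) = -∑_{k<n} x^k H(N_k)`. So a common bound on the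
degrees of the values in `x` can be lowered step by step until all of them vanish. -/
theorem Cuts.combination_eq_zero (hW : S.Cuts W) (hL : Set.range polyRow ⊆ leadingCoeffs W)
    (m : S.J → ℂ[X])
    (hm : ∀ v : Fin r → ℂ[X], (∀ i, (v i).degree < S.q.degree) → ∑ j, m j * S.cond j v = 0)
    (v : Fin r → ℂ[X]) : ∑ j, m j * S.cond j v = 0 := by
  set H : (Fin r → ℂ[X]) → ℂ[X] := fun v => ∑ j, m j * S.cond j v
  have hadd : ∀ u v, H (u + v) = H u + H v := fun u v => by
    simp only [H, map_add, mul_add, Finset.sum_add_distrib]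
  have hdiv : ∀ v, H v = H (S.q • fun i => v i / S.q) := by
    intro v
    have h1 : v = (S.q • fun i => v i / S.q) + fun i => v i % S.q := by
      ext1 i
      exact (EuclideanDomain.div_add_mod (v i) S.q).symm
    conv_lhs => rw [h1, hadd]
    rw [add_eq_left]
    exact hm _ fun i => degree_mod_lt _ S.q_ne_zero
  refine (hdiv v).trans ?_
  -- The descent can start because each `cond` has degree below `κ` in `x`, whatever the row.
  obtain ⟨B, hB⟩ : ∃ B, ∀ v t, B ≤ t → (H v).coeff t = 0 := by
    refine ⟨Finset.univ.sup (fun j => (m j).natDegree) + S.κ, fun v t ht => ?_⟩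
    rw [finsetSum_coeff]
    refine Finset.sum_eq_zero fun j _ => ?_
    rw [coeff_mul]
    refine Finset.sum_eq_zero fun ab hab => ?_
    rw [Finset.HasAntidiagonal.mem_antidiagonal] at hab
    have hj : (m j).natDegree ≤ _ := Finset.le_sup (f := fun j => (m j).natDegree)
      (Finset.mem_univ j)
    rcases lt_or_ge (m j).natDegree ab.1 with h | h
    · rw [coeff_eq_zero_of_natDegree_lt h, zero_mul]
    · rw [S.coeff_cond_of_le j v (by lia), mul_zero]
  have step : ∀ d, (∀ u t, d + 1 ≤ t → (H (S.q • u)).coeff t = 0) →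
      ∀ u t, d ≤ t → (H (S.q • u)).coeff t = 0 := by
    intro d hd u t ht
    rcases eq_or_lt_of_le ht with rfl | ht
    swap
    · exact hd u t ht
    obtain ⟨D, hD, n, hn, hu⟩ := hL ⟨u, rfl⟩
    obtain ⟨N, hN⟩ := hW.exists_coeff hD
    have h1 := (hW.mem_opsInto_iff hN (n := n + 1) fun i k hk => hn i k hk).mp hD
    have hNn : N n = S.q • u := by
      ext1 i
      apply RatFunc.algebraMap_injective ℂ
      rw [← hN, ← congrFun hu i, polyRow, Pi.smul_apply, smul_eq_mul, map_mul]
    have h2 : ∑ k ∈ Finset.range (n + 1), X ^ k * H (N k) = 0 := by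
      have : ∀ k, X ^ k * H (N k) = ∑ j, m j * (X ^ k * S.cond j (N k)) := fun k => by
        rw [Finset.mul_sum]
        exact Finset.sum_congr rfl fun j _ => by ring
      simp only [this]
      rw [Finset.sum_comm]
      exact Finset.sum_eq_zero fun j _ => by rw [← Finset.mul_sum, h1 j, mul_zero]
    rw [Finset.sum_range_succ, hNn] at h2
    -- In degree `d + n` the term `x^k H(N_k)` with `k < n` involves a coefficient of degree at
    -- least `d + 1`, already known to vanish.
    have h3 := congrArg (fun p => coeff p (d + n)) h2
    simp only [coeff_add, coeff_X_pow_mul, finsetSum_coeff, coeff_zero] at h3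
    rw [Finset.sum_eq_zero, zero_add] at h3
    · exact h3
    · intro k hk
      have hk := Finset.mem_range.mp hk
      rw [hdiv, coeff_X_pow_mul', if_pos (by lia)]
      exact hd _ _ (by lia)
  have all : ∀ e d, d + e = B → ∀ u t, d ≤ t → (H (S.q • u)).coeff t = 0 := by
    intro e
    induction e with
    | zero => exact fun d hd u t ht => hB _ _ (by lia)
    | succ e ih => exact fun d hd => step d (ih (d + 1) (by lia))
  exact Polynomial.ext fun t => all B 0 (by lia) _ t (Nat.zero_le t)

/-- All conditions as one linear map. -/
def condAll (S : PointConditions r) :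
    (Fin r → (RatFunc ℂ)[X]) →ₗ[RatFunc ℂ] (S.J → RatFunc ℂ) :=
  LinearMap.pi S.condK

theorem Cuts.condAll_mem (hW : S.Cuts W) (hL : Set.range polyRow ⊆ leadingCoeffs W)
    (v : Fin r → ℂ[X]) :
    S.condAll (fun i => (v i).map (algebraMap ℂ (RatFunc ℂ))) ∈
      (Submodule.pi Set.univ fun _ : Fin r => degreeLT (RatFunc ℂ) S.q.natDegree).map
        S.condAll := by
  classical
  by_contra hv
  -- A functional that separates `v` from the image becomes, after clearing denominators, a relation
  -- excluded by `combination_eq_zero`.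
  obtain ⟨f, hf, hker⟩ := Submodule.exists_le_ker_of_notMem hv
  obtain ⟨b, hb⟩ := IsLocalization.exist_integer_multiples_of_finset (nonZeroDivisors ℂ[X])
    (Finset.univ.image fun j : S.J => f (Pi.single j 1))
  have hb' : ∀ j, ∃ m : ℂ[X], algebraMap ℂ[X] (RatFunc ℂ) m =
      algebraMap ℂ[X] (RatFunc ℂ) b * f (Pi.single j 1) := fun j => by
    obtain ⟨m, hm⟩ := hb _ (Finset.mem_image_of_mem _ (Finset.mem_univ j))
    exact ⟨m, by rw [hm, Algebra.smul_def]⟩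
  choose m hm using hb'
  have hfv : ∀ w : Fin r → ℂ[X], algebraMap ℂ[X] (RatFunc ℂ) (∑ j, m j * S.cond j w) =
      algebraMap ℂ[X] (RatFunc ℂ) b *
        f (S.condAll fun i => (w i).map (algebraMap ℂ (RatFunc ℂ))) := by
    intro w
    rw [f.pi_apply_eq_sum_univ, map_sum, Finset.mul_sum]
    refine Finset.sum_congr rfl fun j _ => ?_
    rw [map_mul, hm, condAll, LinearMap.pi_apply, condK_map, smul_eq_mul]
    have : (fun i => if j = i then (1 : RatFunc ℂ) else 0) = Pi.single j 1 := by
      ext1 i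
      rw [Pi.single_apply]
      simp only [eq_comm]
    rw [this]
    ring
  have h0 := hW.combination_eq_zero hL m (fun w hw => by
    apply RatFunc.algebraMap_injective ℂ
    rw [hfv, map_zero]
    have : f (S.condAll fun i => (w i).map (algebraMap ℂ (RatFunc ℂ))) = 0 := by
      refine LinearMap.mem_ker.mp (hker (Submodule.mem_map_of_mem fun i _ => ?_))
      rw [SetLike.mem_coe, mem_degreeLT, degree_map]
      exact (hw i).trans_eq (degree_eq_natDegree S.q_ne_zero)
    rw [this, mul_zero]) v
  have h1 := hfv v
  rw [h0, map_zero, eq_comm, mul_eq_zero] at h1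
  exact h1.elim (RatFunc.algebraMap_ne_zero (nonZeroDivisors.ne_zero b.2)) hf

/-- Choose `f` of degree below `deg q` with the same condition values as `q e_i`. Then `e_i - f/q`
satisfies all conditions, and the proper fraction `f/q` only affects negative powers of `z`. -/
theorem Cuts.exists_isNormalized (hW : S.Cuts W) (hL : Set.range polyRow ⊆ leadingCoeffs W) :
    ∃ ψ : Matrix (Fin r) (Fin r) (RatFunc ℂ)⸨X⸩, IsNormalized ψ ∧ ∀ i, ψ i ∈ S.bakerModule := by
  have hq0 := expandHom_q_ne_zero S
  have key : ∀ i : Fin r, ∃ φ ∈ S.bakerModule, ∀ j, ∀ n ≤ 0,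
      (φ j).coeff n = if n = 0 then (1 : Matrix (Fin r) (Fin r) (RatFunc ℂ)) i j else 0 := by
    intro i
    set Q : Fin r → (RatFunc ℂ)[X] :=
      fun j => ((Pi.single i S.q : Fin r → ℂ[X]) j).map (algebraMap ℂ (RatFunc ℂ)) with hQ
    obtain ⟨f, hf, hfQ⟩ := hW.condAll_mem hL (Pi.single i S.q)
    have hqK : S.q.map (algebraMap ℂ (RatFunc ℂ)) ≠ 0 :=
      (Polynomial.map_ne_zero_iff (algebraMap ℂ (RatFunc ℂ)).injective).mpr S.q_ne_zero
    have hqf : ∀ j, polySeries (RatFunc ℂ) (f j) / expandHom (RatFunc ℂ)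
        (algebraMap ℂ[X] (RatFunc ℂ) S.q) * polySeries (RatFunc ℂ)
          (S.q.map (algebraMap ℂ (RatFunc ℂ))) = polySeries (RatFunc ℂ) (f j) := fun j => by
      rw [← expandHom_algebraMap, div_mul_cancel₀ _ hq0]
    refine ⟨fun j => HahnSeries.C ((1 : Matrix (Fin r) (Fin r) (RatFunc ℂ)) i j) -
      polySeries (RatFunc ℂ) (f j) / expandHom (RatFunc ℂ) (algebraMap ℂ[X] (RatFunc ℂ) S.q),
      ⟨Q - f, fun j => ?_, fun j => ?_⟩, fun j n hn => ?_⟩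
    · rw [sub_mul, div_mul_cancel₀ _ hq0, Pi.sub_apply, map_sub, expandHom_algebraMap]
      congr 1
      rw [hQ, Matrix.one_apply]
      rcases eq_or_ne i j with rfl | h
      · rw [if_pos rfl, map_one, one_mul]
        dsimp only
        rw [Pi.single_eq_same]
      · rw [if_neg h, map_zero, zero_mul]
        dsimp only
        rw [Pi.single_eq_of_ne h.symm, Polynomial.map_zero, map_zero]
    · rw [map_sub, sub_eq_zero]
      exact (congrFun hfQ j).symm
    · have hdeg : (f j).degree < (S.q.map (algebraMap ℂ (RatFunc ℂ))).degree := by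
        rw [degree_map, degree_eq_natDegree S.q_ne_zero]
        exact mem_degreeLT.mp (hf j (Set.mem_univ j))
      rw [HahnSeries.coeff_sub, coeff_eq_zero_of_mul_polySeries hqK (hqf j) hdeg hn, sub_zero,
        HahnSeries.C_apply, HahnSeries.coeff_single]
      split_ifs <;> rfl
  choose ψ h1 h2 using key
  exact ⟨ψ, ⟨fun i j n hn => by rw [h2 i j n hn.le, if_neg hn.ne],
    fun i j => by rw [h2 i j 0 le_rfl, if_pos rfl]⟩, h1⟩

/-! ### Generation of the Baker module by the Baker function. -/

theorem coeff_expDx (φ : (RatFunc ℂ)⸨X⸩) (n : ℤ) :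
    (expDx φ).coeff n = ratDeriv (φ.coeff n) + φ.coeff (n + 1) := by
  rw [expDx, HahnSeries.coeff_add, dCoef_coeff, HahnSeries.coeff_single_mul, one_mul,
    sub_neg_eq_add]
  rfl

/-- On `φ e^{xz}`, `∂_x^k` multiplies the top term by `z^k`; differentiating coefficients only
affects lower powers. -/
theorem coeff_expDx_iterate {φ : (RatFunc ℂ)⸨X⸩} (h : ∀ n < 0, φ.coeff n = 0) (k : ℕ) :
    (∀ n < -(k : ℤ), (expDx^[k] φ).coeff n = 0) ∧ (expDx^[k] φ).coeff (-(k : ℤ)) = φ.coeff 0 := by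
  induction k with
  | zero => exact ⟨by simpa using h, by simp⟩
  | succ k ih =>
    rw [Function.iterate_succ_apply']
    refine ⟨fun n hn => ?_, ?_⟩
    · rw [coeff_expDx, ih.1 n (by push_cast at hn; lia), ih.1 (n + 1) (by push_cast at hn; lia),
        ratDeriv_zero, add_zero]
    · rw [coeff_expDx, ih.1 _ (by push_cast; lia), ratDeriv_zero, zero_add, ← ih.2]
      congr 1
      push_cast
      ring

/-- The Baker module is generated over `ℂ(x)[∂_x]` by the rows of the Baker function. -/
theorem Cuts.exists_actX (hW : S.Cuts W) (hL : leadingCoeffs W ⊆ Set.range polyRow)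
    {ψ : Matrix (Fin r) (Fin r) (RatFunc ℂ)⸨X⸩} (hψ : IsNormalized ψ)
    (hψS : ∀ i, ψ i ∈ S.bakerModule) {φ : Fin r → (RatFunc ℂ)⸨X⸩} (hφ : φ ∈ S.bakerModule) :
    ∃ Θ : Fin r → DiffOp, ∀ j, φ j = ∑ i, (Θ i).actX (ψ i j) := by
  have main : ∀ (d : ℕ) (φ : Fin r → (RatFunc ℂ)⸨X⸩), φ ∈ S.bakerModule →
      (∀ j, ∀ n : ℤ, n + d ≤ 0 → (φ j).coeff n = 0) →
      ∃ Θ : Fin r → DiffOp, ∀ j, φ j = ∑ i, (Θ i).actX (ψ i j) := by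
    intro d
    induction d with
    | zero =>
      intro φ hφ h
      have := hW.eq_zero_of_coeff hL hφ fun i n hn => h i n (by simpa using hn)
      exact ⟨0, fun j => by simp [this, DiffOp.actX_zero]⟩
    | succ d ih =>
      intro φ hφ h
      -- Cancel the coefficient of `z^d` by `∑ a_i ∂_x^d ψ_i`. Since `d` bounds the powers of `z`
      -- strictly, the case `0` of the induction is `eq_zero_of_coeff`.
      set a : Fin r → RatFunc ℂ := fun i => (φ i).coeff (-(d : ℤ))
      set χ : Fin r → (RatFunc ℂ)⸨X⸩ :=
        fun j => ∑ i, HahnSeries.C (a i) * expDx^[d] (ψ i j) with hχ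
      have hχS : χ ∈ S.bakerModule := sum_mem_bakerModule _ fun i _ =>
        C_mul_mem_bakerModule (expDx_iterate_mem_bakerModule (hψS i) d) (a i)
      obtain ⟨Θ, hΘ⟩ := ih (φ - χ) (S.bakerModule.sub_mem hφ hχS) fun j n hn => by
        rw [Pi.sub_apply, HahnSeries.coeff_sub, sub_eq_zero, hχ, HahnSeries.coeff_sum]
        simp only [HahnSeries.C_mul_eq_smul, HahnSeries.coeff_smul, smul_eq_mul]
        have hk := fun i => coeff_expDx_iterate (hψ.1 i j) d
        rcases eq_or_lt_of_le (show n ≤ -(d : ℤ) by lia) with rfl | hn'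
        · simp only [(hk _).2, hψ.2, Matrix.one_apply, mul_ite, mul_one, mul_zero]
          rw [Finset.sum_ite_eq', if_pos (Finset.mem_univ j)]
        · rw [h j n (by push_cast; lia)]
          exact (Finset.sum_eq_zero fun i _ => by rw [(hk i).1 n hn', mul_zero]).symm
      refine ⟨fun i => Finsupp.single d (a i) + Θ i, fun j => ?_⟩
      simp only [DiffOp.actX_add, DiffOp.actX_single, Finset.sum_add_distrib, ← hΘ]
      exact (add_sub_cancel (χ j) (φ j)).symm
  refine main (Finset.univ.sup (fun j => (-(φ j).order).toNat) + 1) φ hφ fun j n hn => ?_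
  refine HahnSeries.coeff_eq_zero_of_lt_order ?_
  have : (-(φ j).order).toNat ≤ _ :=
    Finset.le_sup (f := fun j => (-(φ j).order).toNat) (Finset.mem_univ j)
  push_cast at hn
  lia

end PointConditions

/-! ### Entire functions and polynomials -/

theorem eventually_eval_ne_zero {b : ℂ[X]} (hb : b ≠ 0) :
    ∀ᶠ z : ℂ in Filter.cofinite, b.eval z ≠ 0 := by
  refine Filter.mem_cofinite.mpr (b.roots.toFinset.finite_toSet.subset fun z hz => ?_)
  simpa [hb] using hz

theorem differentiable_dslope {g : ℂ → ℂ} (hg : Differentiable ℂ g) (c : ℂ) :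
    Differentiable ℂ (dslope g c) := by
  rw [← differentiableOn_univ] at hg ⊢
  exact (Complex.differentiableOn_dslope Filter.univ_mem).mpr hg

theorem eq_add_sub_mul_dslope (g : ℂ → ℂ) (c z : ℂ) : g z = g c + (z - c) * dslope g c z := by
  have := sub_smul_dslope g c z
  rw [smul_eq_mul] at this
  rw [this]
  ring

/-- Division of an entire function by a polynomial. -/
theorem exists_entire_div {g : ℂ → ℂ} (hg : Differentiable ℂ g) {Q : ℂ[X]} (hQ : Q ≠ 0) :
    ∃ (ρ : ℂ[X]) (h : ℂ → ℂ), Differentiable ℂ h ∧ ∀ z, g z = ρ.eval z + Q.eval z * h z := by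
  induction hn : Q.natDegree generalizing Q with
  | zero =>
    rw [natDegree_eq_zero] at hn
    obtain ⟨a, rfl⟩ := hn
    have ha : a ≠ 0 := by simpa using hQ
    refine ⟨0, fun z => a⁻¹ * g z, hg.const_mul _, fun z => ?_⟩
    simp [ha]
  | succ n ih =>
    obtain ⟨c, hc⟩ := IsAlgClosed.exists_root Q (by
      rw [degree_eq_natDegree hQ, hn]; exact_mod_cast n.succ_ne_zero)
    obtain ⟨Q', rfl⟩ := dvd_iff_isRoot.mpr hc
    have hQ' : Q' ≠ 0 := right_ne_zero_of_mul hQ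
    obtain ⟨ρ, h, hh, he⟩ := ih hQ' (by
      rw [natDegree_mul (X_sub_C_ne_zero c) hQ', natDegree_X_sub_C] at hn; lia)
    refine ⟨ρ + Q' * C (h c), dslope h c, differentiable_dslope hh c, fun z => ?_⟩
    rw [he z, eq_add_sub_mul_dslope h c z]
    simp only [eval_add, eval_mul, eval_C, eval_sub, eval_X]
    ring

theorem eq_of_eventually_cofinite {f g : ℂ → ℂ} (hf : Continuous f) (hg : Continuous g)
    (h : ∀ᶠ z in Filter.cofinite, f z = g z) : f = g := by
  refine Continuous.ext_on (s := {z | f z = g z}) ?_ hf hg fun z hz => hz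
  have := (dense_univ (X := ℂ)).sdiff_finite (Filter.mem_cofinite.mp h)
  rwa [← Set.compl_eq_univ_sdiff, compl_compl] at this

/-- By continuity the identity extends to all `z`, so each root of `b` is a root of `f` and can be
cancelled. -/
theorem dvd_of_eventually_eq {b f : ℂ[X]} (hb : b ≠ 0) {G : ℂ → ℂ} (hG : Continuous G)
    (h : ∀ᶠ z in Filter.cofinite, f.eval z = b.eval z * G z) : b ∣ f := by
  induction hn : b.natDegree generalizing b f with
  | zero =>
    rw [natDegree_eq_zero] at hn
    obtain ⟨a, rfl⟩ := hn
    exact (isUnit_C.mpr (IsUnit.mk0 a (by simpa using hb))).dvd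
  | succ n ih =>
    obtain ⟨c, hc⟩ := IsAlgClosed.exists_root b (by
      rw [degree_eq_natDegree hb, hn]; exact_mod_cast n.succ_ne_zero)
    obtain ⟨b', rfl⟩ := dvd_iff_isRoot.mpr hc
    have hb' : b' ≠ 0 := right_ne_zero_of_mul hb
    have h1 := congrFun (eq_of_eventually_cofinite f.continuous
      (((X - C c) * b').continuous.mul hG) h) c
    have hfc : f.IsRoot c := by simpa using h1
    obtain ⟨f', rfl⟩ := dvd_iff_isRoot.mpr hfc
    refine mul_dvd_mul_left _ (ih hb' ?_ ?_)
    · filter_upwards [h, eventually_eval_ne_zero (X_sub_C_ne_zero c)] with z hz hzc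
      rw [eval_mul, eval_mul, mul_assoc] at hz
      exact mul_left_cancel₀ hzc hz
    · rw [natDegree_mul (X_sub_C_ne_zero c) hb', natDegree_X_sub_C] at hn
      lia

/-- The Taylor expansion of `e^{xw}` with entire remainder. -/
theorem exists_exp_taylor (x : ℂ) (k : ℕ) : ∃ h : ℂ → ℂ, Differentiable ℂ h ∧
    ∀ w, Complex.exp (x * w) = ∑ t ∈ Finset.range k, (t.factorial : ℂ)⁻¹ * x ^ t * w ^ t +
      w ^ k * h w := by
  -- The iterated divided differences of `exp` at `0` are the entire remainders, and their values at
  -- `0` are the Taylor coefficients.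
  set e : ℕ → ℂ → ℂ := fun n => (Function.swap dslope 0)^[n] Complex.exp with he
  have hd : ∀ n, Differentiable ℂ (e n) := by
    intro n
    induction n with
    | zero => exact Complex.differentiable_exp
    | succ n ih =>
      simp only [he, Function.iterate_succ_apply']
      exact differentiable_dslope ih 0
  have h0 : ∀ n, e n 0 = (n.factorial : ℂ)⁻¹ := by
    intro n
    have h1 : HasFPowerSeriesAt Complex.exp (NormedSpace.expSeries ℂ ℂ) 0 := by
      rw [Complex.exp_eq_exp_ℂ]
      exact NormedSpace.exp_hasFPowerSeriesAt_zero
    have h2 := (h1.has_fpower_series_iterate_dslope_fslope n).coeff_zero (fun _ => 0)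
    have h3 := FormalMultilinearSeries.coeff_iterate_fslope (p := NormedSpace.expSeries ℂ ℂ) n 0
    have h4 : (NormedSpace.expSeries ℂ ℂ).coeff n = (n.factorial : ℂ)⁻¹ := by
      exact (NormedSpace.expSeries_apply_eq (𝕂 := ℂ) (1 : ℂ) n).trans (by simp)
    rw [zero_add, h4, FormalMultilinearSeries.coeff] at h3
    rw [← h3]
    refine h2.symm.trans (congrArg _ ?_)
    exact Subsingleton.elim _ _
  have hexp : ∀ n w, Complex.exp w =
      ∑ t ∈ Finset.range n, (t.factorial : ℂ)⁻¹ * w ^ t + w ^ n * e n w := by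
    intro n w
    induction n with
    | zero => simp [he]
    | succ n ih =>
      rw [ih, Finset.sum_range_succ, eq_add_sub_mul_dslope (e n) 0 w, h0]
      simp only [he, Function.iterate_succ_apply', Function.swap]
      ring
  refine ⟨fun w => x ^ k * e k (x * w), ?_, fun w => ?_⟩
  · exact ((hd k).comp (differentiable_id.const_mul x)).const_mul _
  · rw [hexp k (x * w)]
    simp only [mul_pow]
    congr 1
    · exact Finset.sum_congr rfl fun t _ => by ring
    · ring

/-! ### Evaluation of rational functions -/

/-- The denominator of `f` divides `b`. Regularity is part of the conclusion since `RatFunc.eval` is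
`0` by convention at a pole; for the same reason the evaluation rules below hold off a finite set.
-/
theorem eval_of_mul_eq {f : RatFunc ℂ} {a b : ℂ[X]} {x : ℂ}
    (h : algebraMap ℂ[X] (RatFunc ℂ) b * f = algebraMap ℂ[X] (RatFunc ℂ) a)
    (hb : b.eval x ≠ 0) :
    f.denom.eval x ≠ 0 ∧ b.eval x * f.eval (RingHom.id ℂ) x = a.eval x := by
  have hb0 : b ≠ 0 := by
    rintro rfl
    simp at hb
  have hf : f = algebraMap ℂ[X] (RatFunc ℂ) a / algebraMap ℂ[X] (RatFunc ℂ) b := by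
    rw [eq_div_iff (RatFunc.algebraMap_ne_zero hb0), mul_comm, h]
  have hd : f.denom.eval x ≠ 0 := by
    have : f.denom ∣ b := by rw [hf]; exact RatFunc.denom_div_dvd a b
    obtain ⟨c, rfl⟩ := this
    rw [eval_mul] at hb
    exact left_ne_zero_of_mul hb
  have h1 := (RatFunc.num_mul_eq_mul_denom_iff hb0).mpr hf
  refine ⟨hd, ?_⟩
  have h2 := congrArg (Polynomial.eval x) h1
  rw [eval_mul, eval_mul] at h2
  change _ * (f.num.eval x / f.denom.eval x) = _
  field_simp
  linear_combination h2

theorem denom_mul_self (f : RatFunc ℂ) : algebraMap ℂ[X] (RatFunc ℂ) f.denom * f =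
    algebraMap ℂ[X] (RatFunc ℂ) f.num := by
  have h := f.num_div_denom
  rwa [div_eq_iff (RatFunc.algebraMap_ne_zero f.denom_ne_zero), eq_comm, mul_comm] at h

theorem eventually_eval_of_mul_eq {f : RatFunc ℂ} {a b : ℂ[X]} (hb : b ≠ 0)
    (h : algebraMap ℂ[X] (RatFunc ℂ) b * f = algebraMap ℂ[X] (RatFunc ℂ) a) :
    ∀ᶠ x in Filter.cofinite, b.eval x * f.eval (RingHom.id ℂ) x = a.eval x :=
  (eventually_eval_ne_zero hb).mono fun _ hx => (eval_of_mul_eq h hx).2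

theorem eventually_eval_add (f g : RatFunc ℂ) : ∀ᶠ x in Filter.cofinite,
    (f + g).eval (RingHom.id ℂ) x = f.eval (RingHom.id ℂ) x + g.eval (RingHom.id ℂ) x := by
  filter_upwards [eventually_eval_ne_zero f.denom_ne_zero,
    eventually_eval_ne_zero g.denom_ne_zero] with x hf hg
  exact RatFunc.eval_add _ _ hf hg

theorem eventually_eval_mul (f g : RatFunc ℂ) : ∀ᶠ x in Filter.cofinite,
    (f * g).eval (RingHom.id ℂ) x = f.eval (RingHom.id ℂ) x * g.eval (RingHom.id ℂ) x := by
  filter_upwards [eventually_eval_ne_zero f.denom_ne_zero,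
    eventually_eval_ne_zero g.denom_ne_zero] with x hf hg
  exact RatFunc.eval_mul _ _ hf hg

theorem ratFunc_eval_algebraMap (p : ℂ[X]) (x : ℂ) :
    (algebraMap ℂ[X] (RatFunc ℂ) p).eval (RingHom.id ℂ) x = p.eval x := by
  rw [RatFunc.eval_algebraMap]
  rfl

theorem eventually_eval_sum {ι : Type*} (s : Finset ι) (f : ι → RatFunc ℂ) :
    ∀ᶠ x in Filter.cofinite,
      (∑ i ∈ s, f i).eval (RingHom.id ℂ) x = ∑ i ∈ s, (f i).eval (RingHom.id ℂ) x := by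
  classical
  induction s using Finset.induction_on with
  | empty => exact Filter.Eventually.of_forall fun x => by simp
  | insert i s hi ih =>
    filter_upwards [ih, eventually_eval_add (f i) (∑ i ∈ s, f i)] with x h1 h2
    rw [Finset.sum_insert hi, Finset.sum_insert hi, h2, h1]

theorem eventually_eval_sum_mul {ι : Type*} (s : Finset ι) (f : ι → RatFunc ℂ) (g : ι → ℂ[X]) :
    ∀ᶠ x in Filter.cofinite,
      (∑ i ∈ s, f i * algebraMap ℂ[X] (RatFunc ℂ) (g i)).eval (RingHom.id ℂ) x =
        ∑ i ∈ s, (f i).eval (RingHom.id ℂ) x * (g i).eval x := by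
  have h : ∀ᶠ x in Filter.cofinite, ∀ i ∈ s,
      (f i * algebraMap ℂ[X] (RatFunc ℂ) (g i)).eval (RingHom.id ℂ) x =
        (f i).eval (RingHom.id ℂ) x * (g i).eval x := by
    rw [Filter.eventually_all_finset]
    intro i _
    filter_upwards [eventually_eval_mul (f i) (algebraMap ℂ[X] (RatFunc ℂ) (g i))] with x hx
    rw [hx, ratFunc_eval_algebraMap]
  filter_upwards [h, eventually_eval_sum s fun i => f i * algebraMap ℂ[X] (RatFunc ℂ) (g i)]
    with x h1 h2
  rw [h2]
  exact Finset.sum_congr rfl h1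

theorem eq_zero_of_eventually_eval {f : RatFunc ℂ}
    (h : ∀ᶠ x in Filter.cofinite, f.eval (RingHom.id ℂ) x = 0) : f = 0 := by
  rw [← RatFunc.num_eq_zero_iff]
  by_contra hn
  have h1 := eventually_eval_of_mul_eq f.denom_ne_zero (denom_mul_self f)
  obtain ⟨x, hx1, hx2, hx3⟩ := (h.and (h1.and (eventually_eval_ne_zero hn))).exists
  rw [hx1, mul_zero] at hx2
  exact hx3 hx2.symm

/-! ### Membership in the completion -/

namespace PointConditions

variable {r : ℕ} {S : PointConditions r} {W : Submodule ℂ (Fin r → RatFunc ℂ)}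

/-- The truncated exponential `e^{x(z-c)}`. -/
def truncExp (S : PointConditions r) (j : S.J) (x : ℂ) : ℂ[X] :=
  ∑ t ∈ Finset.range S.κ, ((t.factorial : ℂ)⁻¹ * x ^ t) • (X - C (S.c j)) ^ t

/-- The functional kills the powers of `z - c_j` from `κ` on, so the exponential may be truncated.
-/
theorem eval_cond (j : S.J) (v : Fin r → ℂ[X]) (x : ℂ) :
    (S.cond j v).eval x = S.lam j (S.truncExp j x • v) := by
  rw [cond_apply, eval_finsetSum, truncExp, Finset.sum_smul, map_sum]
  refine Finset.sum_congr rfl fun t _ => ?_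
  rw [eval_monomial, smul_assoc, (S.lam j).map_smul, smul_eq_mul]
  ring

theorem exists_truncExp_remainder (j : S.J) (x : ℂ) : ∃ h : ℂ → ℂ, Differentiable ℂ h ∧
    ∀ z, Complex.exp (x * z) = Complex.exp (x * S.c j) *
      ((S.truncExp j x).eval z + ((X - C (S.c j)) ^ S.κ).eval z * h z) := by
  obtain ⟨h, hh, he⟩ := exists_exp_taylor x S.κ
  refine ⟨fun z => h (z - S.c j), hh.comp (differentiable_id.sub_const _), fun z => ?_⟩
  have h1 : x * z = x * S.c j + x * (z - S.c j) := by ring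
  rw [h1, Complex.exp_add, he (z - S.c j)]
  congr 1
  simp [truncExp, eval_finsetSum]

/-- Because `p ℂ[z]^r ⊆ W`, the functionals ignore `q p ℂ[z]^r`; the conditions thus do not see the
part `p 𝒪(ℂ)^r` of the completion. -/
theorem Cuts.lam_q_smul (hW : S.Cuts W) {p : ℂ[X]} (hp : ContainsMultiples W p) (j : S.J)
    (u : Fin r → ℂ[X]) : S.lam j ((S.q * p) • u) = 0 := by
  obtain ⟨v, hv, hlam⟩ := (hW _).mp (hp u)
  have : v = (S.q * p) • u := by
    apply polyRow_injective
    rw [← hv]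
    ext1 i
    simp [polyRow, mul_assoc]
  rw [← this]
  exact hlam j

/-- The functionals depend on finitely many Taylor coefficients at the points `c_j`, so entire
functions can be replaced by polynomials modulo `(z - c_j)^κ`. -/
theorem Cuts.mem_completion_iff (hW : S.Cuts W) (hfat : IsFat W) (M : Fin r → RatFunc ℂ) (x : ℂ) :
    (fun z j => (M j).eval (RingHom.id ℂ) z * Complex.exp (x * z)) ∈ completion W ↔
      ∃ N : Fin r → ℂ[X],
        (∀ i, algebraMap ℂ[X] (RatFunc ℂ) S.q * M i = algebraMap ℂ[X] (RatFunc ℂ) (N i)) ∧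
        ∀ j, (S.cond j N).eval x = 0 := by
  constructor
  · rintro ⟨w, hw, p, hp0, hp, h, hh, he⟩
    obtain ⟨u, hu, hlam⟩ := (hW w).mp hw
    have hh' : ∀ i, Differentiable ℂ fun z => h z i := fun i => differentiable_pi.mp hh i
    have hev : ∀ i, ∀ᶠ z in Filter.cofinite, S.q.eval z * (M i).eval (RingHom.id ℂ) z *
        Complex.exp (x * z) = (u i).eval z + (S.q * p).eval z * h z i := by
      intro i
      filter_upwards [he, eventually_eval_of_mul_eq S.q_ne_zero (congrFun hu i)] with z h1 h2
      rw [mul_assoc, h1 i, mul_add, h2, eval_mul]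
      ring
    have hexp : Differentiable ℂ fun z : ℂ => Complex.exp (-(x * z)) :=
      (differentiable_id.const_mul x).neg.cexp
    have hN : ∀ i, ∃ N : ℂ[X],
        algebraMap ℂ[X] (RatFunc ℂ) S.q * M i = algebraMap ℂ[X] (RatFunc ℂ) N := by
      intro i
      -- The rational function `q M_i` equals `e^{-xz}` times an entire function off a finite set,
      -- so it has no poles.
      have hdvd : (M i).denom ∣ S.q * (M i).num := by
        refine dvd_of_eventually_eq (M i).denom_ne_zero (G := fun z => Complex.exp (-(x * z)) *
          ((u i).eval z + (S.q * p).eval z * h z i)) ?_ ?_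
        · exact hexp.continuous.mul ((u i).continuous.add
            ((S.q * p).continuous.mul (hh' i).continuous))
        · filter_upwards [hev i, eventually_eval_of_mul_eq (M i).denom_ne_zero
            (denom_mul_self (M i))] with z h1 h2
          rw [← h1, eval_mul, ← h2, Complex.exp_neg]
          have := Complex.exp_ne_zero (x * z)
          field_simp
      obtain ⟨N, hN⟩ := hdvd
      refine ⟨N, mul_left_cancel₀ (RatFunc.algebraMap_ne_zero (M i).denom_ne_zero) ?_⟩
      rw [mul_left_comm, denom_mul_self, ← map_mul, ← map_mul, hN]
    choose N hN using hN
    refine ⟨N, hN, fun j => ?_⟩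
    rw [eval_cond]
    have hc := X_sub_C_ne_zero (S.c j)
    obtain ⟨ε, hε, hexpj⟩ := exists_truncExp_remainder (S := S) j x
    choose ρ g hg hρ using fun i => exists_entire_div (hh' i) (pow_ne_zero S.κ hc)
    set a := (Complex.exp (x * S.c j))⁻¹ with ha
    have hdvd : ∀ i, (X - C (S.c j)) ^ S.κ ∣
        S.truncExp j x * N i - a • (u i + S.q * p * ρ i) := by
      intro i
      refine dvd_of_eventually_eq (pow_ne_zero S.κ hc)
        (G := fun z => a * (S.q * p).eval z * g i z - (N i).eval z * ε z) ?_ ?_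
      · exact ((continuous_const.mul (S.q * p).continuous).mul (hg i).continuous).sub
          ((N i).continuous.mul hε.continuous)
      · filter_upwards [hev i, eventually_eval_ne_zero S.q_ne_zero] with z h1 h2
        have h3 := (eval_of_mul_eq (hN i) h2).2
        rw [h3, hexpj, hρ i z] at h1
        have h4 : a * Complex.exp (x * S.c j) = 1 := inv_mul_cancel₀ (Complex.exp_ne_zero _)
        simp only [eval_sub, eval_mul, eval_smul, eval_add, smul_eq_mul] at h1 ⊢
        linear_combination a * h1 - (N i).eval z * ((S.truncExp j x).eval z +
          ((X - C (S.c j)) ^ S.κ).eval z * ε z) * h4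
    choose m hm using hdvd
    -- Modulo `(z - c_j)^κ` the row is a multiple of `u + q p ρ`. The functional kills `u`, `q p ρ`
    -- and the multiple of `(z - c_j)^κ`.
    have key : S.truncExp j x • N = a • (u + (S.q * p) • ρ) + (X - C (S.c j)) ^ S.κ • m := by
      ext1 i
      simp only [Pi.smul_apply, Pi.add_apply, smul_eq_mul]
      rw [← hm]
      ring
    rw [key, map_add, map_smul, map_add, hlam, hW.lam_q_smul hp, S.lam_pow_smul, add_zero, add_zero,
      smul_zero]
  · rintro ⟨N, hN, hcond⟩
    obtain ⟨p, -, hp0, -, hp, -⟩ := hfat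
    set P : ℂ[X] := ∏ j, (X - C (S.c j)) ^ S.κ with hP
    have hP0 : P ≠ 0 := Finset.prod_ne_zero_iff.mpr fun j _ => pow_ne_zero _ (X_sub_C_ne_zero _)
    have hexp : Differentiable ℂ fun z : ℂ => Complex.exp (x * z) :=
      (differentiable_id.const_mul x).cexp
    -- Write `e^{xz} = ρ + q p P g`, where the factor `P` makes `ρ` agree with `e^{xz}` to order `κ`
    -- at every `c_j`. Then `M ρ` lies in `W`, and the rest of `M e^{xz}` is `p P` times the entire
    -- row `N g`.
    obtain ⟨ρ, g, hg, hρ⟩ := exists_entire_div hexp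
      (mul_ne_zero S.q_ne_zero (mul_ne_zero hp0 hP0))
    have hlam : ∀ j, S.lam j (ρ • N) = 0 := by
      intro j
      obtain ⟨ε, hε, hexpj⟩ := exists_truncExp_remainder (S := S) j x
      obtain ⟨P', hP'⟩ : (X - C (S.c j)) ^ S.κ ∣ P :=
        Finset.dvd_prod_of_mem (fun j => (X - C (S.c j)) ^ S.κ) (Finset.mem_univ j)
      have hdvd : (X - C (S.c j)) ^ S.κ ∣ ρ - Complex.exp (x * S.c j) • S.truncExp j x := by
        refine dvd_of_eventually_eq (pow_ne_zero S.κ (X_sub_C_ne_zero _))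
          (G := fun z => Complex.exp (x * S.c j) * ε z - (S.q * (p * P')).eval z * g z) ?_ ?_
        · exact (continuous_const.mul hε.continuous).sub
            ((S.q * (p * P')).continuous.mul hg.continuous)
        · refine Filter.Eventually.of_forall fun z => ?_
          have h1 := hρ z
          rw [hexpj, hP'] at h1
          simp only [eval_sub, eval_mul, eval_smul, smul_eq_mul] at h1 ⊢
          linear_combination -h1
      have h2 := S.lam_smul_of_dvd j hdvd N
      rwa [sub_smul, map_sub, smul_assoc, (S.lam j).map_smul, ← eval_cond, hcond, smul_zero,
        sub_zero] at h2
    refine ⟨fun i => M i * algebraMap ℂ[X] (RatFunc ℂ) ρ, (hW _).mpr ⟨ρ • N, ?_, hlam⟩, p * P,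
      mul_ne_zero hp0 hP0, fun u => ?_, fun z i => (N i).eval z * g z, ?_, ?_⟩
    · ext1 i
      simp only [Pi.smul_apply, smul_eq_mul, polyRow]
      rw [← mul_assoc, hN, map_mul, mul_comm]
    · rw [mul_smul]
      exact hp _
    · exact differentiable_pi.mpr fun i => (N i).differentiable.mul hg
    · rw [Filter.eventually_all]
      intro i
      filter_upwards [eventually_eval_ne_zero S.q_ne_zero,
        eventually_eval_mul (M i) (algebraMap ℂ[X] (RatFunc ℂ) ρ)] with z h1 h2
      rw [h2, ratFunc_eval_algebraMap, hρ z, ← (eval_of_mul_eq (hN i) h1).2]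
      simp only [eval_mul]
      ring

end PointConditions

/-! ### Baker functions and the Baker module -/

theorem coeff_mul_polySeries {K : Type} [Field K] (φ : K⸨X⸩) {p : K[X]} {B : ℕ}
    (hB : p.natDegree < B) (m : ℤ) :
    (φ * polySeries K p).coeff m = ∑ n ∈ Finset.range B, φ.coeff (m + n) * p.coeff n := by
  conv_lhs => rw [p.as_sum_range' B hB, map_sum, Finset.mul_sum, HahnSeries.coeff_sum]
  refine Finset.sum_congr rfl fun n _ => ?_
  rw [polySeries_monomial, HahnSeries.coeff_mul_single, sub_neg_eq_add]

theorem polySeries_coeff_range {K : Type} [Field K] {χ : K⸨X⸩} {B : ℕ}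
    (hpos : ∀ m : ℤ, 0 < m → χ.coeff m = 0) (hB : ∀ k : ℕ, B ≤ k → χ.coeff (-(k : ℤ)) = 0) :
    χ = polySeries K (∑ k ∈ Finset.range B, monomial k (χ.coeff (-(k : ℤ)))) := by
  ext m
  rcases lt_or_ge 0 m with hm | hm
  · rw [hpos m hm, polySeries_coeff_pos _ hm]
  · obtain ⟨k, rfl⟩ : ∃ k : ℕ, m = -(k : ℤ) := ⟨(-m).toNat, by lia⟩
    rw [polySeries_coeff_neg, finsetSum_coeff]
    simp only [coeff_monomial]
    rw [Finset.sum_ite_eq']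
    split_ifs with hk
    · rfl
    · exact hB k (by simpa using hk)

theorem row_eq_sum_single {r : ℕ} {K : Type*} [Field K] {B : ℕ} {v : Fin r → K[X]}
    (hB : ∀ i, (v i).natDegree < B) :
    v = ∑ i, ∑ k ∈ Finset.range B, Pi.single i (monomial k ((v i).coeff k)) := by
  conv_lhs => rw [← Finset.univ_sum_single v]
  refine Finset.sum_congr rfl fun i _ => ?_
  conv_lhs => rw [(v i).as_sum_range' B (hB i)]
  exact map_sum (AddMonoidHom.single (fun _ : Fin r => K[X]) i) _ _

namespace PointConditions

variable {r : ℕ} {S : PointConditions r} {W : Submodule ℂ (Fin r → RatFunc ℂ)}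

theorem eval_cond_eq_sum (j : S.J) {v : Fin r → ℂ[X]} {B : ℕ} (hB : ∀ i, (v i).natDegree < B)
    (x : ℂ) : (S.cond j v).eval x = ∑ i, ∑ k ∈ Finset.range B,
      (v i).coeff k * (S.cond j (Pi.single i (X ^ k))).eval x := by
  conv_lhs => rw [row_eq_sum_single hB]
  simp only [map_sum, eval_finsetSum]
  refine Finset.sum_congr rfl fun i _ => Finset.sum_congr rfl fun k _ => ?_
  have : (Pi.single i (monomial k ((v i).coeff k)) : Fin r → ℂ[X]) =
      (v i).coeff k • Pi.single i (X ^ k) := by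
    rw [← Pi.single_smul, X_pow_eq_monomial, smul_monomial, smul_eq_mul, mul_one]
  rw [this, map_smul, eval_smul, smul_eq_mul]

theorem condK_eq_sum (j : S.J) {v : Fin r → (RatFunc ℂ)[X]} {B : ℕ}
    (hB : ∀ i, (v i).natDegree < B) : S.condK j v = ∑ i, ∑ k ∈ Finset.range B,
      (v i).coeff k * algebraMap ℂ[X] (RatFunc ℂ) (S.cond j (Pi.single i (X ^ k))) := by
  conv_lhs => rw [row_eq_sum_single hB]
  simp only [map_sum, condK_single_monomial]

/-- The rows of a stationary Baker function of `W` belong to the Baker module. -/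
theorem Cuts.row_mem_bakerModule (hW : S.Cuts W) (hfat : IsFat W)
    {ψ : Matrix (Fin r) (Fin r) (RatFunc ℂ)⸨X⸩} (hψ : IsStationaryBaker W ψ) (i : Fin r) :
    ψ i ∈ S.bakerModule := by
  obtain ⟨hneg, -, hev⟩ := hψ
  set B := S.q.natDegree + 1 with hB
  set q' := S.q.map (algebraMap ℂ (RatFunc ℂ)) with hq'
  have hqB : q'.natDegree < B := lt_of_le_of_lt natDegree_map_le (Nat.lt_succ_self _)
  set χ : Fin r → (RatFunc ℂ)⸨X⸩ := fun j => ψ i j * polySeries (RatFunc ℂ) q' with hχ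
  have hχc : ∀ j m, (χ j).coeff m = ∑ n ∈ Finset.range B, (ψ i j).coeff (m + n) *
      algebraMap ℂ[X] (RatFunc ℂ) (C (S.q.coeff n)) := by
    intro j m
    rw [hχ]
    dsimp only
    rw [coeff_mul_polySeries _ hqB]
    refine Finset.sum_congr rfl fun n _ => ?_
    rw [hq', coeff_map, algebraMap_eq_C]
  have hlow : ∀ j, ∀ k : ℕ, B ≤ k → (χ j).coeff (-(k : ℤ)) = 0 := by
    intro j k hk
    rw [hχc]
    refine Finset.sum_eq_zero fun n hn => ?_
    rw [Finset.mem_range] at hn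
    rw [hneg i j _ (by lia), zero_mul]
  -- For generic `x` the numerator exists as a polynomial row over `ℂ`. Its coefficients are the
  -- values at `x` of those of `χ = q ψ_i`, so identities for generic `x` lift to `ℂ(x)`.
  have hchi : ∀ᶠ x : ℂ in Filter.cofinite, ∃ N : Fin r → ℂ[X],
      (∀ j m, (polySeries ℂ (N j)).coeff m = ∑ n ∈ Finset.range B,
        ((ψ i j).coeff (m + n)).eval (RingHom.id ℂ) x * (C (S.q.coeff n)).eval x) ∧
      ∀ j, (S.cond j N).eval x = 0 := by
    filter_upwards [hev] with x hx
    obtain ⟨-, M, hM, hc⟩ := hx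
    obtain ⟨N, hN, hcond⟩ := (hW.mem_completion_iff hfat (M i) x).mp (hc i)
    refine ⟨N, fun j m => ?_, hcond⟩
    have h1 := congrArg (expandHom ℂ) (hN j)
    rw [map_mul, expandHom_algebraMap, expandHom_algebraMap, Algebra.algebraMap_self,
      Polynomial.map_id, Polynomial.map_id, mul_comm] at h1
    rw [← h1, coeff_mul_polySeries _ (Nat.lt_succ_self _)]
    refine Finset.sum_congr rfl fun n _ => ?_
    rw [eval_C, ← hM i j]
    rfl
  have hcoef : ∀ j m, ∀ᶠ x : ℂ in Filter.cofinite,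
      ((χ j).coeff m).eval (RingHom.id ℂ) x = ∑ n ∈ Finset.range B,
        ((ψ i j).coeff (m + n)).eval (RingHom.id ℂ) x * (C (S.q.coeff n)).eval x := by
    intro j m
    rw [hχc]
    exact eventually_eval_sum_mul _ _ _
  have hpos : ∀ j, ∀ m : ℤ, 0 < m → (χ j).coeff m = 0 := by
    intro j m hm
    refine eq_zero_of_eventually_eval ?_
    filter_upwards [hchi, hcoef j m] with x ⟨N, hN, _⟩ h2
    rw [h2, ← hN, polySeries_coeff_pos _ hm]
  set P : Fin r → (RatFunc ℂ)[X] :=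
    fun j => ∑ k ∈ Finset.range B, monomial k ((χ j).coeff (-(k : ℤ))) with hP
  have hχP : ∀ j, χ j = polySeries (RatFunc ℂ) (P j) :=
    fun j => polySeries_coeff_range (hpos j) (hlow j)
  have hPdeg : ∀ j, (P j).natDegree < B := by
    intro j
    refine lt_of_le_of_lt (natDegree_sum_le_of_forall_le _ _ (n := S.q.natDegree) fun k hk => ?_)
      (Nat.lt_succ_self _)
    rw [Finset.mem_range] at hk
    exact (natDegree_monomial_le _).trans (by lia)
  refine ⟨P, fun j => ?_, fun j => ?_⟩
  · rw [expandHom_algebraMap]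
    exact hχP j
  · rw [condK_eq_sum j hPdeg]
    refine eq_zero_of_eventually_eval ?_
    have h1 : ∀ᶠ x : ℂ in Filter.cofinite, ∀ i', (∑ k ∈ Finset.range B, (P i').coeff k *
        algebraMap ℂ[X] (RatFunc ℂ) (S.cond j (Pi.single i' (X ^ k)))).eval (RingHom.id ℂ) x =
        ∑ k ∈ Finset.range B, ((P i').coeff k).eval (RingHom.id ℂ) x *
          (S.cond j (Pi.single i' (X ^ k))).eval x :=
      Filter.eventually_all.mpr fun i' => eventually_eval_sum_mul _ _ _
    have h2 : ∀ᶠ x : ℂ in Filter.cofinite, ∀ i', ∀ k ∈ Finset.range B,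
        ((χ i').coeff (-(k : ℤ))).eval (RingHom.id ℂ) x = ∑ n ∈ Finset.range B,
        ((ψ i i').coeff (-(k : ℤ) + n)).eval (RingHom.id ℂ) x * (C (S.q.coeff n)).eval x := by
      refine Filter.eventually_all.mpr fun i' => ?_
      rw [Filter.eventually_all_finset]
      exact fun k _ => hcoef i' _
    filter_upwards [hchi, eventually_eval_sum Finset.univ fun i' => ∑ k ∈ Finset.range B,
      (P i').coeff k * algebraMap ℂ[X] (RatFunc ℂ) (S.cond j (Pi.single i' (X ^ k))), h1, h2]
      with x ⟨N, hN, hcond⟩ h3 h4 h5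
    have hNdeg : ∀ i', (N i').natDegree < B := by
      intro i'
      rw [Nat.lt_succ_iff, natDegree_le_iff_coeff_eq_zero]
      intro k hk
      rw [← polySeries_coeff_neg, hN]
      refine Finset.sum_eq_zero fun n hn => ?_
      rw [Finset.mem_range] at hn
      rw [hneg i i' _ (by lia), RatFunc.eval_zero, zero_mul]
    rw [h3, ← hcond j, eval_cond_eq_sum j hNdeg]
    refine Finset.sum_congr rfl fun i' _ => ?_
    rw [h4]
    refine Finset.sum_congr rfl fun k hk => ?_
    rw [← polySeries_coeff_neg (N i'), hN, ← h5 i' k hk, hχP i', polySeries_coeff_neg]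

/-- A normalized matrix with rows in the Baker module is a stationary Baker function of `W`. -/
theorem Cuts.isStationaryBaker (hW : S.Cuts W) (hfat : IsFat W)
    {ψ : Matrix (Fin r) (Fin r) (RatFunc ℂ)⸨X⸩} (hψ : IsNormalized ψ)
    (hmem : ∀ i, ψ i ∈ S.bakerModule) : IsStationaryBaker W ψ := by
  refine ⟨hψ.1, hψ.2, ?_⟩
  choose N hN hcond using hmem
  obtain ⟨h, P, hh, hP⟩ := exists_common_denominator fun ij : Fin r × Fin r => N ij.1 ij.2
  obtain ⟨B, hB⟩ : ∃ B : ℕ, ∀ i j, (P (i, j)).natDegree < B :=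
    ⟨Finset.univ.sup (fun ij => (P ij).natDegree) + 1, fun i j =>
      Nat.lt_succ_of_le (Finset.le_sup (f := fun ij => (P ij).natDegree) (Finset.mem_univ (i, j)))⟩
  have hq := RatFunc.algebraMap_ne_zero S.q_ne_zero
  -- The expansion of `1/q` has constant coefficients, so the one polynomial `h` clears the
  -- denominators of all `a_n` and a single finite exceptional set suffices.
  set e : RatFunc ℂ := (algebraMap ℂ[X] (RatFunc ℂ) S.q)⁻¹ with he
  have hcoef : ∀ i j m, algebraMap ℂ[X] (RatFunc ℂ) h * (ψ i j).coeff m =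
      algebraMap ℂ[X] (RatFunc ℂ) (∑ n ∈ Finset.range B,
        C ((expandHom ℂ e).coeff (m + n)) * (P (i, j)).coeff n) := by
    intro i j m
    have h1 : ψ i j = expandHom (RatFunc ℂ) e * polySeries (RatFunc ℂ) (N i j) := by
      rw [← hN, mul_left_comm, ← map_mul, he, inv_mul_cancel₀ hq, map_one, mul_one]
    have h2 : HahnSeries.C (algebraMap ℂ[X] (RatFunc ℂ) h) * ψ i j =
        expandHom (RatFunc ℂ) e *
          polySeries (RatFunc ℂ) ((P (i, j)).map (algebraMap ℂ[X] (RatFunc ℂ))) := by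
      rw [h1, hP, smul_eq_C_mul, map_mul, polySeries_C]
      ring
    have h3 := congrFun (congrArg HahnSeries.coeff h2) m
    rw [HahnSeries.C_mul_eq_smul, HahnSeries.coeff_smul, smul_eq_mul, coeff_mul_polySeries _
      (lt_of_le_of_lt natDegree_map_le (hB i j))] at h3
    rw [h3, map_sum]
    refine Finset.sum_congr rfl fun n _ => ?_
    rw [coeff_map, expandHom_coeff, algebraMap_eq_C, map_mul]
  filter_upwards [eventually_eval_ne_zero hh] with x hx
  -- The numerators `N` specialized at `x`.
  set N' : Fin r → Fin r → ℂ[X] :=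
    fun i j => C (h.eval x)⁻¹ * (P (i, j)).map (evalRingHom x) with hN'
  have hN'deg : ∀ i j, (N' i j).natDegree < B := fun i j =>
    lt_of_le_of_lt ((natDegree_C_mul_le _ _).trans natDegree_map_le) (hB i j)
  have hN'c : ∀ i j n, (N' i j).coeff n = (h.eval x)⁻¹ * ((P (i, j)).coeff n).eval x :=
    fun i j n => by rw [hN', coeff_C_mul, coeff_map, coe_evalRingHom]
  refine ⟨fun i j n => (eval_of_mul_eq (hcoef i j n) hx).1,
    fun i j => e * algebraMap ℂ[X] (RatFunc ℂ) (N' i j), fun i j m => ?_, fun i => ?_⟩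
  · have h1 := (eval_of_mul_eq (hcoef i j m) hx).2
    change (expandHom ℂ _).coeff m = _
    rw [map_mul, expandHom_algebraMap, Algebra.algebraMap_self, Polynomial.map_id,
      coeff_mul_polySeries _ (hN'deg i j)]
    refine mul_left_cancel₀ hx (Eq.trans ?_ h1.symm)
    rw [Finset.mul_sum, eval_finsetSum]
    refine Finset.sum_congr rfl fun n _ => ?_
    rw [hN'c, eval_mul, eval_C]
    field_simp
  · refine (hW.mem_completion_iff hfat _ x).mpr ⟨N' i, fun j => ?_, fun j => ?_⟩
    · rw [← mul_assoc, he, mul_inv_cancel₀ hq, one_mul]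
    · have h1 : S.condK j (algebraMap ℂ[X] (RatFunc ℂ) h • N i) = 0 := by
        rw [map_smul, hcond, smul_zero]
      have h2 : algebraMap ℂ[X] (RatFunc ℂ) h • N i =
          fun j => (P (i, j)).map (algebraMap ℂ[X] (RatFunc ℂ)) := funext fun j => (hP (i, j)).symm
      rw [h2, condK_eq_sum j fun j => lt_of_le_of_lt natDegree_map_le (hB i j)] at h1
      simp only [coeff_map, ← map_mul, ← map_sum] at h1
      rw [map_eq_zero_iff _ (RatFunc.algebraMap_injective ℂ)] at h1
      have h3 := congrArg (Polynomial.eval x) h1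
      simp only [eval_finsetSum, eval_mul, eval_zero] at h3
      rw [eval_cond_eq_sum j (hN'deg i)]
      simp only [hN'c, mul_assoc, ← Finset.mul_sum]
      rw [h3, mul_zero]

end PointConditions

/-! ### Existence and uniqueness of the stationary Baker function. -/

namespace PointConditions

variable {r : ℕ} {S : PointConditions r} {W : Submodule ℂ (Fin r → RatFunc ℂ)}

theorem Cuts.existsUnique_isStationaryBaker (hS : S.Cuts W) (hW : W ∈ AdelicGrassmannian r) :
    ∃! ψ, IsStationaryBaker W ψ := by
  obtain ⟨hfat, -, hL⟩ := hW
  obtain ⟨ψ, hψ, hmem⟩ := hS.exists_isNormalized hL.ge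
  refine ⟨ψ, hS.isStationaryBaker hfat hψ hmem, fun ψ' hψ' => ?_⟩
  -- Normalization cancels in the difference of two Baker functions, leaving rows of the Baker
  -- module with only negative powers of `z`.
  refine funext fun i => sub_eq_zero.mp (hS.eq_zero_of_coeff hL.le
    (S.bakerModule.sub_mem (hS.row_mem_bakerModule hfat hψ' i) (hmem i)) fun j n hn => ?_)
  rw [Pi.sub_apply, HahnSeries.coeff_sub]
  rcases lt_or_eq_of_le hn with hn | rfl
  · rw [hψ'.1 i j n hn, hψ.1 i j n hn, sub_zero]
  · rw [hψ'.2.1, hψ.2, sub_self]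

end PointConditions

open PointConditions

theorem IsStationaryBaker.isNormalized {r : ℕ} {W : Submodule ℂ (Fin r → RatFunc ℂ)}
    {ψ : Matrix (Fin r) (Fin r) (RatFunc ℂ)⸨X⸩} (h : IsStationaryBaker W ψ) : IsNormalized ψ :=
  ⟨h.1, h.2.1⟩

/-! ### Operators between subspaces and between Baker functions -/

section Equivalence

variable {r s : ℕ} {U : Submodule ℂ (Fin r → RatFunc ℂ)} {V : Submodule ℂ (Fin s → RatFunc ℂ)}
  {S : PointConditions r} {T : PointConditions s} {D : Matrix (Fin r) (Fin s) DiffOp}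
  {ψU : Matrix (Fin r) (Fin r) (RatFunc ℂ)⸨X⸩} {ψV : Matrix (Fin s) (Fin s) (RatFunc ℂ)⸨X⸩}

/-- Up to a factor in `ℂ[x]`, a row of `ψ_U` is `E.e^{xz}` with `E ∈ M_U`; such factors commute with
`⋆ D`. Composition with `D` sends `M_U` to `M_V`, and the Baker module of `V` is generated by the
rows of `ψ_V`. -/
theorem exists_bakerStar_eq_bakerAct (hS : S.Cuts U) (hT : T.Cuts V)
    (hL : leadingCoeffs V ⊆ Set.range polyRow) (hU : ∀ i, ψU i ∈ S.bakerModule)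
    (hψV : IsNormalized ψV) (hV : ∀ i, ψV i ∈ T.bakerModule) (hD : D ∈ opSpace U V) :
    ∃ Θ : Matrix (Fin r) (Fin s) DiffOp, bakerStar ψU D = bakerAct Θ ψV := by
  have key : ∀ i, bakerStar ψU D i ∈ T.bakerModule := by
    intro i
    obtain ⟨h, hh, E, hE, hsymb⟩ := hS.exists_symb_eq (hU i)
    obtain ⟨F, hF, hFact⟩ := exists_row_comp E D
    have hFV : F ∈ opsInto V := fun p => by
      rw [hFact]
      exact hD _ (hE p)
    have h1 := (hT.symb_mem_iff F).mpr hFV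
    have h2 : ∀ j, (F j).symb = HahnSeries.C (algebraMap ℂ[X] (RatFunc ℂ) h) *
        bakerStar ψU D i j := by
      intro j
      rw [hF, bakerStar, Finset.mul_sum]
      refine Finset.sum_congr rfl fun k _ => ?_
      rw [← hsymb, DiffOp.actZ_C_mul]
    have h3 := C_mul_mem_bakerModule h1 (algebraMap ℂ[X] (RatFunc ℂ) h)⁻¹
    convert h3 using 1
    ext1 j
    rw [h2, ← mul_assoc, ← map_mul, inv_mul_cancel₀ (RatFunc.algebraMap_ne_zero hh), map_one,
      one_mul]
  choose Θ hΘ using fun i => hT.exists_actX hL hψV hV (key i)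
  exact ⟨Θ, funext fun i => funext (hΘ i)⟩

/-- Lift `u` to an operator `E ∈ M_U` with `E.1 = u`, transport `E.e^{xz}` through the Baker
functions, and evaluate the resulting operator in `M_V` at `1`. -/
theorem mem_opSpace_of_bakerStar_eq (hS : S.Cuts U) (hT : T.Cuts V)
    (hL : leadingCoeffs U ⊆ Set.range polyRow) (hψU : IsNormalized ψU)
    (hU : ∀ i, ψU i ∈ S.bakerModule) (hV : ∀ i, ψV i ∈ T.bakerModule)
    {Θ : Matrix (Fin r) (Fin s) DiffOp} (h : bakerStar ψU D = bakerAct Θ ψV) :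
    D ∈ opSpace U V := by
  intro u hu
  obtain ⟨E, hE, hE1⟩ := hS.exists_opsInto_apply_zero hu
  obtain ⟨Θ', hΘ'⟩ := hS.exists_actX hL hψU hU ((hS.symb_mem_iff E).mpr hE)
  obtain ⟨F, hF, hFact⟩ := exists_row_comp E D
  set Θ₁ : Matrix (Fin 1) (Fin r) DiffOp := fun _ => Θ'
  have h1 : (fun j => (F j).symb) = bakerStar (bakerAct Θ₁ ψU) D 0 := by
    ext1 j
    rw [hF, bakerStar]
    exact Finset.sum_congr rfl fun k _ => congrArg _ (hΘ' k)
  have hFV : F ∈ opsInto V := by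
    rw [← hT.symb_mem_iff, h1, bakerAct_bakerStar, h]
    exact bakerAct_mem_bakerModule _ (bakerAct_mem_bakerModule _ hV) _
  have h2 := hFV 1
  rw [map_one, hFact] at h2
  convert h2 using 2
  ext1 k
  exact (hE1 k).symm

end Equivalence

end VecGr

end

/-! ### The main theorem. -/

theorem mainTheorem12 (r s : ℕ)
    (U : Submodule ℂ (Fin r → RatFunc ℂ)) (hU : U ∈ AdelicGrassmannian r)
    (V : Submodule ℂ (Fin s → RatFunc ℂ)) (hV : V ∈ AdelicGrassmannian s)
    (D : Matrix (Fin r) (Fin s) DiffOp) :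
    (∃! ψU, IsStationaryBaker U ψU) ∧ (∃! ψV, IsStationaryBaker V ψV) ∧
    ∀ ψU ψV, IsStationaryBaker U ψU → IsStationaryBaker V ψV →
      IsUnit (waveOperator ψV) ∧
      List.TFAE [
        D ∈ opSpace U V,
        ∃ Θ : Matrix (Fin r) (Fin s) DiffOp, bakerStar ψU D = bakerAct Θ ψV,
        IsDifferential
          (waveOperator ψU * D.map DiffOp.bisp * Ring.inverse (waveOperator ψV))] ∧
      (∀ Θ Θ' : Matrix (Fin r) (Fin s) DiffOp,
        bakerStar ψU D = bakerAct Θ ψV → bakerStar ψU D = bakerAct Θ' ψV → Θ = Θ') ∧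
      ∀ Θ : Matrix (Fin r) (Fin s) DiffOp, bakerStar ψU D = bakerAct Θ ψV →
        Θ.map DiffOp.toPsiDO =
          waveOperator ψU * D.map DiffOp.bisp * Ring.inverse (waveOperator ψV) := by
  obtain ⟨S, hS⟩ := hU.2.1.exists_pointConditions
  obtain ⟨T, hT⟩ := hV.2.1.exists_pointConditions
  refine ⟨hS.existsUnique_isStationaryBaker hU, hT.existsUnique_isStationaryBaker hV,
    fun ψU ψV hψU hψV => ?_⟩
  have hunit := hψV.isNormalized.isUnit_waveOperator
  have hiff := bakerStar_eq_bakerAct_iff ψU hunit D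
  have hmemU := hS.row_mem_bakerModule hU.1 hψU
  have hmemV := hT.row_mem_bakerModule hV.1 hψV
  refine ⟨hunit, ?_, fun Θ Θ' h h' => ?_, fun Θ => (hiff Θ).mp⟩
  · tfae_have 1 → 2 :=
      exists_bakerStar_eq_bakerAct hS hT hV.2.2.le hmemU hψV.isNormalized hmemV
    tfae_have 2 → 1 := fun ⟨_, h⟩ =>
      mem_opSpace_of_bakerStar_eq hS hT hU.2.2.le hψU.isNormalized hmemU hmemV h
    tfae_have 2 ↔ 3 := exists_congr fun Θ => (hiff Θ).trans eq_comm
    tfae_finish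
  · ext1 i j
    exact toPsiDO_injective
      (congrFun (congrFun (((hiff Θ).mp h).trans ((hiff Θ').mp h').symm) i) j)
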